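/- **The category $\mathsf{TOF}$.** Let $\mathsf{TOF}$ be the strict symmetric monoidal category with objects the natural numbers ($n\otimes m=n+m$, unit $0$) presented by the generators $|1\rangle:0\to 1$, $\langle 1|:1\to 0$ and $\mathsf{tof}:3\to 3$, subject to the identities below. Composition $fg$ is diagrammatic (first $f$, then $g$), wires are numbered $1,2,\dots$ from the top, $1_n$ is the identity on $n$ wires and $c$ is the symmetry. For distinct wires $i,j,k$ write $\mathsf{tof}_{ij\to k}$ for the Toffoli gate applied, by means of symmetries, with its first two legs (controls) on $i,j$ and its third leg (target) on $k$. Put $\mathsf{cnot}:=(|1\rangle\otimes 1_2)\,\mathsf{tof}\,(\langle 1|\otimes 1_2):2\to2$, $\mathsf{not}:=(|1\rangle\otimes 1_1)\,\mathsf{cnot}\,(\langle 1|\otimes 1_1)$, $|0\rangle:=|1\rangle\,\mathsf{not}$, $\langle 0|:=\mathsf{not}\,\langle 1|$, and let $\mathsf{cnot}_{i\to j}$ be $\mathsf{cnot}$ with control $i$ and target $j$. The identities are: 1. $(|1\rangle\otimes 1_2)\,\mathsf{tof}=|1\rangle\otimes\mathsf{cnot}$ and $\mathsf{tof}\,(\langle1|\otimes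 1_2)=\langle1|\otimes\mathsf{cnot}$; 2. $(|0\rangle\otimes 1_2)\,\mathsf{tof}=|0\rangle\otimes 1_2$ and $\mathsf{tof}\,(\langle0|\otimes 1_2)=\langle0|\otimes 1_2$; 3. $\mathsf{tof}_{12\to3}\mathsf{tof}_{54\to3}=\mathsf{tof}_{54\to3}\mathsf{tof}_{12\to3}$ (five wires); 4. $\mathsf{tof}_{32\to1}\mathsf{tof}_{34\to5}=\mathsf{tof}_{34\to5}\mathsf{tof}_{32\to1}$ (five wires); 5. $\mathsf{tof}_{32\to1}\mathsf{tof}_{23\to4}=\mathsf{tof}_{23\to4}\mathsf{tof}_{32\to1}$ (four wires); 6. $\mathsf{tof}_{13\to4}\mathsf{tof}_{23\to4}=\mathsf{tof}_{23\to4}\mathsf{tof}_{13\to4}$ (four wires); 7. $(1_2\otimes|1\rangle)\,\mathsf{cnot}_{1\to3}\,(1_2\otimes\langle0|)\,(1_2\otimes|1\rangle)\,\mathsf{cnot}_{2\to3}\,(1_2\otimes\langle0|)=(1_2\otimes|1\rangle)\,\mathsf{tof}\,(1_2\otimes\langle0|)$; 8. $(|1\rangle\langle0|)\otimes 1_1=(|1\rangle\langle0|)\otimes(\langle1|\,|1\rangle)$,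 where $|1\rangle\langle0|:0\to0$ and $\langle1|\,|1\rangle:1\to1$ are diagrammatic composites; 9. $|1\rangle\langle1|=1_0$ (diagrammatic composite $0\to1\to0$); 10. $\mathsf{tof}\,\mathsf{tof}=1_3$; 11. $\mathsf{tof}_{23\to4}\mathsf{tof}_{12\to3}\mathsf{tof}_{23\to4}=\mathsf{tof}_{12\to4}\mathsf{tof}_{12\to3}$ (four wires); 12. $\mathsf{cnot}_{1\to2}\mathsf{tof}_{23\to4}\mathsf{cnot}_{1\to2}=\mathsf{tof}_{13\to4}\mathsf{tof}_{23\to4}$ (four wires); 13. $\mathsf{tof}_{12\to3}\mathsf{tof}_{23\to4}\mathsf{tof}_{12\to3}=\mathsf{tof}_{12\to4}\mathsf{tof}_{23\to4}$ (four wires); 14. $\mathsf{tof}_{12\to3}\mathsf{cnot}_{3\to4}\mathsf{tof}_{12\to3}=\mathsf{tof}_{12\to4}\mathsf{cnot}_{3\to4}$ (four wires); 15. $\mathsf{cnot}_{1\to2}\mathsf{cnot}_{2\to1}\mathsf{cnot}_{1\to2}=c_{1,1}$; 16. $\mathsf{tof}=(c_{1,1}\otimes1_1)\,\mathsf{tof}\,(c_{1,1}\otimes1_1)$;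 17. $K=(1_1\otimes c_{1,1}\otimes1_1)\,K\,(1_1\otimes c_{1,1}\otimes1_1)$, where $K:=(1_2\otimes|0\rangle\otimes1_2)\,\mathsf{tof}_{12\to3}\mathsf{tof}_{34\to5}\mathsf{tof}_{12\to3}\,(1_2\otimes\langle0|\otimes1_2):4\to4$. **Discrete inverse categories.** An inverse category is a category with an identity-on-objects contravariant functor $(\_)^\circ$ with $f^{\circ\circ}=f$, $ff^\circ f=f$ and $ff^\circ gg^\circ=gg^\circ ff^\circ$; a map $f:A\to B$ is total if $ff^\circ=1_A$. A discrete inverse category is a symmetric monoidal inverse category whose tensor preserves $(\_)^\circ$, with a total natural transformation $\Delta_A:A\to A\otimes A$ which is cocommutative, coassociative, semi-Frobenius ($(\Delta\otimes1)(1\otimes\Delta^\circ)=\Delta^\circ\Delta=(1\otimes\Delta)(\Delta^\circ\otimes1)$ up to associators) and uniform-copying ($\Delta_{A\otimes B}$ is $\Delta_A\otimes\Delta_B$ followed by the exchange of the two middle factors). A discrete inverse equivalence is a strong symmetric monoidal functor preserving $(\_)^\circ$ and $\Delta$ which has an inverse of the same kind up to monoidal natural isomorphisms. Let $\mathsf{FPinj}_2$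 be the category of sets with $2^n$ elements ($n\in\mathbb N$) and partial injective functions, a discrete inverse category with the cartesian product of sets as tensor, partial inverses as $(\_)^\circ$ and $\Delta(x)=(x,x)$. **Theorem.** $\mathsf{TOF}$ is a discrete inverse category, where $(\_)^\circ$ flips circuits horizontally ($|1\rangle\leftrightarrow\langle1|$, $\mathsf{tof}\mapsto\mathsf{tof}$) and $\Delta$ is given by $\Delta_0=1_0$, $\Delta_1=(1_1\otimes|0\rangle)\,\mathsf{cnot}$, $\Delta_{n+1}=(\Delta_n\otimes\Delta_1)(1_n\otimes c_{n,1}\otimes1_1)$. For every $n$, the map $(x_1,\dots,x_n)\mapsto|x_1,\dots,x_n\rangle:=|x_1\rangle\otimes\cdots\otimes|x_n\rangle$ is a bijection from $\{0,1\}^n$ onto the set of total maps $0\to n$. The functor $\tilde H_0$ which sends $n$ to the set of total points $p:0\to n$, and $f:n\to m$ to the partial function $p\mapsto pf$ (defined when $pf$ is total), is a discrete inverse equivalence $$\tilde H_0:\mathsf{TOF}\longrightarrow\mathsf{FPinj}_2 .$$ On total points circuits take their usual values: $|x\rangle f=|y\rangle$ if and only if $f$, read as a partial Boolean function in which $|1\rangle$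 produces the bit $1$, $\langle1|$ is defined on the bit $1$ only, and $\mathsf{tof}(x_1,x_2,x_3)=(x_1,x_2,x_1x_2+x_3)$, is defined at $x$ with value $y$. In particular the set of identities is complete: two circuits $n\to m$ are equal in $\mathsf{TOF}$ if and only if they define the same partial function; and for every partial injective function $\varphi:\{0,1\}^n\rightharpoonup\{0,1\}^m$ there is exactly one map $f:n\to m$ of $\mathsf{TOF}$ such that, for all $x,y$, $|x\rangle f=|y\rangle$ if and only if $\varphi(x)=y$. -/

import Mathlib

open CategoryTheory MonoidalCategory

universe v u v' u'

/-! ### Inverse categories and discrete inverse categories -/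

/-- The structure of an inverse category: an identity-on-objects contravariant involution `f ↦ f°`
with `f f° f = f` and `f f° g g° = g g° f f°`.  Composition `≫` is in diagrammatic order. -/
structure InverseStructure (C : Type u) [Category.{v} C] where
  dagger : ∀ {X Y : C}, (X ⟶ Y) → (Y ⟶ X)
  dagger_id : ∀ X : C, dagger (𝟙 X) = 𝟙 X
  dagger_comp : ∀ {X Y Z : C} (f : X ⟶ Y) (g : Y ⟶ Z), dagger (f ≫ g) = dagger g ≫ dagger f
  dagger_dagger : ∀ {X Y : C} (f : X ⟶ Y), dagger (dagger f) = f
  comp_dagger_comp : ∀ {X Y : C} (f : X ⟶ Y), f ≫ dagger f ≫ f = f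
  idem_comm : ∀ {X Y Z : C} (f : X ⟶ Y) (g : X ⟶ Z),
    (f ≫ dagger f) ≫ (g ≫ dagger g) = (g ≫ dagger g) ≫ (f ≫ dagger f)

namespace InverseStructure

variable {C : Type u} [Category.{v} C] (I : InverseStructure C)

/-- The restriction `f f°` of a map `f`. -/
def restriction {X Y : C} (f : X ⟶ Y) : X ⟶ X := f ≫ I.dagger f

/-- A map is total when its restriction is the identity. -/
def IsTotal {X Y : C} (f : X ⟶ Y) : Prop := I.restriction f = 𝟙 X

theorem isTotal_of_comp {X Y Z : C} {f : X ⟶ Y} {g : Y ⟶ Z} (h : I.IsTotal (f ≫ g)) :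
    I.IsTotal f := by
  unfold IsTotal restriction at *
  rw [I.dagger_comp] at h
  calc f ≫ I.dagger f = (f ≫ I.dagger f) ≫ ((f ≫ g) ≫ I.dagger g ≫ I.dagger f) := by
        rw [h, Category.comp_id]
    _ = (f ≫ I.dagger f ≫ f) ≫ g ≫ I.dagger g ≫ I.dagger f := by simp only [Category.assoc]
    _ = 𝟙 X := by rw [I.comp_dagger_comp, ← h]; simp only [Category.assoc]

/-- If `p` and `p f` are total then `p f f° = p`. -/
theorem comp_comp_dagger {X Y Z : C} {p : X ⟶ Y} {f : Y ⟶ Z} (hpf : I.IsTotal (p ≫ f)) :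
    (p ≫ f) ≫ I.dagger f = p := by
  unfold IsTotal restriction at *
  rw [I.dagger_comp] at hpf
  have hc := I.idem_comm f (I.dagger p)
  rw [I.dagger_dagger] at hc
  calc (p ≫ f) ≫ I.dagger f = (p ≫ I.dagger p ≫ p) ≫ f ≫ I.dagger f := by
        rw [I.comp_dagger_comp, Category.assoc]
    _ = p ≫ ((I.dagger p ≫ p) ≫ (f ≫ I.dagger f)) := by simp only [Category.assoc]
    _ = p ≫ ((f ≫ I.dagger f) ≫ (I.dagger p ≫ p)) := by rw [hc]
    _ = ((p ≫ f) ≫ I.dagger f ≫ I.dagger p) ≫ p := by simp only [Category.assoc]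
    _ = p := by rw [hpf, Category.id_comp]

end InverseStructure

/-- The structure of a discrete inverse category on a symmetric monoidal category: an inverse
category whose tensor preserves `(_)°`, with inverse products, that is, a total natural diagonal
which is cocommutative, coassociative, semi-Frobenius and uniform-copying. -/
structure DiscreteInverseStructure (C : Type u) [Category.{v} C] [MonoidalCategory C]
    [SymmetricCategory C] extends InverseStructure C where
  dagger_tensor : ∀ {X Y X' Y' : C} (f : X ⟶ Y) (g : X' ⟶ Y'),
    dagger (f ⊗ₘ g) = dagger f ⊗ₘ dagger g
  diag : ∀ X : C, X ⟶ X ⊗ X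
  diag_total : ∀ X : C, toInverseStructure.IsTotal (diag X)
  diag_natural : ∀ {X Y : C} (f : X ⟶ Y), f ≫ diag Y = diag X ≫ (f ⊗ₘ f)
  diag_comm : ∀ X : C, diag X ≫ (β_ X X).hom = diag X
  diag_assoc : ∀ X : C,
    diag X ≫ (𝟙 X ⊗ₘ diag X) = diag X ≫ (diag X ⊗ₘ 𝟙 X) ≫ (α_ X X X).hom
  frobenius_left : ∀ X : C,
    (diag X ⊗ₘ 𝟙 X) ≫ (α_ X X X).hom ≫ (𝟙 X ⊗ₘ dagger (diag X)) = dagger (diag X) ≫ diag X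
  frobenius_right : ∀ X : C,
    (𝟙 X ⊗ₘ diag X) ≫ (α_ X X X).inv ≫ (dagger (diag X) ⊗ₘ 𝟙 X) = dagger (diag X) ≫ diag X
  diag_tensor : ∀ X Y : C, diag (X ⊗ Y) = (diag X ⊗ₘ diag Y) ≫ tensorμ X X Y Y

/-- A discrete inverse functor: a (strong) symmetric monoidal functor between discrete inverse
categories which preserves `(_)°` (hence restrictions) and the diagonals. -/
structure IsDiscreteInverseFunctor {C : Type u} [Category.{v} C] [MonoidalCategory C]
    [SymmetricCategory C] {D : Type u'} [Category.{v'} D] [MonoidalCategory D]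
    [SymmetricCategory D] (S : DiscreteInverseStructure C) (T : DiscreteInverseStructure D)
    (F : C ⥤ D) [F.Braided] : Prop where
  map_dagger : ∀ {X Y : C} (f : X ⟶ Y), F.map (S.dagger f) = T.dagger (F.map f)
  map_diag : ∀ X : C, F.map (S.diag X) = T.diag (F.obj X) ≫ Functor.LaxMonoidal.μ F X X

/-- `F` is a discrete inverse equivalence: it is a discrete inverse functor which has an inverse
discrete inverse functor up to monoidal natural isomorphisms. -/
def IsDiscreteInverseEquivalence {C : Type u} [Category.{v} C] [MonoidalCategory C]
    [SymmetricCategory C] {D : Type u'} [Category.{v'} D] [MonoidalCategory D]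
    [SymmetricCategory D] (S : DiscreteInverseStructure C) (T : DiscreteInverseStructure D)
    (F : C ⥤ D) : Prop :=
  ∃ (_ : F.Braided) (G : D ⥤ C) (_ : G.Braided) (η : 𝟭 C ≅ F ⋙ G) (ε : G ⋙ F ≅ 𝟭 D),
    IsDiscreteInverseFunctor S T F ∧ IsDiscreteInverseFunctor T S G ∧
      NatTrans.IsMonoidal η.hom ∧ NatTrans.IsMonoidal ε.hom

/-! ### Sets and partial injections -/

/-- The objects of the category of sets and partial isomorphisms. -/
structure Pinj : Type (v + 1) where
  carrier : Type v

namespace Pinj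

/-- Maps are partial injections, composed as partial functions. -/
instance : Category.{v} Pinj.{v} where
  Hom X Y := X.carrier ≃. Y.carrier
  id X := PEquiv.refl X.carrier
  comp f g := PEquiv.trans f g
  id_comp f := PEquiv.refl_trans f
  comp_id f := PEquiv.trans_refl f
  assoc f g h := PEquiv.trans_assoc f g h

/-- The value of a partial injection at a point (`none` where it is undefined). -/
def app {X Y : Pinj.{v}} (f : X ⟶ Y) (x : X.carrier) : Option Y.carrier :=
  (show X.carrier ≃. Y.carrier from f) x

@[simp] theorem app_id {X : Pinj.{v}} (x : X.carrier) : app (𝟙 X) x = some x := rfl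

@[simp] theorem app_comp {X Y Z : Pinj.{v}} (f : X ⟶ Y) (g : Y ⟶ Z) (x : X.carrier) :
    app (f ≫ g) x = (app f x).bind (app g) := rfl

theorem hom_ext {X Y : Pinj.{v}} {f g : X ⟶ Y} (h : ∀ x, app f x = app g x) : f = g :=
  PEquiv.ext h

theorem app_inj {X Y : Pinj.{v}} (f : X ⟶ Y) {x x' : X.carrier} {y : Y.carrier}
    (h : app f x = some y) (h' : app f x' = some y) : x = x' :=
  PEquiv.inj (f : X.carrier ≃. Y.carrier) h h'

/-- A partial function with a partial inverse. -/
def mk' {X Y : Pinj.{v}} (f : X.carrier → Option Y.carrier) (g : Y.carrier → Option X.carrier)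
    (h : ∀ x y, g y = some x ↔ f x = some y) : X ⟶ Y :=
  (⟨f, g, h⟩ : X.carrier ≃. Y.carrier)

@[simp] theorem app_mk' {X Y : Pinj.{v}} (f : X.carrier → Option Y.carrier)
    (g : Y.carrier → Option X.carrier) (h) (x : X.carrier) :
    app (mk' (X := X) (Y := Y) f g h) x = f x := rfl

/-- The partial inverse. -/
def inv {X Y : Pinj.{v}} (f : X ⟶ Y) : Y ⟶ X :=
  PEquiv.symm (show X.carrier ≃. Y.carrier from f)

theorem app_inv {X Y : Pinj.{v}} (f : X ⟶ Y) (x : X.carrier) (y : Y.carrier) :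
    app (inv f) y = some x ↔ app f x = some y :=
  PEquiv.eq_some_iff (show X.carrier ≃. Y.carrier from f)

/-- A bijection as an isomorphism of `Pinj`. -/
def isoOfEquiv {X Y : Pinj.{v}} (e : X.carrier ≃ Y.carrier) : X ≅ Y where
  hom := e.toPEquiv
  inv := e.symm.toPEquiv
  hom_inv_id := hom_ext fun x => by
    change some (e.symm (e x)) = some x
    rw [e.symm_apply_apply]
  inv_hom_id := hom_ext fun y => by
    change some (e (e.symm y)) = some y
    rw [e.apply_symm_apply]

@[simp] theorem app_isoOfEquiv_hom {X Y : Pinj.{v}} (e : X.carrier ≃ Y.carrier)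
    (x : X.carrier) : app (isoOfEquiv e).hom x = some (e x) := rfl

@[simp] theorem app_isoOfEquiv_inv {X Y : Pinj.{v}} (e : X.carrier ≃ Y.carrier)
    (y : Y.carrier) : app (isoOfEquiv e).inv y = some (e.symm y) := rfl

/-- The product of two partial functions, defined where both are. -/
def prodApp {A B A' B' : Type v} (f : A → Option B) (g : A' → Option B') (p : A × A') :
    Option (B × B') :=
  (f p.1).bind fun b => (g p.2).map fun b' => (b, b')

@[simp] theorem prodApp_eq_some {A B A' B' : Type v} (f : A → Option B) (g : A' → Option B')
    (p : A × A') (q : B × B') :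
    prodApp f g p = some q ↔ f p.1 = some q.1 ∧ g p.2 = some q.2 := by
  obtain ⟨a, a'⟩ := p
  obtain ⟨b, b'⟩ := q
  simp only [prodApp, Option.bind_eq_some_iff, Option.map_eq_some_iff, Prod.mk.injEq]
  constructor
  · rintro ⟨c, hc, c', hc', rfl, rfl⟩
    exact ⟨hc, hc'⟩
  · rintro ⟨h, h'⟩
    exact ⟨b, h, b', h', rfl, rfl⟩

/-- The tensor is the cartesian product of sets, with its usual structure maps. -/
instance : MonoidalCategoryStruct Pinj.{v} where
  tensorObj X Y := ⟨X.carrier × Y.carrier⟩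
  tensorHom {X Y X' Y'} f g := mk' (X := ⟨X.carrier × X'.carrier⟩) (Y := ⟨Y.carrier × Y'.carrier⟩)
    (prodApp (app f) (app g)) (prodApp (app (inv f)) (app (inv g)))
    (fun p q => by simp only [prodApp_eq_some, app_inv])
  whiskerLeft X Y Y' g := mk' (X := ⟨X.carrier × Y.carrier⟩) (Y := ⟨X.carrier × Y'.carrier⟩)
    (prodApp (app (𝟙 X)) (app g)) (prodApp (app (inv (𝟙 X))) (app (inv g)))
    (fun p q => by simp only [prodApp_eq_some, app_inv])
  whiskerRight {X X'} f Y := mk' (X := ⟨X.carrier × Y.carrier⟩) (Y := ⟨X'.carrier × Y.carrier⟩)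
    (prodApp (app f) (app (𝟙 Y))) (prodApp (app (inv f)) (app (inv (𝟙 Y))))
    (fun p q => by simp only [prodApp_eq_some, app_inv])
  tensorUnit := ⟨PUnit⟩
  associator X Y Z := isoOfEquiv (X := ⟨(X.carrier × Y.carrier) × Z.carrier⟩)
    (Y := ⟨X.carrier × (Y.carrier × Z.carrier)⟩) (Equiv.prodAssoc _ _ _)
  leftUnitor X := isoOfEquiv (X := ⟨PUnit × X.carrier⟩) (Equiv.punitProd _)
  rightUnitor X := isoOfEquiv (X := ⟨X.carrier × PUnit⟩) (Equiv.prodPUnit _)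

@[simp] theorem app_tensorHom {X Y X' Y' : Pinj.{v}} (f : X ⟶ Y) (g : X' ⟶ Y')
    (p : X.carrier × X'.carrier) : app (f ⊗ₘ g) p = prodApp (app f) (app g) p := rfl

@[simp] theorem app_associator_hom (X Y Z : Pinj.{v})
    (p : (X.carrier × Y.carrier) × Z.carrier) :
    app (α_ X Y Z).hom p = some (p.1.1, p.1.2, p.2) := rfl

@[simp] theorem app_associator_inv (X Y Z : Pinj.{v})
    (p : X.carrier × (Y.carrier × Z.carrier)) :
    app (α_ X Y Z).inv p = some ((p.1, p.2.1), p.2.2) := rfl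

@[simp] theorem app_leftUnitor_hom (X : Pinj.{v}) (p : PUnit × X.carrier) :
    app (λ_ X).hom p = some p.2 := rfl

@[simp] theorem app_rightUnitor_hom (X : Pinj.{v}) (p : X.carrier × PUnit) :
    app (ρ_ X).hom p = some p.1 := rfl

theorem hom_ext_iff_some {X Y : Pinj.{v}} {f g : X ⟶ Y}
    (h : ∀ x y, app f x = some y ↔ app g x = some y) : f = g :=
  hom_ext fun x => Option.ext fun y => h x y

instance : MonoidalCategory Pinj.{v} :=
  MonoidalCategory.ofTensorHom
    (id_tensorHom_id := fun _ _ => rfl)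
    (id_tensorHom := fun _ _ _ _ => rfl)
    (tensorHom_id := fun _ _ => rfl)
    (tensorHom_comp_tensorHom := fun f₁ f₂ g₁ g₂ => hom_ext_iff_some (by
      intro p r
      rw [app_comp, Option.bind_eq_some_iff]
      refine Iff.trans ?_ (prodApp_eq_some (app (f₁ ≫ g₁)) (app (f₂ ≫ g₂)) p r).symm
      simp only [app_comp, Option.bind_eq_some_iff]
      constructor
      · rintro ⟨q, hq, hr⟩
        obtain ⟨h1, h2⟩ := (prodApp_eq_some (app f₁) (app f₂) p q).1 hq
        obtain ⟨h3, h4⟩ := (prodApp_eq_some (app g₁) (app g₂) q r).1 hr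
        exact ⟨⟨q.1, h1, h3⟩, ⟨q.2, h2, h4⟩⟩
      · rintro ⟨⟨b, h1, h3⟩, ⟨b', h2, h4⟩⟩
        exact ⟨(b, b'), (prodApp_eq_some (app f₁) (app f₂) p (b, b')).2 ⟨h1, h2⟩,
          (prodApp_eq_some (app g₁) (app g₂) (b, b') r).2 ⟨h3, h4⟩⟩))
    (associator_naturality := fun f₁ f₂ f₃ => hom_ext (by
      rintro ⟨⟨a, b⟩, c⟩
      simp only [app_comp, app_tensorHom, app_associator_hom, prodApp, Option.bind_some]
      cases app f₁ a <;> cases app f₂ b <;> cases app f₃ c <;> rfl))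
    (leftUnitor_naturality := fun f => hom_ext (by
      rintro ⟨⟨⟩, a⟩
      simp only [app_comp, app_tensorHom, app_leftUnitor_hom, prodApp, Option.bind_some]
      change Option.bind (Option.bind (some PUnit.unit) _) _ = _
      cases app f a <;> rfl))
    (rightUnitor_naturality := fun f => hom_ext (by
      rintro ⟨a, ⟨⟩⟩
      simp only [app_comp, app_tensorHom, app_rightUnitor_hom, prodApp, Option.bind_some]
      cases app f a <;> rfl))
    (pentagon := fun _ _ _ _ => rfl)
    (triangle := fun _ _ => rfl)

/-- The symmetry exchanges the two components of a pair. -/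
instance : SymmetricCategory Pinj.{v} where
  braiding X Y := isoOfEquiv (X := ⟨X.carrier × Y.carrier⟩) (Y := ⟨Y.carrier × X.carrier⟩)
    (Equiv.prodComm _ _)
  braiding_naturality_right X Y Z f := hom_ext (by
    rintro ⟨a, b⟩
    change Option.bind ((app f b).map fun b' => (a, b')) (fun q => some (q.2, q.1)) =
      (app f b).bind fun b' => some (b', a)
    cases app f b <;> rfl)
  braiding_naturality_left f Z := hom_ext (by
    rintro ⟨a, b⟩
    change Option.bind ((app f a).bind fun a' => some (a', b)) (fun q => some (q.2, q.1)) =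
      (app f a).map fun a' => (b, a')
    cases app f a <;> rfl)
  hexagon_forward _ _ _ := rfl
  hexagon_reverse _ _ _ := rfl
  symmetry _ _ := rfl

@[simp] theorem app_braiding_hom (X Y : Pinj.{v}) (p : X.carrier × Y.carrier) :
    app (β_ X Y).hom p = some (p.2, p.1) := rfl

open Classical in
/-- The diagonal `x ↦ (x, x)`; its partial inverse is defined on the pairs `(x, x)`. -/
noncomputable def diag (X : Pinj.{v}) : X ⟶ X ⊗ X :=
  mk' (X := X) (Y := ⟨X.carrier × X.carrier⟩) (fun x => some (x, x))
    (fun p => if p.1 = p.2 then some p.1 else none)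
    (by
      rintro x ⟨a, b⟩
      by_cases h : a = b
      · subst h; simp [eq_comm]
      · simp only [h, if_false, Option.some.injEq, Prod.mk.injEq, reduceCtorEq, false_iff]
        rintro ⟨rfl, rfl⟩
        exact h rfl)

@[simp] theorem app_diag (X : Pinj.{v}) (x : X.carrier) : app (diag X) x = some (x, x) := rfl

theorem app_inv_diag (X : Pinj.{v}) (p : X.carrier × X.carrier) (x : X.carrier) :
    app (inv (diag X)) p = some x ↔ p = (x, x) := by
  rw [app_inv (diag X) x p, app_diag, Option.some.injEq, eq_comm]

theorem app_comp_inv {X Y : Pinj.{v}} (f : X ⟶ Y) (x x' : X.carrier) :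
    app (f ≫ inv f) x = some x' ↔ x = x' ∧ ∃ y, app f x = some y := by
  simp only [app_comp, Option.bind_eq_some_iff, app_inv]
  constructor
  · rintro ⟨y, h, h'⟩
    exact ⟨app_inj f h h', y, h⟩
  · rintro ⟨rfl, y, h⟩
    exact ⟨y, h, h⟩

/-- `Pinj` as a discrete inverse category. -/
noncomputable def discreteInverse : DiscreteInverseStructure Pinj.{v} where
  dagger f := inv f
  dagger_id _ := rfl
  dagger_comp f g := PEquiv.symm_trans_rev f g
  dagger_dagger _ := rfl
  comp_dagger_comp f := by
    rw [← Category.assoc]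
    refine hom_ext_iff_some fun x y => ?_
    rw [app_comp, Option.bind_eq_some_iff]
    simp only [app_comp_inv]
    constructor
    · rintro ⟨_, ⟨rfl, -⟩, h⟩
      exact h
    · intro h
      exact ⟨x, ⟨rfl, y, h⟩, h⟩
  idem_comm f g := by
    refine hom_ext_iff_some fun x y => ?_
    rw [app_comp (f ≫ inv f), app_comp (g ≫ inv g), Option.bind_eq_some_iff,
      Option.bind_eq_some_iff]
    simp only [app_comp_inv]
    constructor
    · rintro ⟨_, ⟨rfl, h⟩, rfl, h'⟩
      exact ⟨_, ⟨rfl, h'⟩, rfl, h⟩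
    · rintro ⟨_, ⟨rfl, h⟩, rfl, h'⟩
      exact ⟨_, ⟨rfl, h'⟩, rfl, h⟩
  dagger_tensor _ _ := rfl
  diag := diag
  diag_total X := by
    refine hom_ext_iff_some fun x y => ?_
    rw [InverseStructure.restriction, app_comp_inv, app_id, Option.some.injEq]
    exact ⟨fun h => h.1, fun h => ⟨h, _, rfl⟩⟩
  diag_natural f := hom_ext fun x => by
    simp only [app_comp, app_diag, app_tensorHom, Option.bind_some, prodApp]
    cases app f x <;> rfl
  diag_comm _ := hom_ext fun _ => rfl
  diag_assoc _ := hom_ext fun _ => rfl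
  frobenius_left X := by
    refine hom_ext_iff_some ?_
    rintro ⟨a, b⟩ ⟨c, d⟩
    simp only [app_comp, app_tensorHom, app_associator_hom, app_diag, app_id, prodApp,
      Option.bind_some, Option.map_some, Option.map_eq_some_iff, Option.bind_eq_some_iff,
      app_inv_diag, Option.some.injEq, Prod.mk.injEq]
    grind
  frobenius_right X := by
    refine hom_ext_iff_some ?_
    rintro ⟨a, b⟩ ⟨c, d⟩
    simp only [app_comp, app_tensorHom, app_associator_inv, app_diag, app_id, prodApp,
      Option.bind_some, Option.map_some, Option.bind_eq_some_iff,
      app_inv_diag, Option.some.injEq, Prod.mk.injEq]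
    grind
  diag_tensor _ _ := hom_ext fun _ => rfl

theorem dagger_eq {X Y : Pinj.{v}} (f : X ⟶ Y) : discreteInverse.dagger f = inv f := rfl

theorem diag_eq (X : Pinj.{v}) : discreteInverse.diag X = diag X := rfl

/-- Sets with `2 ^ n` elements for some `n`. -/
def IsPow2 : ObjectProperty Pinj.{v} := fun X => ∃ n : ℕ, Nat.card X.carrier = 2 ^ n

instance : (IsPow2.{v}).IsMonoidal where
  prop_unit := ⟨0, Nat.card_unique (α := PUnit.{v + 1})⟩
  prop_tensor X Y := by
    rintro ⟨m, hm⟩ ⟨n, hn⟩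
    exact ⟨m + n, by
      change Nat.card (X.carrier × Y.carrier) = _
      rw [Nat.card_prod, hm, hn, pow_add]⟩

end Pinj

/-- The full symmetric monoidal subcategory of `Pinj` on the sets whose number of elements is a
power of two. -/
abbrev FPinj₂ : Type 1 := (Pinj.IsPow2.{0}).FullSubcategory

theorem FPinj₂.braiding_hom (X Y : FPinj₂) : (β_ X Y).hom.hom = (β_ X.obj Y.obj).hom := rfl

theorem FPinj₂.tensorμ_hom (X X' Y Y' : FPinj₂) :
    (tensorμ X X' Y Y').hom = tensorμ X.obj X'.obj Y.obj Y'.obj := by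
  simp [tensorμ, FPinj₂.braiding_hom]

/-- The discrete inverse structure that `FPinj₂` has as a full monoidal subcategory of `Pinj`. -/
noncomputable def FPinj₂.discreteInverse : DiscreteInverseStructure FPinj₂ where
  dagger f := ObjectProperty.homMk (Pinj.inv f.hom)
  dagger_id _ := rfl
  dagger_comp f g := ObjectProperty.hom_ext _ (by
    simpa [Pinj.dagger_eq, Pinj.diag_eq, FPinj₂.braiding_hom, FPinj₂.tensorμ_hom]
      using Pinj.discreteInverse.dagger_comp f.hom g.hom)
  dagger_dagger _ := rfl
  comp_dagger_comp f := ObjectProperty.hom_ext _ (by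
    simpa [Pinj.dagger_eq, Pinj.diag_eq, FPinj₂.braiding_hom, FPinj₂.tensorμ_hom]
      using Pinj.discreteInverse.comp_dagger_comp f.hom)
  idem_comm f g := ObjectProperty.hom_ext _ (by
    simpa [Pinj.dagger_eq, Pinj.diag_eq, FPinj₂.braiding_hom, FPinj₂.tensorμ_hom]
      using Pinj.discreteInverse.idem_comm f.hom g.hom)
  dagger_tensor f g := ObjectProperty.hom_ext _ (by
    simpa [Pinj.dagger_eq, Pinj.diag_eq, FPinj₂.braiding_hom, FPinj₂.tensorμ_hom]
      using Pinj.discreteInverse.dagger_tensor f.hom g.hom)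
  diag X := ObjectProperty.homMk (Pinj.diag X.obj)
  diag_total X := ObjectProperty.hom_ext _ (Pinj.discreteInverse.diag_total X.obj :)
  diag_natural f := ObjectProperty.hom_ext _ (by
    simpa [Pinj.dagger_eq, Pinj.diag_eq, FPinj₂.braiding_hom, FPinj₂.tensorμ_hom]
      using Pinj.discreteInverse.diag_natural f.hom)
  diag_comm X := ObjectProperty.hom_ext _ (by
    simpa [Pinj.dagger_eq, Pinj.diag_eq, FPinj₂.braiding_hom, FPinj₂.tensorμ_hom]
      using Pinj.discreteInverse.diag_comm X.obj)
  diag_assoc X := ObjectProperty.hom_ext _ (by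
    simpa [Pinj.dagger_eq, Pinj.diag_eq, FPinj₂.braiding_hom, FPinj₂.tensorμ_hom]
      using Pinj.discreteInverse.diag_assoc X.obj)
  frobenius_left X := ObjectProperty.hom_ext _ (by
    simpa [Pinj.dagger_eq, Pinj.diag_eq, FPinj₂.braiding_hom, FPinj₂.tensorμ_hom]
      using Pinj.discreteInverse.frobenius_left X.obj)
  frobenius_right X := ObjectProperty.hom_ext _ (by
    simpa [Pinj.dagger_eq, Pinj.diag_eq, FPinj₂.braiding_hom, FPinj₂.tensorμ_hom]
      using Pinj.discreteInverse.frobenius_right X.obj)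
  diag_tensor X Y := ObjectProperty.hom_ext _ (by
    simpa [Pinj.dagger_eq, Pinj.diag_eq, FPinj₂.braiding_hom, FPinj₂.tensorμ_hom]
      using Pinj.discreteInverse.diag_tensor X.obj Y.obj)

/-! ### Evaluation on total points -/

namespace InverseStructure

variable {C : Type u} [Category.{v} C] (I : InverseStructure C)

/-- The total points `X ⟶ Y` of `Y`. -/
abbrev points (X Y : C) : Pinj.{v} := ⟨{p : X ⟶ Y // I.IsTotal p}⟩

open Classical in
/-- The partial action of `f : Y ⟶ Z` on total points: `p ↦ p f` if `p f` is total, and undefined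
otherwise. -/
noncomputable def evalPoint {X Y Z : C} (f : Y ⟶ Z) (p : (I.points X Y).carrier) :
    Option (I.points X Z).carrier :=
  if h : I.IsTotal (p.1 ≫ f) then some ⟨p.1 ≫ f, h⟩ else none

theorem evalPoint_eq_some {X Y Z : C} (f : Y ⟶ Z) (p : (I.points X Y).carrier)
    (q : (I.points X Z).carrier) : I.evalPoint f p = some q ↔ p.1 ≫ f = q.1 := by
  obtain ⟨q, hq⟩ := q
  unfold evalPoint
  by_cases h : I.IsTotal (p.1 ≫ f)
  · rw [dif_pos h]
    exact Option.some_inj.trans Subtype.mk_eq_mk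
  · rw [dif_neg h]
    simp only [reduceCtorEq, false_iff]
    rintro rfl
    exact h hq

/-- The functor which sends an object to its set of total points with source `X`, and a map to its
partial action on total points by composition. -/
noncomputable def pointFunctor (X : C) : C ⥤ Pinj.{v} where
  obj Y := I.points X Y
  map f := Pinj.mk' (I.evalPoint f) (I.evalPoint (I.dagger f)) (fun p q => by
    rw [evalPoint_eq_some, evalPoint_eq_some]
    constructor
    · intro h
      rw [← h]
      have := I.comp_comp_dagger (p := q.1) (f := I.dagger f) (by rw [h]; exact p.2)
      rwa [I.dagger_dagger] at this
    · intro h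
      rw [← h]
      exact I.comp_comp_dagger (by rw [h]; exact q.2))
  map_id Y := Pinj.hom_ext fun p => by
    rw [Pinj.app_mk', Pinj.app_id, evalPoint_eq_some, Category.comp_id]
  map_comp f g := Pinj.hom_ext_iff_some fun p r => by
    rw [Pinj.app_comp, Option.bind_eq_some_iff, Pinj.app_mk', evalPoint_eq_some]
    constructor
    · intro h
      have h' : I.IsTotal ((p.1 ≫ f) ≫ g) := by rw [Category.assoc, h]; exact r.2
      exact ⟨⟨p.1 ≫ f, I.isTotal_of_comp h'⟩, (I.evalPoint_eq_some _ _ _).2 rfl,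
        (I.evalPoint_eq_some _ _ _).2 (by rw [← h, Category.assoc])⟩
    · rintro ⟨q, hq, hr⟩
      rw [← (I.evalPoint_eq_some _ _ _).1 hr, ← (I.evalPoint_eq_some _ _ _).1 hq, Category.assoc]

end InverseStructure

/-! ### Circuits -/

/-- Circuit expressions with `n` input wires and `m` output wires.  `wire h` is the bundle of `n`
straight wires; it carries the equation `h : n = m` so that the strict associativity and unit laws
can be written down.  `swap n m` exchanges the first `n` wires with the last `m` wires. -/
inductive Circuit : ℕ → ℕ → Type
  | wire {n m : ℕ} (h : n = m) : Circuit n m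
  | comp {n m k : ℕ} (f : Circuit n m) (g : Circuit m k) : Circuit n k
  | tensor {n m n' m' : ℕ} (f : Circuit n m) (g : Circuit n' m') : Circuit (n + n') (m + m')
  | swap (n m : ℕ) : Circuit (n + m) (m + n)
  | ketOne : Circuit 0 1
  | braOne : Circuit 1 0
  | tof : Circuit 3 3

namespace Circuit

infixl:60 " ⨟ " => Circuit.comp
notation:70 f:70 " ⊠ " g:71 => (Circuit.tensor f g :)

/-- `n` parallel wires. -/
abbrev id (n : ℕ) : Circuit n n := wire rfl

/-- Two crossing wires. -/
def cross : Circuit 2 2 := swap 1 1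

/-- The controlled not gate; the first wire is the control. -/
def cnot : Circuit 2 2 := (ketOne ⊠ id 2) ⨟ tof ⨟ (braOne ⊠ id 2)

/-- The not gate. -/
def not : Circuit 1 1 := (ketOne ⊠ id 1) ⨟ cnot ⨟ (braOne ⊠ id 1)

/-- The input ancillary bit `|0⟩`. -/
def ketZero : Circuit 0 1 := ketOne ⨟ not

/-- The output ancillary bit `⟨0|`. -/
def braZero : Circuit 1 0 := not ⨟ braOne

/-- Exchange the first and the last of three wires. -/
def rev : Circuit 3 3 := (cross ⊠ id 1) ⨟ (id 1 ⊠ cross) ⨟ (cross ⊠ id 1)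

/-- The flipped Toffoli gate, with target the first wire. -/
def tofFlip : Circuit 3 3 := rev ⨟ tof ⨟ rev

/-- The flipped controlled not gate, with target the first wire. -/
def cnotFlip : Circuit 2 2 := cross ⨟ cnot ⨟ cross

/-- On three wires: controlled not with control the first wire and target the last. -/
def cnotGap : Circuit 3 3 := (id 1 ⊠ cross) ⨟ (cnot ⊠ id 1) ⨟ (id 1 ⊠ cross)

/-- On four wires: Toffoli gate with controls the first two wires and target the last. -/
def tofGapLow : Circuit 4 4 := (id 2 ⊠ cross) ⨟ (tof ⊠ id 1) ⨟ (id 2 ⊠ cross)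

/-- On four wires: Toffoli gate with controls the first and third wires and target the last. -/
def tofGapHigh : Circuit 4 4 := (cross ⊠ id 2) ⨟ (id 1 ⊠ tof) ⨟ (cross ⊠ id 2)

/-- The not gate controlled by three wires, built from Toffoli gates with a middle ancillary wire
which starts at `|0⟩` and ends at `⟨0|`. -/
def cccnot : Circuit 4 4 :=
  (id 2 ⊠ ketZero ⊠ id 2) ⨟ (tof ⊠ id 2) ⨟ (id 2 ⊠ tof) ⨟ (tof ⊠ id 2) ⨟ (id 2 ⊠ braZero ⊠ id 2)

/-- The identities imposed on circuits. -/
inductive Identity : {n m : ℕ} → Circuit n m → Circuit n m → Prop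
  | ketOne_tof : Identity ((ketOne ⊠ id 2) ⨟ tof) (ketOne ⊠ cnot)
  | tof_braOne : Identity (tof ⨟ (braOne ⊠ id 2)) (braOne ⊠ cnot)
  | ketZero_tof : Identity ((ketZero ⊠ id 2) ⨟ tof) (ketZero ⊠ id 2)
  | tof_braZero : Identity (tof ⨟ (braZero ⊠ id 2)) (braZero ⊠ id 2)
  | tof_comm_target : Identity ((tof ⊠ id 2) ⨟ (id 2 ⊠ tofFlip)) ((id 2 ⊠ tofFlip) ⨟ (tof ⊠ id 2))
  | tof_comm_control : Identity ((tofFlip ⊠ id 2) ⨟ (id 2 ⊠ tof)) ((id 2 ⊠ tof) ⨟ (tofFlip ⊠ id 2))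
  | tof_comm_controls : Identity ((tofFlip ⊠ id 1) ⨟ (id 1 ⊠ tof)) ((id 1 ⊠ tof) ⨟ (tofFlip ⊠ id 1))
  | tof_comm_both : Identity (tofGapHigh ⨟ (id 1 ⊠ tof)) ((id 1 ⊠ tof) ⨟ tofGapHigh)
  | meet : Identity
      ((id 2 ⊠ ketOne) ⨟ cnotGap ⨟ (id 2 ⊠ braZero) ⨟
        (id 2 ⊠ ketOne) ⨟ (id 1 ⊠ cnot) ⨟ (id 2 ⊠ braZero))
      ((id 2 ⊠ ketOne) ⨟ tof ⨟ (id 2 ⊠ braZero))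
  | cut : Identity ((ketOne ⨟ braZero) ⊠ id 1) ((ketOne ⨟ braZero) ⊠ (braOne ⨟ ketOne))
  | ketOne_braOne : Identity (ketOne ⨟ braOne) (id 0)
  | tof_tof : Identity (tof ⨟ tof) (id 3)
  | push_tof_target : Identity ((id 1 ⊠ tof) ⨟ (tof ⊠ id 1) ⨟ (id 1 ⊠ tof)) (tofGapLow ⨟ (tof ⊠ id 1))
  | push_cnot_control :
      Identity ((cnot ⊠ id 2) ⨟ (id 1 ⊠ tof) ⨟ (cnot ⊠ id 2)) (tofGapHigh ⨟ (id 1 ⊠ tof))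
  | push_tof_control : Identity ((tof ⊠ id 1) ⨟ (id 1 ⊠ tof) ⨟ (tof ⊠ id 1)) (tofGapLow ⨟ (id 1 ⊠ tof))
  | push_tof_cnot : Identity ((tof ⊠ id 1) ⨟ (id 2 ⊠ cnot) ⨟ (tof ⊠ id 1)) (tofGapLow ⨟ (id 2 ⊠ cnot))
  | cnot_cross : Identity (cnot ⨟ cnotFlip ⨟ cnot) cross
  | tof_cross : Identity tof ((cross ⊠ id 1) ⨟ tof ⨟ (cross ⊠ id 1))
  | cccnot_cross : Identity cccnot ((id 1 ⊠ cross ⊠ id 1) ⨟ cccnot ⨟ (id 1 ⊠ cross ⊠ id 1))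

/-- Provable equality of circuits: the least congruence which contains the imposed identities and
the laws of a strict symmetric monoidal category. -/
inductive Eqv : {n m : ℕ} → Circuit n m → Circuit n m → Prop
  | ax {n m : ℕ} {f g : Circuit n m} : Identity f g → Eqv f g
  | refl {n m : ℕ} (f : Circuit n m) : Eqv f f
  | symm {n m : ℕ} {f g : Circuit n m} : Eqv f g → Eqv g f
  | trans {n m : ℕ} {f g h : Circuit n m} : Eqv f g → Eqv g h → Eqv f h
  | comp {n m k : ℕ} {f f' : Circuit n m} {g g' : Circuit m k} :
      Eqv f f' → Eqv g g' → Eqv (f ⨟ g) (f' ⨟ g')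
  | tensor {n m n' m' : ℕ} {f f' : Circuit n m} {g g' : Circuit n' m'} :
      Eqv f f' → Eqv g g' → Eqv (f ⊠ g) (f' ⊠ g')
  | id_comp {n m : ℕ} (f : Circuit n m) : Eqv (id n ⨟ f) f
  | comp_id {n m : ℕ} (f : Circuit n m) : Eqv (f ⨟ id m) f
  | assoc {n m k l : ℕ} (f : Circuit n m) (g : Circuit m k) (h : Circuit k l) :
      Eqv (f ⨟ g ⨟ h) (f ⨟ (g ⨟ h))
  | tensor_id (n m : ℕ) : Eqv (id n ⊠ id m) (id (n + m))
  | interchange {n m k n' m' k' : ℕ} (f : Circuit n m) (g : Circuit m k) (f' : Circuit n' m')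
      (g' : Circuit m' k') : Eqv ((f ⊠ f') ⨟ (g ⊠ g')) ((f ⨟ g) ⊠ (f' ⨟ g'))
  | tensor_assoc {n m n' m' n'' m'' : ℕ} (f : Circuit n m) (g : Circuit n' m')
      (h : Circuit n'' m'') :
      Eqv ((f ⊠ g ⊠ h) ⨟ wire (add_assoc m m' m'')) (wire (add_assoc n n' n'') ⨟ (f ⊠ (g ⊠ h)))
  | id_zero_tensor {n m : ℕ} (f : Circuit n m) :
      Eqv ((id 0 ⊠ f) ⨟ wire (zero_add m)) (wire (zero_add n) ⨟ f)
  | tensor_id_zero {n m : ℕ} (f : Circuit n m) :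
      Eqv ((f ⊠ id 0) ⨟ wire (add_zero m)) (wire (add_zero n) ⨟ f)
  | swap_natural {n m n' m' : ℕ} (f : Circuit n m) (g : Circuit n' m') :
      Eqv ((f ⊠ g) ⨟ swap m m') (swap n n' ⨟ (g ⊠ f))
  | swap_swap (n m : ℕ) : Eqv (swap n m ⨟ swap m n) (id (n + m))
  | hexagon (n m k : ℕ) :
      Eqv (wire (add_assoc n m k) ⨟ (swap n (m + k) ⨟ wire (add_assoc m k n)))
        ((swap n m ⊠ id k) ⨟ (wire (add_assoc m n k) ⨟ (id m ⊠ swap n k)))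

/-- The horizontal flip of a circuit, which exchanges inputs and outputs. -/
def flip : {n m : ℕ} → Circuit n m → Circuit m n
  | _, _, wire h => wire h.symm
  | _, _, comp f g => comp g.flip f.flip
  | _, _, tensor f g => tensor f.flip g.flip
  | _, _, swap n m => swap m n
  | _, _, ketOne => braOne
  | _, _, braOne => ketOne
  | _, _, tof => tof

/-- The value of a circuit on bits, `none` where it is undefined: `⟨1|` is defined on the bit `1`
only, and the Toffoli gate maps `(x₁, x₂, x₃)` to `(x₁, x₂, x₁ x₂ + x₃)`. -/
def eval : {n m : ℕ} → Circuit n m → (Fin n → Bool) → Option (Fin m → Bool)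
  | _, _, wire h, x => some fun i => x (Fin.cast h.symm i)
  | _, _, comp f g, x => (eval f x).bind (eval g)
  | _, _, tensor (n := n) (n' := n') f g, x =>
      (eval f fun i => x (Fin.castAdd n' i)).bind fun y =>
        (eval g fun i => x (Fin.natAdd n i)).map fun y' => Fin.append y y'
  | _, _, swap n m, x =>
      some (Fin.append (fun i => x (Fin.natAdd n i)) (fun i => x (Fin.castAdd m i)))
  | _, _, ketOne, _ => some ![true]
  | _, _, braOne, x => if x 0 = true then some ![] else none
  | _, _, tof, x => some ![x 0, x 1, xor (x 0 && x 1) (x 2)]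

/-- The input ancillary bit with the given value. -/
def ketBit (b : Bool) : Circuit 0 1 := if b then ketOne else ketZero

/-- The iterated tensor `|x₁⟩ ⊗ ⋯ ⊗ |xₙ⟩` of input ancillary bits. -/
def ket : (n : ℕ) → (Fin n → Bool) → Circuit 0 n
  | 0, _ => id 0
  | n + 1, x => ket n (Fin.init x) ⊠ ketBit (x (Fin.last n))

/-- Circuits up to provable equality. -/
instance setoid (n m : ℕ) : Setoid (Circuit n m) where
  r := Eqv
  iseqv := ⟨Eqv.refl, Eqv.symm, Eqv.trans⟩

end Circuit

/-! ### The symmetric monoidal category presented by the circuits -/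

/-- The objects are the natural numbers. -/
structure TOF : Type where
  wires : ℕ

namespace TOF

open Circuit

/-- Maps are circuits up to provable equality, with composition of circuits. -/
instance : Category.{0} TOF where
  Hom X Y := Quotient (Circuit.setoid X.wires Y.wires)
  id X := Quotient.mk _ (Circuit.id X.wires)
  comp := Quotient.map₂ Circuit.comp fun _ _ h _ _ h' => Eqv.comp h h'
  id_comp := by rintro _ _ ⟨f⟩; exact Quotient.sound (Eqv.id_comp f)
  comp_id := by rintro _ _ ⟨f⟩; exact Quotient.sound (Eqv.comp_id f)
  assoc := by rintro _ _ _ _ ⟨f⟩ ⟨g⟩ ⟨h⟩; exact Quotient.sound (Eqv.assoc f g h)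

/-- The map presented by a circuit. -/
def ofCircuit {n m : ℕ} (f : Circuit n m) : (TOF.mk n) ⟶ (TOF.mk m) := Quotient.mk _ f

theorem ofCircuit_eq_iff {n m : ℕ} (f g : Circuit n m) :
    ofCircuit f = ofCircuit g ↔ Eqv f g := Quotient.eq

theorem sound {n m : ℕ} {f g : Circuit n m} (h : Eqv f g) : ofCircuit f = ofCircuit g :=
  Quotient.sound h

theorem wire_comp {n m k : ℕ} (h : n = m) (h' : m = k) :
    Eqv (wire h ⨟ wire h') (wire (h.trans h')) := by
  subst h; exact Eqv.id_comp _

theorem wire_tensor {n m n' m' : ℕ} (h : n = m) (h' : n' = m') :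
    Eqv (wire h ⊠ wire h') (wire (congrArg₂ (· + ·) h h')) := by
  subst h; subst h'; exact Eqv.tensor_id _ _

/-- Straight wires as an isomorphism. -/
def wireIso {n m : ℕ} (h : n = m) : (TOF.mk n) ≅ (TOF.mk m) where
  hom := ofCircuit (wire h)
  inv := ofCircuit (wire h.symm)
  hom_inv_id := sound (wire_comp _ _)
  inv_hom_id := sound (wire_comp _ _)

/-- The tensor is addition on objects and juxtaposition of circuits on maps; all structure maps are
straight wires. -/
instance : MonoidalCategoryStruct TOF where
  tensorObj X Y := ⟨X.wires + Y.wires⟩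
  tensorHom := Quotient.map₂ Circuit.tensor fun _ _ h _ _ h' => Eqv.tensor h h'
  whiskerLeft X _ _ g :=
    Quotient.map (fun g => Circuit.id X.wires ⊠ g) (fun _ _ h => Eqv.tensor (Eqv.refl _) h) g
  whiskerRight f Y :=
    Quotient.map (fun f => f ⊠ Circuit.id Y.wires) (fun _ _ h => Eqv.tensor h (Eqv.refl _)) f
  tensorUnit := ⟨0⟩
  associator X Y Z := wireIso (add_assoc X.wires Y.wires Z.wires)
  leftUnitor X := wireIso (zero_add X.wires)
  rightUnitor X := wireIso (add_zero X.wires)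

instance : MonoidalCategory TOF :=
  MonoidalCategory.ofTensorHom
    (id_tensorHom_id := fun _ _ => sound (Eqv.tensor_id _ _))
    (id_tensorHom := by rintro X Y Z ⟨f⟩; rfl)
    (tensorHom_id := by rintro X Y ⟨f⟩ Z; rfl)
    (tensorHom_comp_tensorHom := by
      rintro _ _ _ _ _ _ ⟨f⟩ ⟨f'⟩ ⟨g⟩ ⟨g'⟩; exact sound (Eqv.interchange f g f' g'))
    (associator_naturality := by
      rintro _ _ _ _ _ _ ⟨f⟩ ⟨g⟩ ⟨h⟩; exact sound (Eqv.tensor_assoc f g h))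
    (leftUnitor_naturality := by rintro _ _ ⟨f⟩; exact sound (Eqv.id_zero_tensor f))
    (rightUnitor_naturality := by rintro _ _ ⟨f⟩; exact sound (Eqv.tensor_id_zero f))
    (pentagon := fun W X Y Z => sound <|
      ((Eqv.comp (wire_tensor _ _) ((Eqv.comp (Eqv.refl _) (wire_tensor _ _)).trans
        (wire_comp _ _))).trans (wire_comp _ _)).trans (wire_comp _ _).symm)
    (triangle := fun X Y => sound <|
      ((Eqv.comp (Eqv.refl _) (wire_tensor _ _)).trans (wire_comp _ _)).trans
        (wire_tensor _ _).symm)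

/-- The crossing of two bundles of wires, as an isomorphism. -/
def swapIso (X Y : TOF) : X ⊗ Y ≅ Y ⊗ X where
  hom := ofCircuit (swap X.wires Y.wires)
  inv := ofCircuit (swap Y.wires X.wires)
  hom_inv_id := sound (Eqv.swap_swap _ _)
  inv_hom_id := sound (Eqv.swap_swap _ _)

theorem hexagon_iso (X Y Z : TOF) :
    α_ X Y Z ≪≫ swapIso X (Y ⊗ Z) ≪≫ α_ Y Z X =
      whiskerRightIso (swapIso X Y) Z ≪≫ α_ Y X Z ≪≫ whiskerLeftIso Y (swapIso X Z) :=
  Iso.ext (sound (Eqv.hexagon X.wires Y.wires Z.wires))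

/-- The braiding is the crossing of two bundles of wires. -/
instance : BraidedCategory TOF where
  braiding := swapIso
  braiding_naturality_right := by
    rintro X Y Z ⟨f⟩; exact sound (Eqv.swap_natural (Circuit.id X.wires) f)
  braiding_naturality_left := by
    rintro X Y ⟨f⟩ Z; exact sound (Eqv.swap_natural f (Circuit.id Z.wires))
  hexagon_forward X Y Z := congrArg Iso.hom (hexagon_iso X Y Z)
  hexagon_reverse X Y Z := by
    have h := congrArg Iso.inv (hexagon_iso Z X Y)
    simp only [Iso.trans_inv, Category.assoc] at h
    exact h

instance : SymmetricCategory TOF where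
  symmetry _ _ := sound (Eqv.swap_swap _ _)

/-- The diagonal `|x⟩ ↦ |x, x⟩` on one wire. -/
def diagOne : TOF.mk 1 ⟶ TOF.mk 1 ⊗ TOF.mk 1 :=
  ofCircuit ((Circuit.id 1 ⊠ ketZero) ⨟ cnot)

/-- The diagonals, by induction on the number of wires. -/
def diag : (n : ℕ) → (TOF.mk n ⟶ TOF.mk n ⊗ TOF.mk n)
  | 0 => 𝟙 (TOF.mk 0)
  | 1 => diagOne
  | n + 2 =>
      (show TOF.mk (n + 1) ⊗ TOF.mk 1 ⟶ _ from (diag (n + 1) ⊗ₘ diagOne)) ≫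
        tensorμ (TOF.mk (n + 1)) (TOF.mk (n + 1)) (TOF.mk 1) (TOF.mk 1)

/-- The point `|x₁, …, xₙ⟩`. -/
def ket (n : ℕ) (x : Fin n → Bool) : TOF.mk 0 ⟶ TOF.mk n := ofCircuit (Circuit.ket n x)

end TOF

/-! Soundness of the values is a finite check on each identity. The content is completeness:
circuits with the same values are provably equal. It is obtained from a normal form. Given a domain
`d`, a function `φ` and a `ψ` with `ψ (φ x) = x` on `d`, the map `normal d φ ψ` projects the input
`x` to `d`, computes `φ x` on fresh zero wires while keeping `x`, adds `ψ (φ x)` to the input wires,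
which resets them to zero, and ends these wires with zeros. By `normal_congr` the result depends
only on `d`, on `φ` over `d` and on `ψ` over `φ(d)`, and all of this can be read off from the values
(`evalHom_normal`). Every map has such a form: the identity does (`normal_id`, a swap made of
controlled nots), Toffoli gates together with `|1⟩`, `⟨1|` and straight wires generate everything
(`gen`), and composing a normal form with a generator gives a normal form (`IsNormal.comp`). Hence
values are faithful (`evalHom_injective`). The same formula realises every partial injection
(`exists_evalHom`).

Normal forms are handled through oracles `U w s h`, which add a Boolean function `h` of the wires
`w` to the wire `s`. They are built by recursion from `h = low h + xₙ · diff h`, the product being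
formed with a zero ancilla that is computed and uncomputed. The identities of the presentation yield
a calculus: oracles commute when neither writes on a wire that the other reads (`U_commute_U`), they
are involutions that push through controls (`pushes`), they are additive in the function (`U_mul`),
and conjugating an oracle by an oracle on its control creates the oracle of the product
(`conjProd`). The last law is the heart of the matter: its induction needs the product of three bits
to be symmetric in all its factors, and that is the identity `cccnot_cross`, used through
`D_symm_right`. Since Boolean functions are generated by constants, variables, sums and products,
these laws give substitution (`U_comp`, `U_conj_U`). Ending an oracle's ancilla with `⟨1|` gives
projections `Pj`, and with them an oracle may be replaced by any other which agrees on the states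
that actually occur (`Sat.comp_U_congr`).

All this requires gates on arbitrary wires. A coherence argument shows that permutations of wires
act through a homomorphism `perm`, and that conjugation by `perm` gives a well-defined placement
`map φ X` of a map `X` on the wires `φ`.

Once values are faithful, the rest is verified on bits. The flip respects provable equality because
it inverts partial functions, and the laws of a discrete inverse category hold for partial
injections. The realization functor is full, faithful, essentially surjective and monoidal, so it is
a discrete inverse equivalence. The total points of `n` are exactly the kets, so the functor of
total points is isomorphic to the realization, and the structure is transported along this
isomorphism. -/

namespace TOF

/-! ### Strict monoidal calculus -/

/-- The maps from `n` wires to `m` wires. -/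
abbrev H (n m : ℕ) := TOF.mk n ⟶ TOF.mk m

/-- The tensor product of maps, with strictly added numbers of wires. -/
def tens {n m n' m' : ℕ} (f : H n m) (g : H n' m') : H (n + n') (m + m') :=
  (f ⊗ₘ g : TOF.mk n ⊗ TOF.mk n' ⟶ TOF.mk m ⊗ TOF.mk m')

local infixl:70 " ⊙ " => tens

/-- The identity on `n` wires. -/
abbrev one (n : ℕ) : H n n := 𝟙 (TOF.mk n)

theorem tens_comp {n m k n' m' k' : ℕ} (f : H n m) (g : H m k) (f' : H n' m') (g' : H m' k') :
    (f ≫ g) ⊙ (f' ≫ g') = (f ⊙ f') ≫ (g ⊙ g') :=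
  (MonoidalCategory.tensorHom_comp_tensorHom f f' g g').symm

theorem tens_one (n m : ℕ) : one n ⊙ one m = one (n + m) :=
  MonoidalCategory.id_tensorHom_id _ _

theorem tens_assoc {n m n' m' n'' m'' : ℕ} (f : H n m) (g : H n' m') (h : H n'' m'') :
    (f ⊙ g ⊙ h) ≫ ofCircuit (.wire (add_assoc m m' m'')) =
      ofCircuit (.wire (add_assoc n n' n'')) ≫ (f ⊙ (g ⊙ h)) :=
  MonoidalCategory.associator_naturality f g h

theorem wire_rfl (n : ℕ) (h : n = n) : ofCircuit (.wire h) = one n := rfl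

theorem tens_assoc_one {n m n' m' : ℕ} (f : H n m) (g : H n' m') :
    f ⊙ g ⊙ one 1 = f ⊙ (g ⊙ one 1) := by
  have h := tens_assoc f g (one 1)
  exact (Category.comp_id _).symm.trans (h.trans (Category.id_comp _))

/-- The types differ by `add_assoc`. Straight wires become identities once the numbers of wires are
identified, so the naturality square of the associator collapses to a heterogeneous equality, which
is a plain one wherever the sums agree definitionally. -/
theorem tens_assoc_of {n m n' m' a b : ℕ} (f : H n m) (g : H n' m') (k : H a b) :
    HEq (f ⊙ g ⊙ k) (f ⊙ (g ⊙ k)) := by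
  have key := tens_assoc f g k
  have wire_heq : ∀ {p q r s : ℕ} (hp : p = q) (hr : r = s) (x : H p r) (y : H q s),
      x ≫ ofCircuit (.wire hr) = ofCircuit (.wire hp) ≫ y → HEq x y := by
    rintro p q r s rfl rfl x y hxy
    exact heq_of_eq ((Category.comp_id _).symm.trans (hxy.trans (Category.id_comp _)))
  exact wire_heq _ _ _ _ key

theorem one_zero_tens {n m : ℕ} (f : H n m) :
    (one 0 ⊙ f) ≫ ofCircuit (.wire (zero_add m)) = ofCircuit (.wire (zero_add n)) ≫ f := by
  obtain ⟨f⟩ := f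
  exact sound (.id_zero_tensor f)

theorem tens_one_zero {n m : ℕ} (f : H n m) : f ⊙ one 0 = f := by
  obtain ⟨f⟩ := f
  have h := sound (.tensor_id_zero f)
  exact (Category.comp_id _).symm.trans (h.trans (Category.id_comp (ofCircuit f)))

/-- The crossing of `n` wires with `m` wires. -/
def sw (n m : ℕ) : H (n + m) (m + n) := ofCircuit (.swap n m)

theorem sw_natural {n m n' m' : ℕ} (f : H n m) (g : H n' m') :
    (f ⊙ g) ≫ sw m m' = sw n n' ≫ (g ⊙ f) := by
  obtain ⟨f⟩ := f
  obtain ⟨g⟩ := g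
  exact sound (.swap_natural f g)

theorem sw_sw (n m : ℕ) : sw n m ≫ sw m n = one (n + m) := sound (.swap_swap n m)

/-- The crossing of two wires. -/
def cr : H 2 2 := ofCircuit Circuit.cross

theorem cr_cr : cr ≫ cr = one 2 := sound (.swap_swap 1 1)

/-- The endomorphisms of `n` wires form a monoid under diagrammatic composition. -/
instance (n : ℕ) : Monoid (H n n) where
  mul f g := f ≫ g
  one := one n
  mul_assoc := Category.assoc
  one_mul := Category.id_comp
  mul_one := Category.comp_id

theorem mul_def {n : ℕ} (f g : H n n) : f * g = f ≫ g := rfl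

theorem one_def (n : ℕ) : (1 : H n n) = 𝟙 (TOF.mk n) := rfl

theorem comp_mul {n m : ℕ} (k : H n m) (f g : H m m) : k ≫ (f * g) = (k ≫ f) ≫ g :=
  (Category.assoc _ _ _).symm

theorem mul_comp {n m : ℕ} (f g : H n n) (k : H n m) : (f * g) ≫ k = f ≫ (g ≫ k) :=
  Category.assoc _ _ _

theorem comp_one {n m : ℕ} (k : H n m) : k ≫ (1 : H m m) = k := Category.comp_id _

theorem one_comp {n m : ℕ} (k : H n m) : (1 : H n n) ≫ k = k := Category.id_comp _

/-- Add an idle last wire. -/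
def lift {n m : ℕ} (f : H n m) : H (n + 1) (m + 1) := f ⊙ one 1

theorem lift_comp {n m k : ℕ} (f : H n m) (g : H m k) : lift (f ≫ g) = lift f ≫ lift g := by
  unfold lift
  rw [← tens_comp, Category.comp_id]

theorem lift_one (n : ℕ) : lift (1 : H n n) = 1 := tens_one n 1

theorem lift_mul {n : ℕ} (f g : H n n) : lift (f * g) = lift f * lift g := lift_comp f g

theorem lift_lift {n m : ℕ} (f : H n m) : lift (lift f) = f ⊙ one 2 := by
  unfold lift
  rw [tens_assoc_one, tens_one]

/-- The crossing of the last two wires. -/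
def swapLast (n : ℕ) : H (n + 2) (n + 2) := one n ⊙ cr

theorem swapLast_swapLast (n : ℕ) : swapLast n * swapLast n = 1 := by
  rw [mul_def, swapLast, ← tens_comp, cr_cr, Category.comp_id, tens_one, one_def]

theorem lift_lift_swapLast {n m : ℕ} (f : H n m) :
    lift (lift f) ≫ swapLast m = swapLast n ≫ lift (lift f) := by
  rw [lift_lift, swapLast, swapLast, ← tens_comp, ← tens_comp]
  simp only [Category.id_comp, Category.comp_id]

/-- The crossing of the first two of three wires. -/
def crLeft : H 3 3 := cr ⊙ one 1

/-- The crossing of the last two of three wires. -/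
def crRight : H 3 3 := one 1 ⊙ cr

theorem sw_one_two : sw 1 2 = crLeft ≫ crRight := by
  have h := sound (.hexagon 1 1 1)
  exact ((Category.id_comp _).trans (Category.comp_id _)).symm.trans
    (h.trans (congrArg (fun z => crLeft ≫ z) (Category.id_comp crRight)))

/-- Naturality slides a crossing of two wires through the crossing of one wire with both of them;
the hexagon splits the latter into two elementary crossings. -/
theorem braid_three : crRight ≫ crLeft ≫ crRight = crLeft ≫ crRight ≫ crLeft := by
  have h : crRight ≫ sw 1 2 = sw 1 2 ≫ crLeft := sw_natural (one 1) cr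
  rw [sw_one_two, Category.assoc] at h
  exact h

theorem swapLast_succ (n : ℕ) : swapLast (n + 1) = one n ⊙ crRight := by
  refine Eq.trans ?_ (eq_of_heq (tens_assoc_of (one n) (one 1) cr))
  rw [tens_one]
  rfl

theorem swapLast_braid (n : ℕ) :
    swapLast (n + 1) * lift (swapLast n) * swapLast (n + 1) =
      lift (swapLast n) * swapLast (n + 1) * lift (swapLast n) := by
  have h : lift (swapLast n) = one n ⊙ crLeft := tens_assoc_one _ _
  rw [swapLast_succ, h, mul_assoc, mul_assoc]
  simp only [mul_def, ← tens_comp (one n) (one n), Category.comp_id]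
  exact congrArg _ braid_three

/-! ### Coherence: permutations of wires -/

/-- A labelling of `n` wires. -/
inductive Ctx (ι : Type) : ℕ → Type
  | nil : Ctx ι 0
  | snoc {n : ℕ} (Γ : Ctx ι n) (a : ι) : Ctx ι (n + 1)

namespace Ctx

variable {ι κ : Type}

/-- The labels of a context. -/
def get : {n : ℕ} → Ctx ι n → Fin n → ι
  | _, nil => Fin.elim0
  | _, snoc Γ a => Fin.snoc (α := fun _ => ι) Γ.get a

/-- The context with given labels. -/
def ofFn : {n : ℕ} → (Fin n → ι) → Ctx ι n
  | 0, _ => nil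
  | _ + 1, f => snoc (ofFn (Fin.init f)) (f (Fin.last _))

/-- Rename the labels. -/
def map (φ : ι → κ) : {n : ℕ} → Ctx ι n → Ctx κ n
  | _, nil => nil
  | _, snoc Γ a => snoc (map φ Γ) (φ a)

theorem map_ofFn (φ : ι → κ) {n : ℕ} (f : Fin n → ι) : (ofFn f).map φ = ofFn (φ ∘ f) := by
  induction n with
  | zero => rfl
  | succ n ih => exact congrArg₂ snoc (ih _) rfl

theorem ofFn_succ {n : ℕ} (f : Fin (n + 1) → ι) :
    ofFn f = (ofFn fun i => f i.castSucc).snoc (f (Fin.last n)) := rfl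

theorem get_ofFn {n : ℕ} (f : Fin n → ι) : (ofFn f).get = f := by
  induction n with
  | zero => exact Subsingleton.elim _ _
  | succ n ih => simp only [ofFn, get, ih, Fin.snoc_init_self]

/-- Membership of a label. -/
def Mem (a : ι) : {n : ℕ} → Ctx ι n → Prop
  | _, nil => False
  | _, snoc Γ b => a = b ∨ Mem a Γ

/-- All labels are distinct. -/
def Nodup : {n : ℕ} → Ctx ι n → Prop
  | _, nil => True
  | _, snoc Γ b => ¬ Mem b Γ ∧ Nodup Γ

theorem mem_ofFn {n : ℕ} (f : Fin n → ι) (a : ι) : (ofFn f).Mem a ↔ ∃ i, f i = a := by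
  induction n with
  | zero => simp [ofFn, Mem]
  | succ n ih =>
    simp only [ofFn, Mem, ih, Fin.exists_fin_succ', Fin.init]
    rw [or_comm, eq_comm]

theorem nodup_ofFn {n : ℕ} {f : Fin n → ι} (hf : Function.Injective f) : (ofFn f).Nodup := by
  induction n with
  | zero => trivial
  | succ n ih =>
    refine ⟨?_, ih (hf.comp (Fin.castSucc_injective _))⟩
    rw [mem_ofFn]
    rintro ⟨i, hi⟩
    exact (Fin.castSucc_lt_last i).ne (hf hi)

end Ctx

variable {ι κ : Type}

/-- `Mv Γ a Γ' f`: the map `f` moves the wire with label `a` to the end. -/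
inductive Mv : {n : ℕ} → Ctx ι (n + 1) → ι → Ctx ι n → H (n + 1) (n + 1) → Prop
  | here {n : ℕ} (Γ : Ctx ι n) (a : ι) : Mv (Γ.snoc a) a Γ 1
  | there {n : ℕ} {Γ : Ctx ι (n + 1)} {a : ι} {Γ' : Ctx ι n} {f : H (n + 1) (n + 1)} (b : ι) :
      Mv Γ a Γ' f → Mv (Γ.snoc b) a (Γ'.snoc b) (lift f * swapLast n)

/-- `Rho Γ Δ c`: the map `c` permutes the wires so that the labels `Γ` become the labels `Δ`. -/
inductive Rho : {n : ℕ} → Ctx ι n → Ctx ι n → H n n → Prop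
  | nil : Rho .nil .nil 1
  | snoc {n : ℕ} {Γ : Ctx ι (n + 1)} {a : ι} {Γ' Δ : Ctx ι n} {f : H (n + 1) (n + 1)}
      {g : H n n} : Mv Γ a Γ' f → Rho Γ' Δ g → Rho Γ (Δ.snoc a) (f * lift g)

/-- Extracting two labels in the opposite order costs one crossing of the last two wires. If one of
the labels is already last, that crossing is absorbed or cancels. Otherwise both lie deeper, and the
braid relation carries the outer crossing inwards to the induction hypothesis. -/
theorem Mv.swap {n : ℕ} {Γ : Ctx ι (n + 2)} {a b : ι} {Γ₁ : Ctx ι (n + 1)} {Γ₂ : Ctx ι n}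
    {f : H (n + 2) (n + 2)} {g : H (n + 1) (n + 1)} (hf : Mv Γ a Γ₁ f) (hg : Mv Γ₁ b Γ₂ g) :
    ∃ Γ₃ f' g', Mv Γ b Γ₃ f' ∧ Mv Γ₃ a Γ₂ g' ∧ f * lift g * swapLast n = f' * lift g' := by
  induction n generalizing a b with
  | zero =>
    cases hf with
    | here =>
      exact ⟨_, _, _, .there _ hg, .here _ _, by rw [one_mul, lift_one, mul_one]⟩
    | there c hf =>
      cases hg with
      | here =>
        exact ⟨_, _, _, .here _ _, hf, by
          rw [one_mul, lift_one, mul_one, mul_assoc, swapLast_swapLast, mul_one]⟩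
  | succ n ih =>
    cases hf with
    | here =>
      exact ⟨_, _, _, .there _ hg, .here _ _, by rw [one_mul, lift_one, mul_one]⟩
    | @there _ _ _ _ f₀ c hf =>
      cases hg with
      | here =>
        exact ⟨_, _, _, .here _ _, hf, by
          rw [one_mul, lift_one, mul_one, mul_assoc, swapLast_swapLast, mul_one]⟩
      | @there _ _ _ _ g₀ _ hg =>
        obtain ⟨Γ₃, f', g', h₁, h₂, h₃⟩ := ih hf hg
        refine ⟨_, _, _, .there _ h₁, .there _ h₂, ?_⟩
        have e₁ : swapLast (n + 1) * lift (lift g₀) = lift (lift g₀) * swapLast (n + 1) :=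
          (lift_lift_swapLast g₀).symm
        have e₂ : swapLast (n + 1) * lift (lift g') = lift (lift g') * swapLast (n + 1) :=
          (lift_lift_swapLast g').symm
        have h₄ := congrArg lift h₃
        simp only [lift_mul] at h₄ ⊢
        calc lift f₀ * swapLast (n + 1) * (lift (lift g₀) * lift (swapLast n)) * swapLast (n + 1)
            = lift f₀ * (swapLast (n + 1) * lift (lift g₀)) * lift (swapLast n) *
                swapLast (n + 1) := by simp only [mul_assoc]
          _ = lift f₀ * lift (lift g₀) * (swapLast (n + 1) * lift (swapLast n) *
                swapLast (n + 1)) := by rw [e₁]; simp only [mul_assoc]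
          _ = lift f₀ * lift (lift g₀) * lift (swapLast n) * (swapLast (n + 1) *
                lift (swapLast n)) := by rw [swapLast_braid]; simp only [mul_assoc]
          _ = lift f' * (lift (lift g') * swapLast (n + 1)) * lift (swapLast n) := by
                rw [h₄]; simp only [mul_assoc]
          _ = _ := by rw [← e₂]; simp only [mul_assoc]

/-- A label can be extracted before a permutation instead of after it. This is the exchange step
that makes `Rho` closed under composition. -/
theorem Rho.mv {n : ℕ} {Γ Δ : Ctx ι (n + 1)} {c : H (n + 1) (n + 1)} (hc : Rho Γ Δ c) {a : ι}
    {Δ' : Ctx ι n} {g : H (n + 1) (n + 1)} (hg : Mv Δ a Δ' g) :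
    ∃ Γ' f c', Mv Γ a Γ' f ∧ Rho Γ' Δ' c' ∧ c * g = f * lift c' := by
  induction n generalizing a with
  | zero =>
    cases hc with
    | snoc hf hc =>
      cases hg with
      | here => exact ⟨_, _, _, hf, hc, mul_one _⟩
  | succ n ih =>
    cases hc with
    | @snoc _ _ _ _ _ f₁ c₁ hf hc =>
      cases hg with
      | here => exact ⟨_, _, _, hf, hc, mul_one _⟩
      | @there _ _ _ _ g₁ _ hg =>
        obtain ⟨Γ₁, f₂, c₂, h₁, h₂, h₃⟩ := ih hc hg
        obtain ⟨Γ₂, f₃, g₃, h₄, h₅, h₆⟩ := hf.swap h₁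
        refine ⟨_, _, _, h₄, .snoc h₅ h₂, ?_⟩
        have e : lift (lift c₂) * swapLast n = swapLast n * lift (lift c₂) := lift_lift_swapLast c₂
        calc f₁ * lift c₁ * (lift g₁ * swapLast n) = f₁ * lift (c₁ * g₁) * swapLast n := by
              rw [lift_mul]; simp only [mul_assoc]
          _ = f₁ * lift f₂ * (lift (lift c₂) * swapLast n) := by
              rw [h₃, lift_mul]; simp only [mul_assoc]
          _ = f₁ * lift f₂ * swapLast n * lift (lift c₂) := by rw [e]; simp only [mul_assoc]
          _ = f₃ * lift (g₃ * lift c₂) := by rw [h₆, lift_mul]; simp only [mul_assoc]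

theorem Rho.trans {n : ℕ} {Γ Δ Θ : Ctx ι n} {c d : H n n} (hc : Rho Γ Δ c) (hd : Rho Δ Θ d) :
    Rho Γ Θ (c * d) := by
  induction hd with
  | nil => rw [mul_one]; exact hc
  | snoc hg _ ih =>
    obtain ⟨_, f, c', h₁, h₂, h₃⟩ := hc.mv hg
    have := Rho.snoc h₁ (ih h₂)
    rwa [lift_mul, ← mul_assoc, ← h₃, mul_assoc] at this

theorem Rho.lift {n : ℕ} {Γ Δ : Ctx ι n} {c : H n n} (hc : Rho Γ Δ c) (a : ι) :
    Rho (Γ.snoc a) (Δ.snoc a) (TOF.lift c) := by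
  have := Rho.snoc (.here Γ a) hc
  rwa [one_mul] at this

theorem Rho.refl : ∀ {n : ℕ} (Γ : Ctx ι n), Rho Γ Γ 1
  | _, .nil => .nil
  | _, .snoc Γ a => by
    have := (Rho.refl Γ).lift a
    rwa [lift_one] at this

theorem Rho.swapLast {n : ℕ} (Γ : Ctx ι n) (a b : ι) :
    Rho ((Γ.snoc a).snoc b) ((Γ.snoc b).snoc a) (TOF.swapLast n) := by
  have := Rho.snoc (.there b (.here Γ a)) (Rho.refl (Γ.snoc b))
  rw [lift_one, one_mul] at this
  exact (mul_one (TOF.swapLast n)) ▸ (lift_one (n + 1)) ▸ this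

theorem Mv.map (φ : ι → κ) {n : ℕ} {Γ : Ctx ι (n + 1)} {a : ι} {Γ' : Ctx ι n}
    {f : H (n + 1) (n + 1)} (h : Mv Γ a Γ' f) : Mv (Γ.map φ) (φ a) (Γ'.map φ) f := by
  induction h with
  | here => exact .here _ _
  | there b _ ih => exact .there _ ih

theorem Rho.map (φ : ι → κ) {n : ℕ} {Γ Δ : Ctx ι n} {c : H n n} (h : Rho Γ Δ c) :
    Rho (Γ.map φ) (Δ.map φ) c := by
  induction h with
  | nil => exact .nil
  | snoc hf _ ih => exact .snoc (hf.map φ) ih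

theorem Mv.mem {n : ℕ} {Γ : Ctx ι (n + 1)} {a : ι} {Γ' : Ctx ι n} {f : H (n + 1) (n + 1)}
    (h : Mv Γ a Γ' f) (x : ι) : Γ.Mem x ↔ x = a ∨ Γ'.Mem x := by
  induction h with
  | here => rfl
  | there b _ ih => simp only [Ctx.Mem, ih]; exact or_left_comm

theorem Mv.nodup {n : ℕ} {Γ : Ctx ι (n + 1)} {a : ι} {Γ' : Ctx ι n} {f : H (n + 1) (n + 1)}
    (h : Mv Γ a Γ' f) (hΓ : Γ.Nodup) : ¬ Γ'.Mem a ∧ Γ'.Nodup := by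
  induction h with
  | here => exact hΓ
  | there b h ih =>
    obtain ⟨h₁, h₂⟩ := hΓ
    obtain ⟨h₃, h₄⟩ := ih h₂
    rw [h.mem, not_or] at h₁
    exact ⟨not_or.2 ⟨Ne.symm h₁.1, h₃⟩, h₁.2, h₄⟩

theorem Mv.unique {n : ℕ} {Γ : Ctx ι (n + 1)} {a : ι} {Γ₁ Γ₂ : Ctx ι n}
    {f g : H (n + 1) (n + 1)} (hf : Mv Γ a Γ₁ f) (hg : Mv Γ a Γ₂ g) (hΓ : Γ.Nodup) :
    Γ₁ = Γ₂ ∧ f = g := by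
  induction n with
  | zero =>
    cases hf with
    | here => cases hg with
      | here => exact ⟨rfl, rfl⟩
  | succ n ih =>
    cases hf with
    | here => cases hg with
      | here => exact ⟨rfl, rfl⟩
      | there _ hg => exact absurd ((hg.mem _).2 (.inl rfl)) hΓ.1
    | there _ hf => cases hg with
      | here => exact absurd ((hf.mem _).2 (.inl rfl)) hΓ.1
      | there _ hg =>
        obtain ⟨rfl, rfl⟩ := ih hf hg hΓ.2
        exact ⟨rfl, rfl⟩

/-- With distinct labels a derivation of `Rho` is deterministic: the last label of the target occurs
at one place only in the source. This is the coherence statement, as it gives each permutation a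
single realisation. -/
theorem Rho.unique {n : ℕ} {Γ Δ : Ctx ι n} {c d : H n n} (hc : Rho Γ Δ c) (hd : Rho Γ Δ d)
    (hΓ : Γ.Nodup) : c = d := by
  induction hc with
  | nil => cases hd; rfl
  | snoc hf _ ih => cases hd with
    | snoc hg hd =>
      obtain ⟨rfl, rfl⟩ := hf.unique hg hΓ
      rw [ih hd (hf.nodup hΓ).2]

theorem rho_swapLast_ofFn {n : ℕ} {f g : Fin (n + 2) → ι}
    (h : ∀ j : Fin n, g j.castSucc.castSucc = f j.castSucc.castSucc)
    (h₁ : g (Fin.last n).castSucc = f (Fin.last (n + 1)))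
    (h₂ : g (Fin.last (n + 1)) = f (Fin.last n).castSucc) :
    Rho (.ofFn f) (.ofFn g) (swapLast n) := by
  have := Rho.swapLast (.ofFn fun j : Fin n => f j.castSucc.castSucc) (f (Fin.last n).castSucc)
    (f (Fin.last (n + 1)))
  rw [Ctx.ofFn_succ g, Ctx.ofFn_succ fun i => g i.castSucc]
  simp only [h, h₁, h₂]
  exact this

theorem rho_lift_ofFn {n : ℕ} {f g : Fin (n + 1) → ι} {c : H n n}
    (hc : Rho (.ofFn fun i => f i.castSucc) (.ofFn fun i => g i.castSucc) c)
    (h : g (Fin.last n) = f (Fin.last n)) : Rho (.ofFn f) (.ofFn g) (lift c) := by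
  have := hc.lift (f (Fin.last n))
  rw [Ctx.ofFn_succ g, h]
  exact this

/-- The transposition of two neighbouring wires is realised by a map. -/
theorem exists_rho_swap {n : ℕ} (i : Fin n) :
    ∃ c, Rho (.ofFn (fun j : Fin (n + 1) => j))
      (.ofFn fun j => Equiv.swap i.castSucc i.succ j) c := by
  -- Arbitrary labellings are needed for the induction, because the identity labelling restricted to
  -- all wires but the last is no longer an identity labelling.
  suffices h : ∀ {n : ℕ} (i : Fin n) {ι : Type} (f : Fin (n + 1) → ι),
      ∃ c, Rho (.ofFn f) (.ofFn (f ∘ Equiv.swap i.castSucc i.succ)) c from h i _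
  clear i
  intro n i ι f
  induction n with
  | zero => exact i.elim0
  | succ n ih =>
    induction i using Fin.lastCases with
    | last =>
      refine ⟨TOF.swapLast n, rho_swapLast_ofFn (fun j => ?_) ?_ ?_⟩
      · rw [Function.comp_apply, Equiv.swap_apply_of_ne_of_ne]
        · simp [Fin.ext_iff, j.isLt.ne]
        · simp [Fin.ext_iff]; omega
      · simp
      · simp
    | cast i =>
      obtain ⟨c, hc⟩ := ih i (fun i => f i.castSucc)
      refine ⟨lift c, rho_lift_ofFn ?_ ?_⟩
      · convert hc using 2
        funext j
        simp only [Function.comp_apply]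
        congr 1
        rw [← Fin.castSucc_succ]
        exact ((Fin.castSucc_injective _).swap_apply _ _ _)
      · rw [Function.comp_apply, Equiv.swap_apply_of_ne_of_ne]
        · simp [Fin.ext_iff]; omega
        · simp [Fin.ext_iff]; omega

/-- Neighbouring transpositions generate the permutations as a monoid. For a product, the
realisation of the second factor is relabelled along the first, so that the two derivations can be
composed. -/
theorem exists_rho {n : ℕ} (σ : Equiv.Perm (Fin n)) :
    ∃ c, Rho (.ofFn (fun i => i)) (.ofFn σ) c := by
  obtain _ | n := n
  · exact ⟨1, .nil⟩
  have h : σ ∈ Submonoid.closure (Set.range fun i : Fin n => Equiv.swap i.castSucc i.succ) := by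
    rw [Equiv.Perm.mclosure_swap_castSucc_succ]; trivial
  induction h using Submonoid.closure_induction with
  | mem σ h =>
    obtain ⟨i, rfl⟩ := h
    exact exists_rho_swap i
  | one => exact ⟨1, Rho.refl _⟩
  | mul σ τ _ _ hσ hτ =>
    obtain ⟨c, hc⟩ := hσ
    obtain ⟨d, hd⟩ := hτ
    have := hd.map σ
    rw [Ctx.map_ofFn, Ctx.map_ofFn] at this
    exact ⟨_, hc.trans this⟩

theorem nodup_ofFn_id (n : ℕ) : (Ctx.ofFn (fun i : Fin n => i)).Nodup :=
  Ctx.nodup_ofFn fun _ _ h => h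

/-- The permutation of wires such that the output wire `i` is the input wire `σ i`. -/
noncomputable def perm {n : ℕ} : Equiv.Perm (Fin n) →* H n n where
  toFun σ := (exists_rho σ).choose
  map_one' := (exists_rho 1).choose_spec.unique (Rho.refl _) (nodup_ofFn_id n)
  map_mul' σ τ := by
    have h := (exists_rho τ).choose_spec.map σ
    rw [Ctx.map_ofFn, Ctx.map_ofFn] at h
    exact (exists_rho (σ * τ)).choose_spec.unique ((exists_rho σ).choose_spec.trans h)
      (nodup_ofFn_id n)

theorem rho_perm {n : ℕ} (σ : Equiv.Perm (Fin n)) :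
    Rho (.ofFn (fun i => i)) (.ofFn σ) (perm σ) := (exists_rho σ).choose_spec

theorem Rho.eq_perm {n : ℕ} {σ : Equiv.Perm (Fin n)} {c : H n n}
    (h : Rho (.ofFn (fun i => i)) (.ofFn σ) c) : c = perm σ :=
  h.unique (rho_perm σ) (nodup_ofFn_id n)

/-- Extend a permutation by a fixed last point. -/
def extendLast {n : ℕ} (σ : Equiv.Perm (Fin n)) : Equiv.Perm (Fin (n + 1)) where
  toFun := Fin.snoc (α := fun _ => Fin (n + 1)) (fun i => (σ i).castSucc) (Fin.last n)
  invFun := Fin.snoc (α := fun _ => Fin (n + 1)) (fun i => (σ.symm i).castSucc) (Fin.last n)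
  left_inv i := by induction i using Fin.lastCases <;> simp
  right_inv i := by induction i using Fin.lastCases <;> simp

@[simp] theorem extendLast_castSucc {n : ℕ} (σ : Equiv.Perm (Fin n)) (i : Fin n) :
    extendLast σ i.castSucc = (σ i).castSucc :=
  Fin.snoc_castSucc (α := fun _ => Fin (n + 1)) (Fin.last n) (fun i => (σ i).castSucc) i

@[simp] theorem extendLast_last {n : ℕ} (σ : Equiv.Perm (Fin n)) :
    extendLast σ (Fin.last n) = Fin.last n :=
  Fin.snoc_last (α := fun _ => Fin (n + 1)) (Fin.last n) (fun i => (σ i).castSucc)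

theorem lift_perm {n : ℕ} (σ : Equiv.Perm (Fin n)) : lift (perm σ) = perm (extendLast σ) := by
  refine (rho_lift_ofFn ?_ (extendLast_last σ)).eq_perm
  have h := (rho_perm σ).map Fin.castSucc
  rw [Ctx.map_ofFn, Ctx.map_ofFn] at h
  simp only [extendLast_castSucc]
  exact h

theorem swapLast_eq_perm (n : ℕ) :
    swapLast n = perm (Equiv.swap (Fin.last n).castSucc (Fin.last (n + 1))) := by
  refine (rho_swapLast_ofFn (fun j => ?_) ?_ ?_).eq_perm
  · rw [Equiv.swap_apply_of_ne_of_ne]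
    · simp [Fin.ext_iff, j.isLt.ne]
    · simp [Fin.ext_iff]; omega
  · simp
  · simp

/-! ### Placing maps on chosen wires -/

/-- Straight wires. -/
abbrev strands {n m : ℕ} (h : n = m) : H n m := ofCircuit (.wire h)

theorem strands_comp {n m k : ℕ} (h : n = m) (h' : m = k) :
    strands h ≫ strands h' = strands (h.trans h') := sound (wire_comp h h')

/-- Add `d` idle wires at the end. -/
def liftBy {n : ℕ} (X : H n n) : (d : ℕ) → H (n + d) (n + d)
  | 0 => X
  | d + 1 => lift (liftBy X d)

theorem liftBy_mul {n : ℕ} (X Y : H n n) (d : ℕ) :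
    liftBy (X * Y) d = liftBy X d * liftBy Y d := by
  induction d with
  | zero => rfl
  | succ d ih => exact (congrArg lift ih).trans (lift_mul _ _)

theorem liftBy_one (n d : ℕ) : liftBy (1 : H n n) d = 1 := by
  induction d with
  | zero => rfl
  | succ d ih => exact (congrArg lift ih).trans (lift_one _)

namespace Ctx

variable {ι : Type}

/-- Concatenation of contexts. -/
def append {n : ℕ} (Γ : Ctx ι n) : {d : ℕ} → Ctx ι d → Ctx ι (n + d)
  | _, nil => Γ
  | _, snoc Δ a => snoc (append Γ Δ) a

theorem ofFn_add {n : ℕ} : ∀ {d : ℕ} (f : Fin (n + d) → ι),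
    ofFn f = (ofFn fun i => f (Fin.castAdd d i)).append (ofFn fun i => f (Fin.natAdd n i))
  | 0, _ => rfl
  | d + 1, f => by
    rw [ofFn_succ (n := n + d) f, ofFn_add (d := d)]
    rfl

end Ctx

variable {ι : Type}

/-- The moved label does not occur among the first `n` wires, so every crossing involved lies among
the added wires and slides past `X`. -/
theorem Mv.commute_liftBy {n : ℕ} {Γ : Ctx ι n} (X : H n n) : ∀ {d : ℕ} {Δ : Ctx ι (d + 1)}
    {a : ι} {Γ' : Ctx ι (n + d)} {f : H (n + (d + 1)) (n + (d + 1))},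
    Mv (Ctx.append (d := d + 1) Γ Δ) a Γ' f → ¬ Γ.Mem a →
      (∃ Δ' : Ctx ι d, Γ' = Γ.append Δ') ∧ Commute f (liftBy X (d + 1))
  | 0, .snoc .nil b, a, Γ', f, h, ha => by
    obtain _ | n := n
    · cases h with
      | here => exact ⟨⟨.nil, rfl⟩, Commute.one_left _⟩
    · cases h with
      | here => exact ⟨⟨.nil, rfl⟩, Commute.one_left _⟩
      | there _ h => exact absurd ((h.mem _).2 (.inl rfl)) ha
  | d + 1, .snoc Δ b, a, Γ', f, h, ha => by
    cases h with
    | here => exact ⟨⟨Δ, rfl⟩, Commute.one_left _⟩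
    | @there _ _ _ Γ₁ f₁ _ h =>
      obtain ⟨⟨Δ', rfl⟩, hc⟩ := Mv.commute_liftBy X h ha
      refine ⟨⟨Δ'.snoc b, rfl⟩, Commute.mul_left ?_ ?_⟩
      · exact (lift_mul _ _).symm.trans ((congrArg lift hc.eq).trans (lift_mul _ _))
      · exact (lift_lift_swapLast (liftBy X d)).symm

theorem Rho.commute_liftBy {n : ℕ} {Γ : Ctx ι n} (hΓ : Γ.Nodup) (X : H n n) : ∀ {d : ℕ}
    {Δ Δ' : Ctx ι d} {c : H (n + d) (n + d)}, Rho (Γ.append Δ) (Γ.append Δ') c →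
    (∀ a, Γ.Mem a → ¬ Δ'.Mem a) → Commute c (liftBy X d)
  | 0, .nil, .nil, c, h, _ => by
    rw [h.unique (Rho.refl _) hΓ]
    exact Commute.one_left _
  | d + 1, Δ, .snoc Δ' a, c, h, ha => by
    cases h with
    | @snoc _ _ _ _ _ f g hf hg =>
      obtain ⟨⟨Δ'', rfl⟩, hc⟩ := hf.commute_liftBy X fun h => ha a h (.inl rfl)
      have := Rho.commute_liftBy hΓ X hg fun b hb hb' => ha b hb (.inr hb')
      exact hc.mul_left
        ((lift_mul _ _).symm.trans ((congrArg TOF.lift this.eq).trans (lift_mul _ _)))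

/-- A permutation that fixes the first `n` wires only crosses wires on which `X` is idle. This
removes the dependence of `IsMap` on the permutation chosen to extend `φ`. -/
theorem perm_commute_liftBy {n d : ℕ} (X : H n n) (σ : Equiv.Perm (Fin (n + d)))
    (hσ : ∀ i, σ (Fin.castAdd d i) = Fin.castAdd d i) : Commute (perm σ) (liftBy X d) := by
  have h := rho_perm σ
  rw [Ctx.ofFn_add, Ctx.ofFn_add (σ : Fin (n + d) → Fin (n + d))] at h
  simp only [hσ] at h
  refine h.commute_liftBy (Ctx.nodup_ofFn (Fin.castAdd_injective n d)) X ?_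
  intro a ha hb
  rw [Ctx.mem_ofFn] at ha hb
  obtain ⟨i, rfl⟩ := ha
  obtain ⟨j, hj⟩ := hb
  have := σ.injective (hj.trans (hσ i).symm)
  simp only [Fin.ext_iff, Fin.val_natAdd, Fin.val_castAdd] at this
  omega

/-- `IsMap φ X Y`: the map `Y` is `X` applied to the wires given by `φ`. -/
def IsMap {n m : ℕ} (φ : Fin n → Fin m) (X : H n n) (Y : H m m) : Prop :=
  ∃ (d : ℕ) (h : n + d = m) (σ : Equiv.Perm (Fin m)),
    (∀ i, σ (Fin.cast h (Fin.castAdd d i)) = φ i) ∧ Y = perm σ * (h ▸ liftBy X d) * perm σ⁻¹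

theorem perm_mul_perm_inv {n : ℕ} (σ : Equiv.Perm (Fin n)) : perm σ * perm σ⁻¹ = 1 := by
  rw [← map_mul, mul_inv_cancel, map_one]

theorem perm_inv_mul_perm {n : ℕ} (σ : Equiv.Perm (Fin n)) : perm σ⁻¹ * perm σ = 1 := by
  rw [← map_mul, inv_mul_cancel, map_one]

/-- Two permutations extending `φ` differ by one that fixes the first `n` wires, and that one
cancels after being moved past the lifted map. -/
theorem IsMap.unique {n m : ℕ} {φ : Fin n → Fin m} {X : H n n} {Y Y' : H m m}
    (h : IsMap φ X Y) (h' : IsMap φ X Y') : Y = Y' := by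
  obtain ⟨d, rfl, σ, hσ, rfl⟩ := h
  obtain ⟨d', h', σ', hσ', rfl⟩ := h'
  obtain rfl : d' = d := by omega
  have hc := perm_commute_liftBy X (σ⁻¹ * σ') (d := d') fun i => by
    rw [Equiv.Perm.mul_apply, Equiv.Perm.inv_eq_iff_eq]
    exact (hσ' i).trans (hσ i).symm
  have e : perm σ' = perm σ * perm (σ⁻¹ * σ') := by rw [← map_mul, mul_inv_cancel_left]
  have e' : perm σ'⁻¹ = perm (σ⁻¹ * σ')⁻¹ * perm σ⁻¹ := by rw [← map_mul]; congr 1; group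
  change perm σ * liftBy X d' * perm σ⁻¹ = perm σ' * liftBy X d' * perm σ'⁻¹
  rw [e, e', mul_assoc (perm σ) (perm (σ⁻¹ * σ')), hc.eq]
  simp only [mul_assoc]
  rw [← mul_assoc (perm (σ⁻¹ * σ')), perm_mul_perm_inv, one_mul]

theorem isMap_id {n : ℕ} (X : H n n) : IsMap (fun i => i) X X :=
  ⟨0, rfl, 1, fun _ => rfl, by rw [inv_one, map_one, one_mul, mul_one]; rfl⟩

theorem IsMap.perm {n m : ℕ} {φ : Fin n → Fin m} {X : H n n} {Y : H m m} (h : IsMap φ X Y)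
    (σ : Equiv.Perm (Fin m)) : IsMap (fun i => σ (φ i)) X (perm σ * Y * TOF.perm σ⁻¹) := by
  obtain ⟨d, rfl, τ, hτ, rfl⟩ := h
  refine ⟨d, rfl, σ * τ, fun i => congrArg σ (hτ i), ?_⟩
  rw [mul_inv_rev, map_mul, map_mul]
  simp only [mul_assoc]

theorem IsMap.lift {n m : ℕ} {φ : Fin n → Fin m} {X : H n n} {Y : H m m} (h : IsMap φ X Y) :
    IsMap (fun i => (φ i).castSucc) X (lift Y) := by
  obtain ⟨d, rfl, τ, hτ, rfl⟩ := h
  refine ⟨d + 1, rfl, extendLast τ, fun i => ?_, ?_⟩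
  · change _ = (φ i).castSucc
    rw [← hτ]
    exact extendLast_castSucc τ (Fin.castAdd d i)
  · rw [lift_mul, lift_mul, lift_perm, lift_perm]
    congr 2

theorem IsMap.liftBy {n m : ℕ} {φ : Fin n → Fin m} {X : H n n} {Y : H m m} (h : IsMap φ X Y)
    (d : ℕ) : IsMap (fun i => Fin.castAdd d (φ i)) X (liftBy Y d) := by
  induction d with
  | zero => exact h
  | succ d ih => exact ih.lift

theorem IsMap.injective {n m : ℕ} {φ : Fin n → Fin m} {X : H n n} {Y : H m m}
    (h : IsMap φ X Y) : Function.Injective φ := by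
  obtain ⟨d, rfl, τ, hτ, rfl⟩ := h
  obtain rfl : _ = φ := funext hτ
  exact τ.injective.comp ((Fin.cast_injective _).comp (Fin.castAdd_injective n d))

theorem exists_isMap {n m : ℕ} {φ : Fin n → Fin m} (hφ : Function.Injective φ) (X : H n n) :
    ∃ Y, IsMap φ X Y := by
  have hle : n ≤ m := by simpa using Fintype.card_le_of_injective φ hφ
  obtain ⟨d, rfl⟩ := Nat.exists_eq_add_of_le hle
  -- A bijection between two subsets of a finite set extends to a permutation of the whole set.
  let e : {x // x ∈ Set.range (Fin.castAdd (m := d) : Fin n → _)} ≃ {x // x ∈ Set.range φ} :=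
    (Equiv.ofInjective _ (Fin.castAdd_injective n d)).symm.trans (Equiv.ofInjective φ hφ)
  refine ⟨_, d, rfl, e.extendSubtype, fun i => ?_, rfl⟩
  have h : Fin.castAdd d i ∈ Set.range (Fin.castAdd (m := d) : Fin n → _) := ⟨i, rfl⟩
  refine (e.extendSubtype_apply_of_mem _ h).trans ?_
  have : (⟨Fin.castAdd d i, h⟩ : {x // x ∈ Set.range (Fin.castAdd (m := d) : Fin n → _)}) =
      Equiv.ofInjective _ (Fin.castAdd_injective n d) i := rfl
  simp only [e, this, Equiv.trans_apply, Equiv.symm_apply_apply]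
  rfl

theorem IsMap.comp {n m k : ℕ} {φ : Fin n → Fin m} {ψ : Fin m → Fin k} {X : H n n} {Y : H m m}
    {Z : H k k} (h : IsMap φ X Y) (h' : IsMap ψ Y Z) : IsMap (fun i => ψ (φ i)) X Z := by
  obtain ⟨d, rfl, τ, hτ, rfl⟩ := h'
  have := (h.liftBy d).perm τ
  simp only [← hτ]
  exact this

theorem IsMap.mul {n m : ℕ} {φ : Fin n → Fin m} {X X' : H n n} {Y Y' : H m m}
    (h : IsMap φ X Y) (h' : IsMap φ X' Y') : IsMap φ (X * X') (Y * Y') := by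
  obtain ⟨d, rfl, τ, hτ, rfl⟩ := h
  obtain rfl : Y' = _ := h'.unique ⟨d, rfl, τ, hτ, rfl⟩
  refine ⟨d, rfl, τ, hτ, ?_⟩
  change _ = TOF.perm τ * TOF.liftBy (X * X') d * TOF.perm τ⁻¹
  rw [liftBy_mul]
  simp only [mul_assoc]
  rw [← mul_assoc (TOF.perm τ⁻¹), perm_inv_mul_perm, one_mul]

theorem isMap_one {n m : ℕ} {φ : Fin n → Fin m} (hφ : Function.Injective φ) :
    IsMap φ (1 : H n n) 1 := by
  obtain ⟨Y, hY⟩ := exists_isMap hφ 1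
  obtain ⟨d, rfl, τ, hτ, rfl⟩ := hY
  refine ⟨d, rfl, τ, hτ, ?_⟩
  change _ = TOF.perm τ * TOF.liftBy 1 d * TOF.perm τ⁻¹
  rw [liftBy_one, mul_one, perm_mul_perm_inv]

open Classical in
/-- The map `X` applied to the wires given by an injective `φ`. -/
noncomputable def map {n m : ℕ} (φ : Fin n → Fin m) (X : H n n) : H m m :=
  -- The default value `1` makes gates with repeated wires trivial. Thus `map_mul'` and `map_one'`
  -- hold for every `φ`, and `map_map` needs injectivity of the outer placement only.
  if h : Function.Injective φ then (exists_isMap h X).choose else 1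

theorem isMap_map {n m : ℕ} {φ : Fin n → Fin m} (hφ : Function.Injective φ) (X : H n n) :
    IsMap φ X (map φ X) := by
  rw [map, dif_pos hφ]
  exact (exists_isMap hφ X).choose_spec

theorem IsMap.eq_map {n m : ℕ} {φ : Fin n → Fin m} {X : H n n} {Y : H m m} (h : IsMap φ X Y) :
    Y = map φ X := h.unique (isMap_map h.injective X)

theorem map_of_not_injective {n m : ℕ} {φ : Fin n → Fin m} (hφ : ¬ Function.Injective φ)
    (X : H n n) : map φ X = 1 := dif_neg hφ

theorem map_mul' {n m : ℕ} (φ : Fin n → Fin m) (X Y : H n n) :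
    map φ (X * Y) = map φ X * map φ Y := by
  by_cases hφ : Function.Injective φ
  · exact ((isMap_map hφ X).mul (isMap_map hφ Y)).eq_map.symm
  · simp only [map_of_not_injective hφ, mul_one]

theorem map_one' {n m : ℕ} (φ : Fin n → Fin m) : map φ (1 : H n n) = 1 := by
  by_cases hφ : Function.Injective φ
  · exact (isMap_one hφ).eq_map.symm
  · exact map_of_not_injective hφ _

theorem map_map {n m k : ℕ} {ψ : Fin m → Fin k} (hψ : Function.Injective ψ) (φ : Fin n → Fin m)
    (X : H n n) : map ψ (map φ X) = map (fun i => ψ (φ i)) X := by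
  by_cases hφ : Function.Injective φ
  · exact ((isMap_map hφ X).comp (isMap_map hψ _)).eq_map
  · rw [map_of_not_injective hφ, map_one', map_of_not_injective]
    exact fun h => hφ (Function.Injective.of_comp h)

theorem map_id {n : ℕ} (X : H n n) : map (fun i => i) X = X := (isMap_id X).eq_map.symm

theorem lift_eq_map {n : ℕ} (X : H n n) : lift X = map Fin.castSucc X := (isMap_id X).lift.eq_map

theorem liftBy_eq_map {n : ℕ} (X : H n n) (d : ℕ) : liftBy X d = map (Fin.castAdd d) X :=
  ((isMap_id X).liftBy d).eq_map

theorem perm_conj {n : ℕ} (σ : Equiv.Perm (Fin n)) (X : H n n) :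
    perm σ * X * perm σ⁻¹ = map σ X := ((isMap_id X).perm σ).eq_map

theorem lift_map {n m : ℕ} (φ : Fin n → Fin m) (X : H n n) :
    lift (map φ X) = map (fun i => (φ i).castSucc) X := by
  rw [lift_eq_map, map_map (Fin.castSucc_injective m)]

/-! ### Ancillary wires -/

theorem sw_one_zero : sw 1 0 = one 1 := by
  have h : sw 1 0 = strands (add_zero 1) ≫ strands (zero_add 1).symm :=
    braiding_tensorUnit_right (TOF.mk 1)
  rw [h, strands_comp]
  rfl

theorem sw_zero_one : sw 0 1 = one 1 := by
  have h := sw_sw 0 1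
  rw [sw_one_zero] at h
  exact (Category.comp_id _).symm.trans h

/-- Add a last wire with a given state. -/
def addWire (k : H 0 1) (n : ℕ) : H n (n + 1) := one n ⊙ k

/-- Remove the last wire by a given effect. -/
def removeWire (b : H 1 0) (n : ℕ) : H (n + 1) n := one n ⊙ b

theorem addWire_comp_removeWire {k : H 0 1} {b : H 1 0} (h : k ≫ b = one 0) (n : ℕ) :
    addWire k n ≫ removeWire b n = 1 := by
  rw [addWire, removeWire, ← tens_comp, h, Category.comp_id, tens_one]
  rfl

theorem addWire_comp_lift (k : H 0 1) {n m : ℕ} (f : H n m) :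
    addWire k n ≫ lift f = f ≫ addWire k m := by
  unfold addWire lift
  rw [← tens_comp, Category.id_comp, Category.comp_id]
  nth_rewrite 2 [← tens_one_zero f]
  rw [← tens_comp, Category.id_comp, Category.comp_id]

theorem lift_comp_removeWire (b : H 1 0) {n m : ℕ} (f : H n m) :
    lift f ≫ removeWire b m = removeWire b n ≫ f := by
  unfold removeWire lift
  rw [← tens_comp, Category.id_comp, Category.comp_id]
  nth_rewrite 2 [← tens_one_zero f]
  rw [← tens_comp, Category.id_comp, Category.comp_id]

theorem addWire_succ (k : H 0 1) (n : ℕ) : addWire k (n + 1) = one n ⊙ (one 1 ⊙ k) := by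
  refine Eq.trans ?_ (eq_of_heq (tens_assoc_of (one n) (one 1) k))
  rw [tens_one]
  rfl

theorem removeWire_succ (b : H 1 0) (n : ℕ) : removeWire b (n + 1) = one n ⊙ (one 1 ⊙ b) := by
  refine Eq.trans ?_ (eq_of_heq (tens_assoc_of (one n) (one 1) b))
  rw [tens_one]
  rfl

theorem lift_addWire (k : H 0 1) (n : ℕ) : lift (addWire k n) = one n ⊙ (k ⊙ one 1) :=
  eq_of_heq (tens_assoc_of (one n) k (one 1))

theorem lift_removeWire (b : H 1 0) (n : ℕ) : lift (removeWire b n) = one n ⊙ (b ⊙ one 1) :=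
  eq_of_heq (tens_assoc_of (one n) b (one 1))

theorem addWire_comp_swapLast (k : H 0 1) (n : ℕ) :
    addWire k (n + 1) ≫ swapLast n = lift (addWire k n) := by
  have h : (one 1 ⊙ k) ≫ cr = (k ⊙ one 1 : H (0 + 1) 2) := by
    have h := sw_natural (one 1) k
    rw [sw_one_zero] at h
    exact h.trans (Category.id_comp _)
  rw [addWire_succ, swapLast, lift_addWire]
  exact (tens_comp (one n) (one n) (one 1 ⊙ k) cr).symm.trans
    (congrArg₂ (fun a b => a ⊙ b) (Category.comp_id _) h)

theorem swapLast_comp_removeWire (b : H 1 0) (n : ℕ) :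
    swapLast n ≫ removeWire b (n + 1) = lift (removeWire b n) := by
  have h : cr ≫ (one 1 ⊙ b) = (b ⊙ one 1 : H 2 (0 + 1)) := by
    have h := sw_natural b (one 1)
    rw [sw_zero_one] at h
    exact h.symm.trans (Category.comp_id _)
  rw [removeWire_succ, swapLast, lift_removeWire]
  exact (tens_comp (one n) (one n) cr (one 1 ⊙ b)).symm.trans
    (congrArg₂ (fun a b => a ⊙ b) (Category.comp_id _) h)

/-- Extend an injection of wires by a last wire. -/
def extend {n m : ℕ} (φ : Fin n → Fin m) : Fin (n + 1) → Fin (m + 1) :=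
  Fin.snoc (α := fun _ => Fin (m + 1)) (fun i => (φ i).castSucc) (Fin.last m)

@[simp] theorem extend_castSucc {n m : ℕ} (φ : Fin n → Fin m) (i : Fin n) :
    extend φ i.castSucc = (φ i).castSucc :=
  Fin.snoc_castSucc (α := fun _ => Fin (m + 1)) (Fin.last m) (fun i => (φ i).castSucc) i

@[simp] theorem extend_last {n m : ℕ} (φ : Fin n → Fin m) :
    extend φ (Fin.last n) = Fin.last m :=
  Fin.snoc_last (α := fun _ => Fin (m + 1)) (Fin.last m) (fun i => (φ i).castSucc)

theorem extend_injective {n m : ℕ} {φ : Fin n → Fin m} (hφ : Function.Injective φ) :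
    Function.Injective (extend φ) := by
  intro i j
  induction i using Fin.lastCases with
  | last =>
    induction j using Fin.lastCases with
    | last => simp
    | cast j => simp [(Fin.castSucc_lt_last _).ne']
  | cast i =>
    induction j using Fin.lastCases with
    | last => simp [(Fin.castSucc_lt_last _).ne]
    | cast j => simp [hφ.eq_iff]

/-- A way to write an injection as a composite of permutations and of `Fin.castSucc`. -/
theorem injection_induction {n : ℕ} {P : ∀ {m : ℕ}, (Fin n → Fin m) → Prop}
    (id : P fun i : Fin n => i)
    (castSucc : ∀ {m : ℕ} (φ : Fin n → Fin m), P φ → P fun i => (φ i).castSucc)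
    (perm : ∀ {m : ℕ} (φ : Fin n → Fin m) (σ : Equiv.Perm (Fin m)), P φ → P fun i => σ (φ i))
    {m : ℕ} {φ : Fin n → Fin m} (hφ : Function.Injective φ) : P φ := by
  -- Placing the map `1` is only a way to obtain a permutation `τ` that restricts to `φ`.
  obtain ⟨d, rfl, τ, hτ, -⟩ := isMap_map hφ 1
  obtain rfl : _ = φ := funext hτ
  refine perm _ τ ?_
  clear hτ hφ τ
  induction d with
  | zero => exact id
  | succ d ih => exact castSucc _ ih

/-- The distinguished last wire has to stay last, so the new idle wire is inserted just before it;
this explains the conjugation by `swapLast`. -/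
theorem isMap_extend_castSucc {n m : ℕ} {φ : Fin n → Fin m} {X : H (n + 1) (n + 1)}
    {Y : H (m + 1) (m + 1)} (h : IsMap (extend φ) X Y) :
    IsMap (extend fun i => (φ i).castSucc) X (swapLast m * lift Y * swapLast m) := by
  have := h.lift.perm (Equiv.swap (Fin.last m).castSucc (Fin.last (m + 1)))
  rw [Equiv.swap_inv, ← swapLast_eq_perm] at this
  convert this using 1
  funext i
  induction i using Fin.lastCases with
  | last => simp
  | cast i =>
    rw [extend_castSucc, extend_castSucc, Equiv.swap_apply_of_ne_of_ne]
    · simp [Fin.ext_iff, (φ i).isLt.ne]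
    · simp [Fin.ext_iff]; omega

theorem isMap_extend_perm {n m : ℕ} {φ : Fin n → Fin m} (σ : Equiv.Perm (Fin m))
    {X : H (n + 1) (n + 1)} {Y : H (m + 1) (m + 1)} (h : IsMap (extend φ) X Y) :
    IsMap (extend fun i => σ (φ i)) X (lift (perm σ) * Y * lift (perm σ⁻¹)) := by
  have := h.perm (extendLast σ)
  rw [← lift_perm, show (extendLast σ)⁻¹ = extendLast σ⁻¹ from ?_, ← lift_perm] at this
  · convert this using 1
    funext i
    induction i using Fin.lastCases <;> simp
  · ext i
    induction i using Fin.lastCases <;> simp [extendLast]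

/-- Transports a rule about a fresh wire next to a small map to arbitrary wires. The rule survives
permuting the other wires and adding idle ones, and these two operations produce every injection. -/
theorem addWire_comp_map (k : H 0 1) {n m : ℕ} {φ : Fin n → Fin m} (hφ : Function.Injective φ)
    {X : H (n + 1) (n + 1)} {Y : H n n} (h : addWire k n ≫ X = Y ≫ addWire k n) :
    addWire k m ≫ map (extend φ) X = map φ Y ≫ addWire k m := by
  suffices H : ∃ X' Y', IsMap (extend φ) X X' ∧ IsMap φ Y Y' ∧
      addWire k m ≫ X' = Y' ≫ addWire k m by
    obtain ⟨X', Y', hX, hY, h⟩ := H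
    rwa [← hX.eq_map, ← hY.eq_map]
  refine injection_induction (P := fun {m} φ => ∃ X' Y', IsMap (extend φ) X X' ∧ IsMap φ Y Y' ∧
      addWire k m ≫ X' = Y' ≫ addWire k m) ?_ ?_ ?_ hφ
  · refine ⟨X, Y, ?_, isMap_id Y, h⟩
    convert isMap_id X using 1
    funext i
    induction i using Fin.lastCases <;> simp
  · intro m φ ih
    obtain ⟨X', Y', hX, hY, h⟩ := ih
    refine ⟨_, _, isMap_extend_castSucc hX, hY.lift, ?_⟩
    rw [comp_mul, comp_mul, addWire_comp_swapLast, ← lift_comp, h, lift_comp, Category.assoc,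
      ← addWire_comp_swapLast, Category.assoc, ← mul_def, swapLast_swapLast, comp_one]
  · intro m φ σ ih
    obtain ⟨X', Y', hX, hY, h⟩ := ih
    refine ⟨_, _, isMap_extend_perm σ hX, hY.perm σ, ?_⟩
    rw [comp_mul, comp_mul, addWire_comp_lift, Category.assoc (perm σ), h,
      ← Category.assoc (perm σ), Category.assoc, addWire_comp_lift, mul_comp]
    rfl

theorem map_comp_removeWire (b : H 1 0) {n m : ℕ} {φ : Fin n → Fin m}
    (hφ : Function.Injective φ) {X : H (n + 1) (n + 1)} {Y : H n n}
    (h : X ≫ removeWire b n = removeWire b n ≫ Y) :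
    map (extend φ) X ≫ removeWire b m = removeWire b m ≫ map φ Y := by
  suffices H : ∃ X' Y', IsMap (extend φ) X X' ∧ IsMap φ Y Y' ∧
      X' ≫ removeWire b m = removeWire b m ≫ Y' by
    obtain ⟨X', Y', hX, hY, h⟩ := H
    rwa [← hX.eq_map, ← hY.eq_map]
  refine injection_induction (P := fun {m} φ => ∃ X' Y', IsMap (extend φ) X X' ∧ IsMap φ Y Y' ∧
      X' ≫ removeWire b m = removeWire b m ≫ Y') ?_ ?_ ?_ hφ
  · refine ⟨X, Y, ?_, isMap_id Y, h⟩
    convert isMap_id X using 1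
    funext i
    induction i using Fin.lastCases <;> simp
  · intro m φ ih
    obtain ⟨X', Y', hX, hY, h⟩ := ih
    refine ⟨_, _, isMap_extend_castSucc hX, hY.lift, ?_⟩
    rw [mul_assoc, mul_comp, mul_comp, swapLast_comp_removeWire, ← lift_comp, h, lift_comp,
      ← Category.assoc, ← swapLast_comp_removeWire, ← Category.assoc, ← mul_def,
      swapLast_swapLast, one_comp]
  · intro m φ σ ih
    obtain ⟨X', Y', hX, hY, h⟩ := ih
    refine ⟨_, _, isMap_extend_perm σ hX, hY.perm σ, ?_⟩
    rw [mul_assoc, mul_comp, mul_comp, lift_comp_removeWire, ← Category.assoc X', h,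
      ← Category.assoc, ← Category.assoc, lift_comp_removeWire, comp_mul, comp_mul]

/-- Feed the last wire with a state and project it to an effect. -/
def anc (k : H 0 1) (b : H 1 0) {n : ℕ} (X : H (n + 1) (n + 1)) : H n n :=
  addWire k n ≫ X ≫ removeWire b n

theorem anc_lift_mul (k : H 0 1) (b : H 1 0) {n : ℕ} (X : H n n) (Y : H (n + 1) (n + 1)) :
    anc k b (lift X * Y) = X * anc k b Y := by
  simp only [anc, mul_def]
  rw [Category.assoc, ← Category.assoc (addWire k n), addWire_comp_lift, Category.assoc]

theorem anc_mul_lift (k : H 0 1) (b : H 1 0) {n : ℕ} (X : H n n) (Y : H (n + 1) (n + 1)) :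
    anc k b (Y * lift X) = anc k b Y * X := by
  simp only [anc, mul_def, Category.assoc]
  rw [lift_comp_removeWire]

/-- An ancilla is insensitive to what happens to the other wires, so constructions that use one can
be placed on any wires; oracles are defined in this way. -/
theorem map_anc (k : H 0 1) (b : H 1 0) {n m : ℕ} {φ : Fin n → Fin m}
    (hφ : Function.Injective φ) (X : H (n + 1) (n + 1)) :
    map φ (anc k b X) = anc k b (map (extend φ) X) := by
  suffices H : ∃ X', IsMap (extend φ) X X' ∧ IsMap φ (anc k b X) (anc k b X') by
    obtain ⟨X', hX, h⟩ := H
    rw [← hX.eq_map, ← h.eq_map]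
  refine injection_induction (P := fun {m} φ => ∃ X', IsMap (extend φ) X X' ∧
      IsMap φ (anc k b X) (anc k b X')) ?_ ?_ ?_ hφ
  · refine ⟨X, ?_, isMap_id _⟩
    convert isMap_id X using 1
    funext i
    induction i using Fin.lastCases <;> simp
  · intro m φ ih
    obtain ⟨X', hX, h⟩ := ih
    refine ⟨_, isMap_extend_castSucc hX, ?_⟩
    convert h.lift using 1
    simp only [anc, mul_def, Category.assoc]
    rw [swapLast_comp_removeWire, ← Category.assoc, addWire_comp_swapLast, lift_comp, lift_comp]
  · intro m φ σ ih
    obtain ⟨X', hX, h⟩ := ih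
    refine ⟨_, isMap_extend_perm σ hX, ?_⟩
    convert h.perm σ using 1
    rw [mul_assoc, anc_lift_mul, anc_mul_lift, mul_assoc]

/-! ### Tensoring with idle wires on the left -/

/-- The hexagon peels the last wire off the bundle, at the cost of one crossing. Only the positions
of the bundle are recorded, because the single wire is idle where this is used; the straight wires
reconcile `1 + n` with `n + 1`. -/
theorem exists_perm_sw_one (n : ℕ) : ∃ σ : Equiv.Perm (Fin (n + 1)),
    (∀ i : Fin n, σ i.castSucc = i.succ) ∧ sw 1 n = strands (add_comm 1 n) ≫ perm σ := by
  induction n with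
  | zero =>
    refine ⟨1, fun i => i.elim0, ?_⟩
    rw [map_one, sw_one_zero]
    exact (Category.id_comp _).symm
  | succ n ih =>
    obtain ⟨σ, hσ, h⟩ := ih
    refine ⟨extendLast σ * Equiv.swap (Fin.last n).castSucc (Fin.last (n + 1)), ?_, ?_⟩
    · intro i
      rw [Equiv.Perm.mul_apply]
      induction i using Fin.lastCases with
      | last => simp
      | cast i =>
        rw [Equiv.swap_apply_of_ne_of_ne]
        · rw [extendLast_castSucc, hσ]; rfl
        · simp [Fin.ext_iff, i.isLt.ne]
        · simp [Fin.ext_iff]; omega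
    · have hex := sound (.hexagon 1 n 1)
      have h1 : strands (add_assoc 1 n 1) ≫ sw 1 (n + 1) = lift (sw 1 n) ≫ swapLast n :=
        (congrArg (fun z => strands (add_assoc 1 n 1) ≫ z) (Category.comp_id _)).symm.trans
          (hex.trans (congrArg (fun z => lift (sw 1 n) ≫ z) (Category.id_comp (swapLast n))))
      rw [h, lift_comp, lift_perm, swapLast_eq_perm, Category.assoc, ← mul_def, ← map_mul] at h1
      have h2 : lift (strands (add_comm 1 n)) = strands (congrArg (· + 1) (add_comm 1 n)) :=
        sound (wire_tensor (add_comm 1 n) (rfl : 1 = 1))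
      rw [h2] at h1
      have h3 := congrArg (fun z => strands (add_assoc 1 n 1).symm ≫ z) h1
      simp only [← Category.assoc, strands_comp] at h3
      exact (Category.id_comp _).symm.trans h3

theorem liftBy_eq_tens {n : ℕ} (X : H n n) (d : ℕ) : liftBy X d = X ⊙ one d := by
  induction d with
  | zero => exact (tens_one_zero X).symm
  | succ d ih =>
    rw [liftBy, ih, lift, tens_assoc_one, tens_one]

theorem map_comp_strands {n m k : ℕ} (h : m = k) (φ : Fin n → Fin m) (X : H n n) :
    map φ X ≫ strands h = strands h ≫ map (fun i => Fin.cast h (φ i)) X := by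
  subst h
  exact (Category.comp_id _).trans (Category.id_comp _).symm

theorem one_tens_aux {n : ℕ} (X : H n n) (N : ℕ) (h : 1 + n = N) (φ : Fin n → Fin N)
    (hφ : ∀ i, (φ i).val = 1 + i) : (one 1 ⊙ X) ≫ strands h = strands h ≫ map φ X := by
  obtain ⟨σ, hσ, hs⟩ := exists_perm_sw_one n
  have h1 := sw_natural (one 1) X
  rw [hs] at h1
  have h2 := congrArg (fun z => z ≫ perm σ⁻¹) h1
  simp only [Category.assoc] at h2
  rw [← mul_def, perm_mul_perm_inv, comp_one] at h2
  have h3 : (X ⊙ one 1) = lift X := rfl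
  rw [h3, ← mul_comp, ← mul_def, lift_eq_map, perm_conj, map_map σ.injective] at h2
  have h4 := congrArg (fun z => z ≫ strands ((add_comm n 1).trans h)) h2
  simp only [Category.assoc] at h4
  rw [strands_comp, map_comp_strands, ← Category.assoc, strands_comp] at h4
  refine h4.trans (congrArg (fun ψ => strands h ≫ map ψ X) (funext fun i => ?_))
  rw [hσ]
  simp [Fin.ext_iff, hφ, add_comm]

/-- The number `N` and the placement `φ`, known through its values only, are kept free, so that the
induction can pass between `a + 1 + n` and `a + (1 + n)` without casting maps. -/
theorem one_tens_eq_map' (a : ℕ) : ∀ {n : ℕ} (X : H n n) (N : ℕ) (h : a + n = N)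
    (φ : Fin n → Fin N) (_ : ∀ i, (φ i).val = a + i),
    (one a ⊙ X) ≫ strands h = strands h ≫ map φ X := by
  induction a with
  | zero =>
    intro n X N h φ hφ
    have h1 := congrArg (fun z => z ≫ strands ((zero_add n).symm.trans h)) (one_zero_tens X)
    simp only [Category.assoc, strands_comp] at h1
    rw [h1]
    obtain rfl : n = N := (zero_add n).symm.trans h
    obtain rfl : φ = fun i => i := funext fun i => by simp [Fin.ext_iff, hφ]
    rw [map_id]
    exact congrArg (fun z => strands h ≫ z) (Category.comp_id X)
  | succ a ih =>
    intro n X N h φ hφ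
    have h1 := tens_assoc (one a) (one 1) X
    rw [tens_one] at h1
    have h2 : (one 1 ⊙ X) = map (Fin.natAdd 1) X := by
      have := one_tens_aux X (1 + n) rfl (Fin.natAdd 1) fun i => rfl
      exact (Category.comp_id _).symm.trans (this.trans (Category.id_comp _))
    have h3 : (one a ⊙ (one 1 ⊙ X)) = map (Fin.natAdd a) (one 1 ⊙ X) := by
      have := ih (one 1 ⊙ X) (a + (1 + n)) rfl (Fin.natAdd a) fun i => rfl
      exact (Category.comp_id _).symm.trans (this.trans (Category.id_comp _))
    rw [h3, h2, map_map (Fin.natAdd_injective _ _)] at h1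
    have h4 := congrArg (fun z => z ≫ strands ((add_assoc a 1 n).symm.trans h)) h1
    simp only [Category.assoc] at h4
    rw [strands_comp, map_comp_strands, ← Category.assoc, strands_comp] at h4
    refine h4.trans (congrArg (fun ψ => strands h ≫ map ψ X) (funext fun i => ?_))
    simp [Fin.ext_iff, hφ, add_assoc]

theorem one_tens_eq_map (a : ℕ) {n : ℕ} (X : H n n) : one a ⊙ X = map (Fin.natAdd a) X := by
  have := one_tens_eq_map' a X (a + n) rfl (Fin.natAdd a) fun i => rfl
  exact (Category.comp_id _).symm.trans (this.trans (Category.id_comp _))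

/-! ### Gates on chosen wires -/

/-- The Toffoli gate with controls `i`, `j` and target `k`. -/
noncomputable def T {N : ℕ} (i j k : Fin N) : H N N := map ![i, j, k] (ofCircuit .tof)

/-- The controlled not gate with control `i` and target `j`. -/
noncomputable def C {N : ℕ} (i j : Fin N) : H N N := map ![i, j] (ofCircuit Circuit.cnot)

/-- The not gate on the wire `i`. -/
noncomputable def X {N : ℕ} (i : Fin N) : H N N := map ![i] (ofCircuit Circuit.not)

/-- The state with the given bit. -/
def ketB (b : Bool) : H 0 1 := ofCircuit (Circuit.ketBit b)

/-- The effect with the given bit. -/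
def braB (b : Bool) : H 1 0 := ofCircuit (if b then .braOne else Circuit.braZero)

theorem map_T {N M : ℕ} {φ : Fin N → Fin M} (hφ : Function.Injective φ) (i j k : Fin N) :
    map φ (T i j k) = T (φ i) (φ j) (φ k) := by
  rw [T, T, map_map hφ]
  congr 1
  funext x
  fin_cases x <;> rfl

theorem map_C {N M : ℕ} {φ : Fin N → Fin M} (hφ : Function.Injective φ) (i j : Fin N) :
    map φ (C i j) = C (φ i) (φ j) := by
  rw [C, C, map_map hφ]
  congr 1
  funext x
  fin_cases x <;> rfl

theorem map_X {N M : ℕ} {φ : Fin N → Fin M} (hφ : Function.Injective φ) (i : Fin N) :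
    map φ (X i) = X (φ i) := by
  rw [X, X, map_map hφ]
  congr 1
  funext x
  fin_cases x
  rfl

theorem lift_T {N : ℕ} (i j k : Fin N) :
    lift (T i j k) = T i.castSucc j.castSucc k.castSucc := by
  rw [lift_eq_map, map_T (Fin.castSucc_injective N)]

theorem lift_C {N : ℕ} (i j : Fin N) : lift (C i j) = C i.castSucc j.castSucc := by
  rw [lift_eq_map, map_C (Fin.castSucc_injective N)]

theorem lift_X {N : ℕ} (i : Fin N) : lift (X i) = X i.castSucc := by
  rw [lift_eq_map, map_X (Fin.castSucc_injective N)]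

theorem T_of_not_injective {N : ℕ} {i j k : Fin N} (h : ¬ Function.Injective ![i, j, k]) :
    T i j k = 1 := map_of_not_injective h _

theorem C_self {N : ℕ} (i : Fin N) : C i i = 1 :=
  map_of_not_injective (fun h => absurd (@h 0 1 rfl) (by decide)) _

theorem T_self_left {N : ℕ} (i k : Fin N) : T i i k = 1 :=
  T_of_not_injective fun h => absurd (@h 0 1 rfl) (by decide)

theorem T_self_right {N : ℕ} (i k : Fin N) : T i k k = 1 :=
  T_of_not_injective fun h => absurd (@h 1 2 rfl) (by decide)

theorem T_self_outer {N : ℕ} (i k : Fin N) : T k i k = 1 :=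
  T_of_not_injective fun h => absurd (@h 0 2 rfl) (by decide)

theorem injective_pair {N : ℕ} {a b : Fin N} (h : a ≠ b) : Function.Injective ![a, b] := by
  intro i j hij
  fin_cases i <;> fin_cases j <;> simp_all

theorem injective_three {N : ℕ} {a b c : Fin N} (hab : a ≠ b) (hac : a ≠ c) (hbc : b ≠ c) :
    Function.Injective ![a, b, c] := by
  intro i j hij
  fin_cases i <;> fin_cases j <;> simp_all

theorem injective_four {N : ℕ} {a b c d : Fin N} (hab : a ≠ b) (hac : a ≠ c) (had : a ≠ d)
    (hbc : b ≠ c) (hbd : b ≠ d) (hcd : c ≠ d) : Function.Injective ![a, b, c, d] := by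
  intro i j hij
  fin_cases i <;> fin_cases j <;> simp_all

/-- Add one more wire to an injective list of wires. -/
theorem injective_cons {N n : ℕ} {a : Fin N} {v : Fin n → Fin N} (hv : Function.Injective v)
    (ha : ∀ i, a ≠ v i) : Function.Injective (Matrix.vecCons a v) :=
  Fin.cons_injective_iff.2 ⟨fun ⟨i, hi⟩ => ha i hi.symm, hv⟩

/-! #### Circuits as placed gates -/

theorem tens_one_eq_map {n : ℕ} (X : H n n) (d : ℕ) : X ⊙ one d = map (Fin.castAdd d) X := by
  rw [← liftBy_eq_tens, liftBy_eq_map]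

theorem perm_involutive_conj {n : ℕ} {σ : Equiv.Perm (Fin n)} (hσ : σ⁻¹ = σ) (X : H n n) :
    perm σ ≫ X ≫ perm σ = map σ X := by
  rw [← perm_conj, hσ, mul_assoc]; rfl

theorem ofCircuit_tof : ofCircuit .tof = (T 0 1 2 : H 3 3) :=
  (map_id _).symm.trans
    (congrArg (fun φ => map φ (ofCircuit .tof)) (funext fun x => by fin_cases x <;> rfl))

theorem ofCircuit_cnot : ofCircuit Circuit.cnot = (C 0 1 : H 2 2) :=
  (map_id _).symm.trans
    (congrArg (fun φ => map φ (ofCircuit Circuit.cnot)) (funext fun x => by fin_cases x <;> rfl))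

theorem ofCircuit_not : ofCircuit Circuit.not = (X 0 : H 1 1) :=
  (map_id _).symm.trans
    (congrArg (fun φ => map φ (ofCircuit Circuit.not)) (funext fun x => by fin_cases x; rfl))

theorem ofCircuit_cross : ofCircuit Circuit.cross = (perm (Equiv.swap 0 1) : H 2 2) := by
  have h := swapLast_eq_perm 0
  have h2 : swapLast 0 = cr := by
    have := one_zero_tens cr
    simp only [wire_rfl] at this
    exact ((Category.comp_id _).symm.trans this).trans (Category.id_comp _)
  rw [h2] at h
  exact h

theorem lift_cr : ofCircuit (Circuit.cross ⊠ Circuit.id 1) = (perm (Equiv.swap 0 1) : H 3 3) := by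
  change lift (ofCircuit Circuit.cross) = _
  rw [ofCircuit_cross, lift_perm]
  congr 1
  ext x
  revert x
  decide

theorem ofCircuit_id_cross (n : ℕ) :
    ofCircuit (Circuit.id n ⊠ Circuit.cross) =
      perm (Equiv.swap (Fin.last n).castSucc (Fin.last (n + 1))) :=
  swapLast_eq_perm n

theorem ofCircuit_tofFlip : ofCircuit Circuit.tofFlip = (T 2 1 0 : H 3 3) := by
  have hr : ofCircuit Circuit.rev = (perm (Equiv.swap 0 2) : H 3 3) := by
    change (ofCircuit (Circuit.cross ⊠ Circuit.id 1) * ofCircuit (Circuit.id 1 ⊠ Circuit.cross)) *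
      ofCircuit (Circuit.cross ⊠ Circuit.id 1) = _
    rw [lift_cr, ofCircuit_id_cross, ← map_mul, ← map_mul]
    congr 1
    ext x
    revert x
    decide
  change (ofCircuit Circuit.rev * ofCircuit .tof) * ofCircuit Circuit.rev = _
  rw [hr, ofCircuit_tof]
  refine (congrArg _ (congrArg perm (Equiv.swap_inv 0 2).symm)).trans ?_
  rw [perm_conj, map_T (Equiv.injective _)]
  rfl

theorem ofCircuit_cnotFlip : ofCircuit Circuit.cnotFlip = (C 1 0 : H 2 2) := by
  change (ofCircuit Circuit.cross * ofCircuit Circuit.cnot) * ofCircuit Circuit.cross = _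
  rw [ofCircuit_cross, ofCircuit_cnot]
  refine (congrArg _ (congrArg perm (Equiv.swap_inv 0 1).symm)).trans ?_
  rw [perm_conj, map_C (Equiv.injective _)]
  rfl

theorem ofCircuit_tens_id {n : ℕ} (c : Circuit n n) (d : ℕ) :
    ofCircuit (c ⊠ Circuit.id d) = map (Fin.castAdd d) (ofCircuit c) :=
  tens_one_eq_map (ofCircuit c) d

theorem ofCircuit_id_tens {n : ℕ} (c : Circuit n n) (d : ℕ) :
    ofCircuit (Circuit.id d ⊠ c) = map (Fin.natAdd d) (ofCircuit c) :=
  one_tens_eq_map d (ofCircuit c)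

theorem ofCircuit_tofGapLow : ofCircuit Circuit.tofGapLow = (T 0 1 3 : H 4 4) := by
  change (ofCircuit (Circuit.id 2 ⊠ Circuit.cross) * ofCircuit (.tof ⊠ Circuit.id 1)) *
    ofCircuit (Circuit.id 2 ⊠ Circuit.cross) = _
  rw [ofCircuit_id_cross, ofCircuit_tens_id, ofCircuit_tof]
  refine (congrArg _ (congrArg perm (Equiv.swap_inv _ _).symm)).trans ?_
  rw [perm_conj, map_T (Fin.castAdd_injective _ _), map_T (Equiv.injective _)]
  rfl

theorem ofCircuit_cross_id_two :
    ofCircuit (Circuit.cross ⊠ Circuit.id 2) = (perm (Equiv.swap 0 1) : H 4 4) := by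
  refine (lift_lift (ofCircuit Circuit.cross)).symm.trans ?_
  rw [ofCircuit_cross, lift_perm, lift_perm]
  congr 1
  ext x
  revert x
  decide

theorem ofCircuit_tofGapHigh : ofCircuit Circuit.tofGapHigh = (T 0 2 3 : H 4 4) := by
  change (ofCircuit (Circuit.cross ⊠ Circuit.id 2) * ofCircuit (Circuit.id 1 ⊠ .tof)) *
    ofCircuit (Circuit.cross ⊠ Circuit.id 2) = _
  rw [ofCircuit_cross_id_two, ofCircuit_id_tens, ofCircuit_tof]
  refine (congrArg _ (congrArg perm (Equiv.swap_inv 0 1).symm)).trans ?_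
  rw [perm_conj, map_T (Fin.natAdd_injective _ _), map_T (Equiv.injective _)]
  rfl

/-! #### The identities between gates -/

theorem T_comm_target_aux : T 0 1 2 * T 4 3 2 = (T 4 3 2 * T 0 1 2 : H 5 5) := by
  have h : ofCircuit (.tof ⊠ Circuit.id 2) * ofCircuit (Circuit.id 2 ⊠ Circuit.tofFlip) =
    ofCircuit (Circuit.id 2 ⊠ Circuit.tofFlip) * ofCircuit (.tof ⊠ Circuit.id 2) :=
    sound (.ax .tof_comm_target)
  rwa [ofCircuit_tens_id, ofCircuit_id_tens, ofCircuit_tof, ofCircuit_tofFlip,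
    map_T (Fin.castAdd_injective _ _), map_T (Fin.natAdd_injective _ _)] at h

theorem T_comm_control_aux : T 2 1 0 * T 2 3 4 = (T 2 3 4 * T 2 1 0 : H 5 5) := by
  have h : ofCircuit (Circuit.tofFlip ⊠ Circuit.id 2) * ofCircuit (Circuit.id 2 ⊠ .tof) =
    ofCircuit (Circuit.id 2 ⊠ .tof) * ofCircuit (Circuit.tofFlip ⊠ Circuit.id 2) :=
    sound (.ax .tof_comm_control)
  rwa [ofCircuit_tens_id, ofCircuit_id_tens, ofCircuit_tof, ofCircuit_tofFlip,
    map_T (Fin.castAdd_injective _ _), map_T (Fin.natAdd_injective _ _)] at h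

theorem T_comm_controls_aux : T 2 1 0 * T 1 2 3 = (T 1 2 3 * T 2 1 0 : H 4 4) := by
  have h : ofCircuit (Circuit.tofFlip ⊠ Circuit.id 1) * ofCircuit (Circuit.id 1 ⊠ .tof) =
    ofCircuit (Circuit.id 1 ⊠ .tof) * ofCircuit (Circuit.tofFlip ⊠ Circuit.id 1) :=
    sound (.ax .tof_comm_controls)
  rwa [ofCircuit_tens_id, ofCircuit_id_tens, ofCircuit_tof, ofCircuit_tofFlip,
    map_T (Fin.castAdd_injective _ _), map_T (Fin.natAdd_injective _ _)] at h

theorem T_comm_both_aux : T 0 2 3 * T 1 2 3 = (T 1 2 3 * T 0 2 3 : H 4 4) := by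
  have h : ofCircuit Circuit.tofGapHigh * ofCircuit (Circuit.id 1 ⊠ .tof) =
    ofCircuit (Circuit.id 1 ⊠ .tof) * ofCircuit Circuit.tofGapHigh :=
    sound (.ax .tof_comm_both)
  rwa [ofCircuit_tofGapHigh, ofCircuit_id_tens, ofCircuit_tof,
    map_T (Fin.natAdd_injective _ _)] at h

theorem T_mul_self_aux : T 0 1 2 * T 0 1 2 = (1 : H 3 3) := by
  have h : ofCircuit .tof * ofCircuit .tof = (1 : H 3 3) := sound (.ax .tof_tof)
  rwa [ofCircuit_tof] at h

theorem C_conj_T_aux : C 0 1 * T 1 2 3 * C 0 1 = (T 0 2 3 * T 1 2 3 : H 4 4) := by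
  have h : ofCircuit (Circuit.cnot ⊠ Circuit.id 2) * ofCircuit (Circuit.id 1 ⊠ .tof) *
      ofCircuit (Circuit.cnot ⊠ Circuit.id 2) =
    ofCircuit Circuit.tofGapHigh * ofCircuit (Circuit.id 1 ⊠ .tof) :=
    sound (.ax .push_cnot_control)
  rwa [ofCircuit_tofGapHigh, ofCircuit_id_tens, ofCircuit_tens_id, ofCircuit_tof, ofCircuit_cnot,
    map_T (Fin.natAdd_injective _ _), map_C (Fin.castAdd_injective _ _)] at h

theorem T_conj_T_aux : T 0 1 2 * T 1 2 3 * T 0 1 2 = (T 0 1 3 * T 1 2 3 : H 4 4) := by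
  have h : ofCircuit (.tof ⊠ Circuit.id 1) * ofCircuit (Circuit.id 1 ⊠ .tof) *
      ofCircuit (.tof ⊠ Circuit.id 1) =
    ofCircuit Circuit.tofGapLow * ofCircuit (Circuit.id 1 ⊠ .tof) :=
    sound (.ax .push_tof_control)
  rwa [ofCircuit_tofGapLow, ofCircuit_id_tens, ofCircuit_tens_id, ofCircuit_tof,
    map_T (Fin.natAdd_injective _ _), map_T (Fin.castAdd_injective _ _)] at h

theorem T_conj_C_aux : T 0 1 2 * C 2 3 * T 0 1 2 = (T 0 1 3 * C 2 3 : H 4 4) := by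
  have h : ofCircuit (.tof ⊠ Circuit.id 1) * ofCircuit (Circuit.id 2 ⊠ Circuit.cnot) *
      ofCircuit (.tof ⊠ Circuit.id 1) =
    ofCircuit Circuit.tofGapLow * ofCircuit (Circuit.id 2 ⊠ Circuit.cnot) :=
    sound (.ax .push_tof_cnot)
  rwa [ofCircuit_tofGapLow, ofCircuit_id_tens, ofCircuit_tens_id, ofCircuit_tof, ofCircuit_cnot,
    map_C (Fin.natAdd_injective _ _), map_T (Fin.castAdd_injective _ _)] at h

theorem C_swap : C 0 1 * C 1 0 * C 0 1 = (perm (Equiv.swap 0 1) : H 2 2) := by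
  have h : ofCircuit Circuit.cnot * ofCircuit Circuit.cnotFlip * ofCircuit Circuit.cnot =
    ofCircuit Circuit.cross := sound (.ax .cnot_cross)
  rwa [ofCircuit_cnot, ofCircuit_cnotFlip, ofCircuit_cross] at h

theorem T_symm_aux : T 0 1 2 = (T 1 0 2 : H 3 3) := by
  have h : ofCircuit .tof = ofCircuit (Circuit.cross ⊠ Circuit.id 1) * ofCircuit .tof *
    ofCircuit (Circuit.cross ⊠ Circuit.id 1) := sound (.ax .tof_cross)
  rw [lift_cr, ofCircuit_tof] at h
  refine h.trans ((congrArg _ (congrArg perm (Equiv.swap_inv 0 1).symm)).trans ?_)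
  rw [perm_conj, map_T (Equiv.injective _)]
  rfl

/-! ### Gate identities on arbitrary wires -/

theorem T_symm {N : ℕ} (i j k : Fin N) : T i j k = T j i k := by
  by_cases h : Function.Injective ![i, j, k]
  · have := congrArg (map ![i, j, k]) T_symm_aux
    rwa [map_T h, map_T h] at this
  · have h' : ¬ Function.Injective ![j, i, k] := fun h' => h (by
      have := h'.comp (Equiv.swap (0 : Fin 3) 1).injective
      convert this using 1
      funext x
      fin_cases x <;> rfl)
    rw [T_of_not_injective h, T_of_not_injective h']

theorem T_mul_self {N : ℕ} (i j k : Fin N) : T i j k * T i j k = 1 := by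
  by_cases h : Function.Injective ![i, j, k]
  · have := congrArg (map ![i, j, k]) T_mul_self_aux
    rwa [map_mul', map_T h, map_one'] at this
  · rw [T_of_not_injective h, mul_one]

theorem C_conj_T {N : ℕ} {a b c d : Fin N} (h : Function.Injective ![a, b, c, d]) :
    C a b * T b c d * C a b = T a c d * T b c d := by
  have := congrArg (map ![a, b, c, d]) C_conj_T_aux
  rwa [map_mul', map_mul', map_mul', map_T h, map_T h, map_C h] at this

theorem T_conj_T {N : ℕ} {a b c d : Fin N} (h : Function.Injective ![a, b, c, d]) :
    T a b c * T b c d * T a b c = T a b d * T b c d := by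
  have := congrArg (map ![a, b, c, d]) T_conj_T_aux
  rwa [map_mul', map_mul', map_mul', map_T h, map_T h, map_T h] at this

theorem T_conj_C {N : ℕ} {a b c d : Fin N} (h : Function.Injective ![a, b, c, d]) :
    T a b c * C c d * T a b c = T a b d * C c d := by
  have := congrArg (map ![a, b, c, d]) T_conj_C_aux
  rwa [map_mul', map_mul', map_mul', map_T h, map_T h, map_C h] at this

/-- Gates on disjoint sets of wires commute. -/
theorem map_commute_map {n m N : ℕ} {φ : Fin (n + m) → Fin N} (hφ : Function.Injective φ) (X : H n n) (Y : H m m) :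
    Commute (map (φ ∘ Fin.castAdd m) X) (map (φ ∘ Fin.natAdd n) Y) := by
  · have h : (X ⊙ one m) * (one n ⊙ Y) = (one n ⊙ Y) * (X ⊙ one m) := by
      simp only [mul_def, ← tens_comp, Category.comp_id, Category.id_comp]
    rw [tens_one_eq_map, one_tens_eq_map] at h
    have := congrArg (map φ) h
    rwa [map_mul', map_mul', map_map hφ, map_map hφ] at this

theorem injective_five {N : ℕ} {a b c d e : Fin N} (hab : a ≠ b) (hac : a ≠ c) (had : a ≠ d)
    (hae : a ≠ e) (h : Function.Injective ![b, c, d, e]) :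
    Function.Injective ![a, b, c, d, e] :=
  injective_cons h fun i => by fin_cases i <;> assumption

theorem injective_six {N : ℕ} {a b c d e f : Fin N} (hab : a ≠ b) (hac : a ≠ c) (had : a ≠ d)
    (hae : a ≠ e) (haf : a ≠ f) (h : Function.Injective ![b, c, d, e, f]) :
    Function.Injective ![a, b, c, d, e, f] :=
  injective_cons h fun i => by fin_cases i <;> assumption

/-- With one control shared, each further coincidence is covered by one imposed identity:
`tof_comm_controls` if both controls are shared, `tof_comm_both` if the target is,
`tof_comm_control` if nothing else is. If everything is shared the gates are equal. -/
theorem T_commute_of_eq {N : ℕ} {a b c e f : Fin N} (hab : a ≠ b) (hac : a ≠ c) (hbc : b ≠ c)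
    (hae : a ≠ e) (haf : a ≠ f) (hef : e ≠ f) (h₂ : c ≠ e) (h₄ : f ≠ b) :
    Commute (T a b c) (T a e f) := by
  by_cases hbe : b = e
  · subst hbe
    by_cases hcf : c = f
    · subst hcf
      exact Commute.refl _
    · have hi : Function.Injective ![c, b, a, f] :=
        injective_four hbc.symm hac.symm hcf hab.symm hef haf
      have h := congrArg (map ![c, b, a, f]) T_comm_controls_aux
      rw [map_mul', map_mul', map_T hi, map_T hi] at h
      rw [T_symm a b f]
      exact h
  · by_cases hcf : c = f
    · subst hcf
      have hi : Function.Injective ![b, e, a, c] :=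
        injective_four hbe hab.symm hbc hae.symm hef hac
      have h := congrArg (map ![b, e, a, c]) T_comm_both_aux
      rw [map_mul', map_mul', map_T hi, map_T hi] at h
      rw [T_symm a b, T_symm a e]
      exact h
    · have hi : Function.Injective ![c, b, a, e, f] :=
        injective_five hbc.symm hac.symm h₂ hcf (injective_four hab.symm hbe h₄.symm hae haf hef)
      have h := congrArg (map ![c, b, a, e, f]) T_comm_control_aux
      rw [map_mul', map_mul', map_T hi, map_T hi] at h
      exact h

/-- Degenerate gates are `1`. For proper gates the overlap is a shared control, a shared target, or
nothing, and the last case is interchange in the monoidal category. -/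
theorem T_commute {N : ℕ} {a b c d e f : Fin N} (h₁ : c ≠ d) (h₂ : c ≠ e) (h₃ : f ≠ a)
    (h₄ : f ≠ b) : Commute (T a b c) (T d e f) := by
  rcases eq_or_ne a b with rfl | hab
  · rw [T_self_left]; exact Commute.one_left _
  rcases eq_or_ne b c with rfl | hbc
  · rw [T_self_right]; exact Commute.one_left _
  rcases eq_or_ne a c with rfl | hac
  · rw [T_self_outer]; exact Commute.one_left _
  rcases eq_or_ne d e with rfl | hde
  · rw [T_self_left]; exact Commute.one_right _
  rcases eq_or_ne e f with rfl | hef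
  · rw [T_self_right]; exact Commute.one_right _
  rcases eq_or_ne d f with rfl | hdf
  · rw [T_self_outer]; exact Commute.one_right _
  rcases eq_or_ne a d with rfl | had
  · exact T_commute_of_eq hab hac hbc hde h₃.symm hef h₂ h₄
  rcases eq_or_ne a e with rfl | hae
  · rw [T_symm d]
    exact T_commute_of_eq hab hac hbc hde.symm hef hdf h₁ h₄
  rcases eq_or_ne b d with rfl | hbd
  · rw [T_symm a]
    exact T_commute_of_eq hab.symm hbc hac hde hdf hef h₂ h₃
  rcases eq_or_ne b e with rfl | hbe
  · rw [T_symm a, T_symm d]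
    exact T_commute_of_eq hab.symm hbc hac hde.symm hef hdf h₁ h₃
  rcases eq_or_ne c f with rfl | hcf
  · have hi : Function.Injective ![a, b, c, e, d] :=
      injective_five hab hac hae had (injective_four hbc hbe hbd h₂ h₁ hde.symm)
    have h := congrArg (map ![a, b, c, e, d]) T_comm_target_aux
    rw [map_mul', map_mul', map_T hi, map_T hi] at h
    exact h
  · have hi : Function.Injective ![a, b, c, d, e, f] :=
      injective_six hab hac had hae h₃.symm (injective_five hbc hbd hbe h₄.symm
        (injective_four h₁ h₂ hcf hde hdf hef))
    have h := map_commute_map (n := 3) (m := 3) hi (T 0 1 2) (T 0 1 2)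
    rw [map_T (hi.comp (Fin.castAdd_injective 3 3)), map_T (hi.comp (Fin.natAdd_injective 3 3))]
      at h
    exact h

/-! #### Ancillas -/

/-- Start a new last wire with the given bit. -/
def addBit (b : Bool) (n : ℕ) : H n (n + 1) := addWire (ketB b) n

/-- End the last wire with the given bit. -/
def removeBit (b : Bool) (n : ℕ) : H (n + 1) n := removeWire (braB b) n

theorem addBit_true_comp_removeBit (n : ℕ) : addBit true n ≫ removeBit true n = 1 :=
  addWire_comp_removeWire (sound (.ax .ketOne_braOne)) n

theorem addBit_comp_lift (b : Bool) {n m : ℕ} (f : H n m) :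
    addBit b n ≫ lift f = f ≫ addBit b m := addWire_comp_lift _ f

theorem lift_comp_removeBit (b : Bool) {n m : ℕ} (f : H n m) :
    lift f ≫ removeBit b m = removeBit b n ≫ f := lift_comp_removeWire _ f

theorem addBit_comp_swapLast (b : Bool) (n : ℕ) :
    addBit b (n + 1) ≫ swapLast n = lift (addBit b n) := addWire_comp_swapLast _ n

theorem swapLast_comp_removeBit (b : Bool) (n : ℕ) :
    swapLast n ≫ removeBit b (n + 1) = lift (removeBit b n) := swapLast_comp_removeWire _ n

theorem addWire_zero (k : H 0 1) : addWire k 0 = k := by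
  have := one_zero_tens k
  simp only [wire_rfl] at this
  exact ((Category.comp_id _).symm.trans this).trans (Category.id_comp _)

theorem removeWire_zero (k : H 1 0) : removeWire k 0 = k := by
  have := one_zero_tens k
  simp only [wire_rfl] at this
  exact ((Category.comp_id _).symm.trans this).trans (Category.id_comp _)

theorem tens_one_one_eq (k : H 0 1) : k ⊙ one 1 = addWire k 1 ≫ perm (Equiv.swap 0 1) := by
  have h := addWire_comp_swapLast k 0
  rw [addWire_zero, swapLast_eq_perm] at h
  exact h.symm

theorem tens_one_one_eq' (b : H 1 0) :
    b ⊙ one 1 = (perm (Equiv.swap 0 1) : H 2 2) ≫ removeWire b 1 := by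
  have h := swapLast_comp_removeWire b 0
  rw [removeWire_zero, swapLast_eq_perm] at h
  exact h.symm

theorem swapLast_lift_swapLast :
    swapLast 1 ≫ lift (swapLast 0) = (perm (Equiv.swap 1 2 * Equiv.swap 0 1) : H 3 3) := by
  rw [map_mul, swapLast_eq_perm, swapLast_eq_perm, lift_perm]
  congr 2
  ext x
  revert x
  decide

theorem tens_one_two_eq (k : H 0 1) :
    k ⊙ one 2 = addWire k 2 ≫ perm (Equiv.swap 1 2 * Equiv.swap 0 1) := by
  refine (lift_lift k).symm.trans ?_
  have h : lift k = addWire k 1 ≫ swapLast 0 := by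
    rw [addWire_comp_swapLast, addWire_zero]
  rw [h, lift_comp, ← addWire_comp_swapLast, Category.assoc, swapLast_lift_swapLast]

theorem lift_swapLast_swapLast :
    lift (swapLast 0) ≫ swapLast 1 = (perm (Equiv.swap 1 2 * Equiv.swap 0 1)⁻¹ : H 3 3) := by
  have h : (perm (Equiv.swap 0 1 * Equiv.swap 1 2) : H 3 3) = lift (swapLast 0) ≫ swapLast 1 := by
    rw [map_mul, swapLast_eq_perm, swapLast_eq_perm, lift_perm]
    congr 2
    ext x
    revert x
    decide
  rw [← h, mul_inv_rev, Equiv.swap_inv, Equiv.swap_inv]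

theorem tens_one_two_eq' (b : H 1 0) :
    b ⊙ one 2 = (perm (Equiv.swap 1 2 * Equiv.swap 0 1)⁻¹ : H 3 3) ≫ removeWire b 2 := by
  refine (lift_lift b).symm.trans ?_
  have h : lift b = swapLast 0 ≫ removeWire b 1 := by
    rw [swapLast_comp_removeWire, removeWire_zero]
  rw [h, lift_comp, ← swapLast_comp_removeWire, ← Category.assoc, lift_swapLast_swapLast]

theorem ket_tens (k : H 0 1) (Y : H 2 2) : k ⊙ Y = Y ≫ (k ⊙ one 2) := by
  have h := tens_comp (one 0) k Y (one 2)
  rw [Category.id_comp, Category.comp_id] at h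
  rw [h]
  congr 1
  have := one_zero_tens Y
  simp only [wire_rfl] at this
  exact ((Category.comp_id _).symm.trans this).trans (Category.id_comp _)

theorem bra_tens (k : H 1 0) (Y : H 2 2) : k ⊙ Y = (k ⊙ one 2) ≫ Y := by
  have h := tens_comp k (one 0) (one 2) Y
  rw [Category.id_comp, Category.comp_id] at h
  rw [h]
  congr 1
  have := one_zero_tens Y
  simp only [wire_rfl] at this
  exact (((Category.comp_id _).symm.trans this).trans (Category.id_comp _))

/-- The imposed identities feed the first wire, whereas ancillas are kept last here. Conjugation by
a three-cycle moves the fed control to the end and turns `T 0 1 2` into `T 2 0 1`. -/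
theorem addWire_T_aux (k : H 0 1) (Y : H 2 2)
    (h : (k ⊙ one 2) ≫ ofCircuit .tof = k ⊙ Y) : addWire k 2 ≫ T 2 0 1 = Y ≫ addWire k 2 := by
  rw [ket_tens k Y, tens_one_two_eq, ofCircuit_tof] at h
  have h' := congrArg (· ≫ (perm (Equiv.swap 1 2 * Equiv.swap 0 1)⁻¹ : H 3 3)) h
  simp only [Category.assoc] at h'
  have e1 := perm_conj (Equiv.swap 1 2 * Equiv.swap 0 1 : Equiv.Perm (Fin 3)) (T 0 1 2)
  rw [map_T (Equiv.injective _), mul_assoc] at e1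
  have e2 := perm_mul_perm_inv (Equiv.swap 1 2 * Equiv.swap 0 1 : Equiv.Perm (Fin 3))
  simp only [mul_def] at e1 e2
  rw [e1, e2] at h'
  exact h'.trans (congrArg _ (Category.comp_id _))

theorem T_aux_removeWire (k : H 1 0) (Y : H 2 2)
    (h : ofCircuit .tof ≫ (k ⊙ one 2) = k ⊙ Y) : T 2 0 1 ≫ removeWire k 2 = removeWire k 2 ≫ Y := by
  rw [bra_tens k Y, tens_one_two_eq', ofCircuit_tof] at h
  have h' := congrArg (perm (Equiv.swap 1 2 * Equiv.swap 0 1 : Equiv.Perm (Fin 3)) ≫ ·) h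
  simp only [← Category.assoc] at h'
  have e1 := perm_conj (Equiv.swap 1 2 * Equiv.swap 0 1 : Equiv.Perm (Fin 3)) (T 0 1 2)
  rw [map_T (Equiv.injective _)] at e1
  have e2 := perm_mul_perm_inv (Equiv.swap 1 2 * Equiv.swap 0 1 : Equiv.Perm (Fin 3))
  simp only [mul_def] at e1 e2
  rw [e1, e2] at h'
  exact h'.trans (congrArg (· ≫ Y) (Category.id_comp _))

theorem addBit_true_T_aux : addBit true 2 ≫ T 2 0 1 = C 0 1 ≫ addBit true 2 := by
  refine addWire_T_aux _ _ ?_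
  rw [← ofCircuit_cnot]
  exact sound (.ax .ketOne_tof)

theorem addBit_false_T_aux : addBit false 2 ≫ T 2 0 1 = addBit false 2 :=
  (addWire_T_aux (ketB false) (one 2) (sound (.ax .ketZero_tof))).trans (Category.id_comp _)

theorem T_removeBit_true_aux : T 2 0 1 ≫ removeBit true 2 = removeBit true 2 ≫ C 0 1 := by
  refine T_aux_removeWire _ _ ?_
  rw [← ofCircuit_cnot]
  exact sound (.ax .tof_braOne)

theorem eq_of_comp_addBit_true {n m : ℕ} {f g : H n m}
    (h : f ≫ addBit true m = g ≫ addBit true m) : f = g := by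
  have h' := congrArg (· ≫ removeBit true m) h
  simp only [Category.assoc, addBit_true_comp_removeBit] at h'
  exact ((Category.comp_id f).symm.trans h').trans (Category.comp_id g)

theorem X_zero_eq : (X 0 : H 1 1) = addBit true 1 ≫ C 1 0 ≫ removeBit true 1 := by
  have h : ofCircuit Circuit.not = ((ketB true ⊙ one 1) ≫ ofCircuit Circuit.cnot) ≫
    (braB true ⊙ one 1) := rfl
  rw [← ofCircuit_not, h, tens_one_one_eq, tens_one_one_eq', ofCircuit_cnot]
  have h2 : (perm (Equiv.swap 0 1) ≫ C 0 1 ≫ perm (Equiv.swap 0 1) : H 2 2) = C 1 0 := by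
    rw [perm_involutive_conj (Equiv.swap_inv 0 1), map_C (Equiv.injective _)]
    rfl
  rw [← h2]
  simp only [Category.assoc]
  rfl

/-- The not gate is defined with its control already ended, so it must be shown that the control
comes out as `|1⟩`. Feeding `|1⟩` to both controls of a Toffoli gate and using the symmetry of its
controls, the used control and a fresh `|1⟩` can be exchanged. Ending the used one then leaves a
fresh `|1⟩` beside the not gate. -/
theorem addBit_true_C_aux : addBit true 1 ≫ C 1 0 = X 0 ≫ addBit true 1 := by
  have hc : (swapLast 1 * T 2 1 0) = (T 1 2 0 * swapLast 1 : H 3 3) := by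
    have e := perm_conj (Equiv.swap 1 2 : Equiv.Perm (Fin 3)) (T 2 1 0)
    rw [map_T (Equiv.injective _), Equiv.swap_inv] at e
    have e2 : swapLast 1 = (perm (Equiv.swap 1 2) : H 3 3) := swapLast_eq_perm 1
    have e3 : (T 1 2 0 : H 3 3) = swapLast 1 * T 2 1 0 * swapLast 1 := by rw [e2]; exact e.symm
    rw [e3, mul_assoc, mul_assoc, swapLast_swapLast, mul_one]
  have hT : addBit true 2 ≫ T 2 1 0 = C 1 0 ≫ addBit true 2 := by
    have h := addWire_comp_map _ (Equiv.swap (0 : Fin 2) 1).injective addBit_true_T_aux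
    rw [map_T (extend_injective (Equiv.injective _)), map_C (Equiv.injective _)] at h
    exact h
  have key : (addBit true 1 ≫ C 1 0) ≫ addBit true 2 =
      (addBit true 1 ≫ C 1 0) ≫ lift (addBit true 1) := by
    rw [← addBit_comp_swapLast, Category.assoc, ← hT, Category.assoc, ← Category.assoc (C 1 0), ← hT,
      Category.assoc]
    have e : T 2 1 0 ≫ swapLast 1 = swapLast 1 * (T 1 2 0 : H 3 3) := by
      have := congrArg (fun x => swapLast 1 * x * swapLast 1) hc
      simp only [mul_assoc, swapLast_swapLast, mul_one] at this
      rw [← mul_assoc, swapLast_swapLast, one_mul] at this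
      exact this
    rw [e, mul_def, ← Category.assoc (addBit true 2) (swapLast 1), addBit_comp_swapLast,
      ← Category.assoc, ← addBit_comp_lift, Category.assoc, T_symm 2 1 0]
  have h' := congrArg (· ≫ lift (removeBit true 1)) key
  simp only [Category.assoc] at h'
  rw [addBit_comp_lift, ← lift_comp, addBit_true_comp_removeBit, lift_one] at h'
  rw [X_zero_eq, Category.assoc, Category.assoc]
  exact (h'.trans (congrArg _ (Category.comp_id _))).symm

/-! ### Ancilla rules for gates on arbitrary wires -/

theorem addBit_true_T {N : ℕ} (i j : Fin N) :
    addBit true N ≫ T (Fin.last N) i.castSucc j.castSucc = C i j ≫ addBit true N := by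
  rcases eq_or_ne i j with rfl | h
  · rw [C_self, T_self_right, one_comp, comp_one]
  · have h' := addWire_comp_map _ (injective_pair h) addBit_true_T_aux
    rwa [map_T (extend_injective (injective_pair h)), map_C (injective_pair h)] at h'

theorem addBit_false_T {N : ℕ} (i j : Fin N) :
    addBit false N ≫ T (Fin.last N) i.castSucc j.castSucc = addBit false N := by
  rcases eq_or_ne i j with rfl | h
  · rw [T_self_right, comp_one]
  · have h' := addWire_comp_map (Y := 1) _ (injective_pair h)
      (addBit_false_T_aux.trans (one_comp _).symm)
    rwa [map_T (extend_injective (injective_pair h)), map_one', one_comp] at h'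

theorem T_removeBit_true {N : ℕ} (i j : Fin N) :
    T (Fin.last N) i.castSucc j.castSucc ≫ removeBit true N = removeBit true N ≫ C i j := by
  rcases eq_or_ne i j with rfl | h
  · rw [C_self, T_self_right, one_comp, comp_one]
  · have h' := map_comp_removeWire _ (injective_pair h) T_removeBit_true_aux
    rwa [map_T (extend_injective (injective_pair h)), map_C (injective_pair h)] at h'

theorem injective_single {N : ℕ} (i : Fin N) : Function.Injective ![i] :=
  Function.injective_of_subsingleton _

theorem addBit_true_C {N : ℕ} (i : Fin N) :
    addBit true N ≫ C (Fin.last N) i.castSucc = X i ≫ addBit true N := by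
  have h' := addWire_comp_map _ (injective_single i) addBit_true_C_aux
  rwa [map_C (extend_injective (injective_single i)), map_X (injective_single i)] at h'

/-- Starting a wire at `|1⟩` is a split monomorphism and turns a Toffoli gate into a controlled not,
so laws descend from `T` to `C`. The same device leads from `C` to `X`. -/
theorem C_mul_self {N : ℕ} (i j : Fin N) : C i j * C i j = 1 := by
  refine eq_of_comp_addBit_true ?_
  rw [mul_comp, ← addBit_true_T, ← Category.assoc, ← addBit_true_T, Category.assoc, ← mul_def,
    T_mul_self, one_comp, comp_one]

theorem X_mul_self {N : ℕ} (i : Fin N) : X i * X i = 1 := by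
  refine eq_of_comp_addBit_true ?_
  rw [mul_comp, ← addBit_true_C, ← Category.assoc, ← addBit_true_C, Category.assoc, ← mul_def,
    C_mul_self, one_comp, comp_one]

theorem ketB_comp_X (b : Bool) : ketB b ≫ X 0 = ketB (!b) := by
  have h : ketB false = ketB true ≫ X 0 := by rw [← ofCircuit_not]; rfl
  cases b
  · rw [h, Category.assoc, ← mul_def, X_mul_self, comp_one]
    rfl
  · exact h.symm

theorem X_comp_braB (b : Bool) : X 0 ≫ braB b = braB (!b) := by
  have h : braB false = X 0 ≫ braB true := by rw [← ofCircuit_not]; rfl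
  cases b
  · rw [h, ← Category.assoc, ← mul_def, X_mul_self, one_comp]
    rfl
  · exact h.symm

theorem X_last (N : ℕ) : X (Fin.last N) = one N ⊙ X 0 := by
  rw [one_tens_eq_map, map_X (Fin.natAdd_injective _ _)]
  rfl

theorem addBit_X (b : Bool) (N : ℕ) : addBit b N ≫ X (Fin.last N) = addBit (!b) N := by
  rw [X_last, addBit, addWire, ← tens_comp, Category.comp_id, ketB_comp_X]
  rfl

theorem X_removeBit (b : Bool) (N : ℕ) : X (Fin.last N) ≫ removeBit b N = removeBit (!b) N := by
  rw [X_last, removeBit, removeWire, ← tens_comp, Category.id_comp, X_comp_braB]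
  rfl

theorem addBit_comp_removeBit (b : Bool) (N : ℕ) : addBit b N ≫ removeBit b N = 1 := by
  cases b
  · rw [show removeBit false N = _ from (X_removeBit true N).symm,
      show addBit false N = _ from (addBit_X true N).symm, Category.assoc, ← Category.assoc (X _), ← mul_def,
      X_mul_self, one_comp, addBit_true_comp_removeBit]
  · exact addBit_true_comp_removeBit N

theorem eq_of_comp_addBit {n m : ℕ} (b : Bool) {f g : H n m}
    (h : f ≫ addBit b m = g ≫ addBit b m) : f = g := by
  have h' := congrArg (· ≫ removeBit b m) h
  simp only [Category.assoc, addBit_comp_removeBit] at h'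
  exact ((Category.comp_id f).symm.trans h').trans (Category.comp_id g)

/-! ### Oracles -/

/-! #### Equality on a last wire which starts at zero -/

/-- Two maps agree when the last wire starts at `|0⟩`. -/
def ZEq {N m : ℕ} (V W : H (N + 1) m) : Prop := addBit false N ≫ V = addBit false N ≫ W

theorem ZEq.refl {N m : ℕ} (V : H (N + 1) m) : ZEq V V := rfl

theorem ZEq.symm {N m : ℕ} {V W : H (N + 1) m} (h : ZEq V W) : ZEq W V := Eq.symm h

theorem ZEq.trans {N m : ℕ} {V W X : H (N + 1) m} (h : ZEq V W) (h' : ZEq W X) : ZEq V X :=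
  Eq.trans h h'

theorem ZEq.mul {N : ℕ} {V W : H (N + 1) (N + 1)} (h : ZEq V W) (X : H (N + 1) (N + 1)) :
    ZEq (V * X) (W * X) := by
  simp only [ZEq, comp_mul] at h ⊢
  rw [h]

theorem ZEq.lift_mul {N : ℕ} {V W : H (N + 1) (N + 1)} (X : H N N) (h : ZEq V W) :
    ZEq (lift X * V) (lift X * W) := by
  simp only [ZEq, comp_mul, addBit_comp_lift] at h ⊢
  rw [Category.assoc, Category.assoc, h]

/-- Comparison with a lifted map says that the ancilla is returned in state zero, so a second map
with the same property may reuse it. -/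
theorem ZEq.mul_mul {N : ℕ} {V V' : H (N + 1) (N + 1)} {W W' : H N N} (h : ZEq V (lift W))
    (h' : ZEq V' (lift W')) : ZEq (V * V') (lift (W * W')) := by
  rw [TOF.lift_mul]
  exact (h.mul V').trans (h'.lift_mul W)

theorem eq_of_zEq_lift {N : ℕ} {X Y : H N N} (h : ZEq (lift X) (lift Y)) : X = Y := by
  simp only [ZEq, addBit_comp_lift] at h
  exact eq_of_comp_addBit false h

/-- Start and end the last wire at zero. -/
def anc0 {N : ℕ} (V : H (N + 1) (N + 1)) : H N N := addBit false N ≫ V ≫ removeBit false N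

theorem ZEq.anc0_eq {N : ℕ} {V W : H (N + 1) (N + 1)} (h : ZEq V W) : anc0 V = anc0 W := by
  simp only [ZEq, anc0, ← Category.assoc] at h ⊢
  rw [h]

theorem anc0_lift_mul {N : ℕ} (X : H N N) (V : H (N + 1) (N + 1)) :
    anc0 (lift X * V) = X * anc0 V := anc_lift_mul _ _ X V

theorem anc0_mul_lift {N : ℕ} (X : H N N) (V : H (N + 1) (N + 1)) :
    anc0 (V * lift X) = anc0 V * X := anc_mul_lift _ _ X V

theorem anc0_one {N : ℕ} : anc0 (1 : H (N + 1) (N + 1)) = 1 := by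
  rw [anc0, one_comp, addBit_comp_removeBit]

theorem anc0_lift {N : ℕ} (X : H N N) : anc0 (lift X) = X := by
  rw [← mul_one (lift X), anc0_lift_mul, anc0_one, mul_one]

theorem ZEq.eq_anc0 {N : ℕ} {V : H (N + 1) (N + 1)} {W : H N N} (h : ZEq V (lift W)) :
    W = anc0 V := by
  rw [h.anc0_eq, anc0_lift]

theorem map_anc0 {N M : ℕ} {φ : Fin N → Fin M} (hφ : Function.Injective φ)
    (V : H (N + 1) (N + 1)) : map φ (anc0 V) = anc0 (map (extend φ) V) := map_anc _ _ hφ V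

theorem commute_anc0 {N : ℕ} {X : H N N} {V : H (N + 1) (N + 1)} (h : Commute (lift X) V) :
    Commute X (anc0 V) := by
  rw [commute_iff_eq, ← anc0_lift_mul, h.eq, anc0_mul_lift]

theorem zEq_T {N : ℕ} (i j : Fin N) : ZEq (T (Fin.last N) i.castSucc j.castSucc) 1 := by
  rw [ZEq, addBit_false_T, comp_one]

theorem zEq_T' {N : ℕ} (i j : Fin N) : ZEq (T i.castSucc (Fin.last N) j.castSucc) 1 := by
  rw [T_symm]; exact zEq_T i j

/-! #### Commutation and cancellation of the smaller gates -/

theorem lift_injective {n m : ℕ} {f g : H n m} (h : lift f = lift g) : f = g := by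
  refine eq_of_comp_addBit false ?_
  rw [← addBit_comp_lift, h, addBit_comp_lift]

theorem commute_lift {N : ℕ} {X Y : H N N} (h : Commute X Y) : Commute (lift X) (lift Y) := by
  rw [commute_iff_eq, ← lift_mul, h.eq, lift_mul]

/-- Transport a commutation through a last wire in state `|1⟩`. -/
theorem commute_of_addBit_true {N : ℕ} {X Y : H N N} {V : H (N + 1) (N + 1)}
    (hV : addBit true N ≫ V = X ≫ addBit true N) (h : Commute V (TOF.lift Y)) : Commute X Y := by
  refine eq_of_comp_addBit true ?_
  rw [mul_comp, mul_comp, ← addBit_comp_lift, ← Category.assoc, ← hV, Category.assoc, ← mul_def,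
    h.eq, mul_def, ← Category.assoc, addBit_comp_lift, Category.assoc, hV]

theorem C_commute_T {N : ℕ} {i j a b c : Fin N} (h₁ : j ≠ a) (h₂ : j ≠ b) (h₃ : c ≠ i) :
    Commute (C i j) (T a b c) := by
  refine commute_of_addBit_true (addBit_true_T i j) ?_
  rw [lift_T]
  exact T_commute (by simpa using h₁) (by simpa using h₂) (Fin.castSucc_lt_last c).ne
    (by simpa using h₃)

theorem C_commute_C {N : ℕ} {i j a c : Fin N} (h₁ : j ≠ a) (h₃ : c ≠ i) :
    Commute (C i j) (C a c) := by
  refine Commute.symm (commute_of_addBit_true (addBit_true_T a c) ?_)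
  rw [lift_C]
  exact (C_commute_T (Fin.castSucc_lt_last j).ne (by simpa using h₁) (by simpa using h₃)).symm

theorem X_commute_T {N : ℕ} {j a b c : Fin N} (h₁ : j ≠ a) (h₂ : j ≠ b) :
    Commute (X j) (T a b c) := by
  refine commute_of_addBit_true (addBit_true_C j) ?_
  rw [lift_T]
  exact C_commute_T (by simpa using h₁) (by simpa using h₂) (Fin.castSucc_lt_last c).ne

theorem X_commute_C {N : ℕ} {j a c : Fin N} (h₁ : j ≠ a) : Commute (X j) (C a c) := by
  refine commute_of_addBit_true (addBit_true_C j) ?_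
  rw [lift_C]
  exact C_commute_C (by simpa using h₁) (Fin.castSucc_lt_last c).ne

theorem X_commute_X {N : ℕ} (j c : Fin N) : Commute (X j) (X c) := by
  refine commute_of_addBit_true (addBit_true_C j) ?_
  rw [lift_X]
  exact (X_commute_C (Fin.castSucc_lt_last c).ne).symm

/-- Transport an equation through a last wire in state `|1⟩`. -/
theorem eq_of_addBit_true {N : ℕ} {X Y : H N N} {V : H (N + 1) (N + 1)}
    (hX : addBit true N ≫ V = X ≫ addBit true N) (hY : addBit true N ≫ V = Y ≫ addBit true N) :
    X = Y := eq_of_comp_addBit true (hX.symm.trans hY)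

theorem addBit_mul {b : Bool} {N : ℕ} {X Y : H N N} {V W : H (N + 1) (N + 1)}
    (hX : addBit b N ≫ V = X ≫ addBit b N) (hY : addBit b N ≫ W = Y ≫ addBit b N) :
    addBit b N ≫ (V * W) = (X * Y) ≫ addBit b N := by
  rw [comp_mul, hX, Category.assoc, hY, mul_comp]

theorem C_conj_C {N : ℕ} {a b d : Fin N} (hab : a ≠ b) (had : a ≠ d) (hbd : b ≠ d) :
    C a b * C b d * C a b = C a d * C b d := by
  have hl : ∀ b d : Fin N, addBit true N ≫ T b.castSucc (Fin.last N) d.castSucc =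
      C b d ≫ addBit true N := fun b d => by rw [T_symm, addBit_true_T]
  have hi : Function.Injective ![a.castSucc, b.castSucc, Fin.last N, d.castSucc] :=
    injective_four (by simpa using hab) (Fin.castSucc_lt_last a).ne (by simpa using had)
      (Fin.castSucc_lt_last b).ne (by simpa using hbd) (Fin.castSucc_lt_last d).ne'
  have h := C_conj_T hi
  refine eq_of_addBit_true (V := C a.castSucc b.castSucc * T b.castSucc (Fin.last N) d.castSucc *
    C a.castSucc b.castSucc) ?_ ?_
  · rw [← lift_C]
    exact addBit_mul (addBit_mul (addBit_comp_lift true _) (hl b d)) (addBit_comp_lift true _)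
  · rw [h]
    exact addBit_mul (hl a d) (hl b d)

theorem X_conj_C {N : ℕ} {b d : Fin N} (hbd : b ≠ d) : X b * C b d * X b = X d * C b d := by
  have h := C_conj_C (Fin.castSucc_lt_last b).ne' (Fin.castSucc_lt_last d).ne'
    ((Fin.castSucc_injective N).ne hbd)
  refine eq_of_addBit_true (V := C (Fin.last N) b.castSucc * C b.castSucc d.castSucc *
    C (Fin.last N) b.castSucc) ?_ ?_
  · rw [← lift_C]
    exact addBit_mul (addBit_mul (addBit_true_C b) (addBit_comp_lift true _)) (addBit_true_C b)
  · rw [h, ← lift_C]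
    exact addBit_mul (addBit_true_C d) (addBit_comp_lift true _)

/-! #### Conjugation -/

theorem conj_mul {M : Type*} [Monoid M] {A : M} (h : A * A = 1) (X Y : M) :
    A * (X * Y) * A = (A * X * A) * (A * Y * A) := by
  calc A * (X * Y) * A = A * X * 1 * Y * A := by simp only [mul_assoc, one_mul]
    _ = _ := by rw [← h]; simp only [mul_assoc]

theorem conj_of_commute {M : Type*} [Monoid M] {A X : M} (h : A * A = 1) (hX : Commute A X) :
    A * X * A = X := by
  rw [hX.eq, mul_assoc, h, mul_one]

theorem conj_conj {M : Type*} [Monoid M] {A B : M} (h : Commute A B) (X : M) :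
    A * (B * X * B) * A = (A * B) * X * (A * B) := by
  rw [h.eq]
  nth_rewrite 1 [← h.eq]
  simp only [mul_assoc]

theorem mul_eq_of_conj_eq {M : Type*} [Monoid M] {A X Y : M} (h : A * A = 1)
    (hX : A * X * A = Y) : A * X = Y * A := by
  rw [← hX, mul_assoc _ A A, h, mul_one]

/-! #### Oracles for Boolean functions -/

/-- The part of a Boolean function where the last argument is zero. -/
def low {n : ℕ} (h : (Fin (n + 1) → Bool) → Bool) (x : Fin n → Bool) : Bool :=
  h (Fin.snoc (α := fun _ => Bool) x false)

/-- The difference of the values of a Boolean function at the two values of the last argument. -/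
def diff {n : ℕ} (h : (Fin (n + 1) → Bool) → Bool) (x : Fin n → Bool) : Bool :=
  xor (h (Fin.snoc (α := fun _ => Bool) x false)) (h (Fin.snoc (α := fun _ => Bool) x true))

/-- The oracle which adds `h` of the wires `w` to the wire `s`. -/
noncomputable def U : {n N : ℕ} → (Fin n → Fin N) → Fin N → ((Fin n → Bool) → Bool) → H N N
  | 0, _, _, s, h => if h ![] = true then X s else 1
  -- Over the field with two elements `h = low h + xₙ · diff h`. The ancilla receives `diff h`, a
  -- Toffoli gate adds its product with the last input, and the repeated oracle clears the ancilla.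
  | n + 1, N, w, s, h => U (n := n) (Fin.init w) s (low h) *
      anc0 (U (n := n) (Fin.castSucc ∘ Fin.init w) (Fin.last N) (diff h) *
        T (w (Fin.last n)).castSucc (Fin.last N) s.castSucc *
        U (n := n) (Fin.castSucc ∘ Fin.init w) (Fin.last N) (diff h))

/-- The oracle which adds `h` of the wires `w` to the wire `s`, controlled by the wire `y`. -/
noncomputable def CU {n N : ℕ} (w : Fin n → Fin N) (y s : Fin N) (h : (Fin n → Bool) → Bool) :
    H N N :=
  anc0 (U (Fin.castSucc ∘ w) (Fin.last N) h * T y.castSucc (Fin.last N) s.castSucc *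
    U (Fin.castSucc ∘ w) (Fin.last N) h)

theorem U_zero {N : ℕ} (w : Fin 0 → Fin N) (s : Fin N) (h : (Fin 0 → Bool) → Bool) :
    U w s h = if h ![] = true then X s else 1 := by rw [U]

theorem U_succ {n N : ℕ} (w : Fin (n + 1) → Fin N) (s : Fin N)
    (h : (Fin (n + 1) → Bool) → Bool) :
    U w s h = U (Fin.init w) s (low h) * CU (Fin.init w) (w (Fin.last n)) s (diff h) := by
  rw [U, CU]

section map

variable {N M : ℕ} {φ : Fin N → Fin M}

theorem extend_comp_castSucc {n : ℕ} (w : Fin n → Fin N) :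
    extend φ ∘ (Fin.castSucc ∘ w) = Fin.castSucc ∘ (φ ∘ w) := by
  funext i
  simp

/-- `CU` with `n` inputs is built from `U` with `n` inputs and occurs in `U` with `n + 1` inputs.
Its laws are therefore proved first from a hypothesis on `U`, to serve inside the recursion;
`CU_mul_of` and `evalHom_CU_of` follow the same pattern. -/
theorem map_CU_of {n : ℕ} (w : Fin n → Fin N) (y s : Fin N) (h : (Fin n → Bool) → Bool)
    (hφ : Function.Injective φ)
    (H : ∀ {N M : ℕ} {φ : Fin N → Fin M} (_ : Function.Injective φ) (w : Fin n → Fin N) (s : Fin N),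
      map φ (U w s h) = U (φ ∘ w) (φ s) h) :
    map φ (CU w y s h) = CU (φ ∘ w) (φ y) (φ s) h := by
  have hφ' := extend_injective hφ
  rw [CU, map_anc0 hφ, map_mul', map_mul', H hφ', map_T hφ', extend_comp_castSucc, extend_last,
    extend_castSucc, extend_castSucc, CU]

theorem map_U : ∀ {n N M : ℕ} {φ : Fin N → Fin M} (_ : Function.Injective φ) (w : Fin n → Fin N)
    (s : Fin N) (h : (Fin n → Bool) → Bool), map φ (U w s h) = U (φ ∘ w) (φ s) h
  | 0, _, _, _, hφ, w, s, h => by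
    rw [U_zero, U_zero]
    split
    · exact map_X hφ s
    · exact map_one' _
  | n + 1, N, M, φ, hφ, w, s, h => by
    rw [U_succ, U_succ, map_mul', map_U hφ, map_CU_of _ _ _ _ hφ fun hφ w s => map_U hφ w s _]
    rfl

theorem map_CU {n : ℕ} (hφ : Function.Injective φ) (w : Fin n → Fin N) (y s : Fin N)
    (h : (Fin n → Bool) → Bool) : map φ (CU w y s h) = CU (φ ∘ w) (φ y) (φ s) h :=
  map_CU_of w y s h hφ fun hφ w s => map_U hφ w s h

end map

theorem lift_U {n N : ℕ} (w : Fin n → Fin N) (s : Fin N) (h : (Fin n → Bool) → Bool) :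
    lift (U w s h) = U (Fin.castSucc ∘ w) s.castSucc h := by
  rw [lift_eq_map, map_U (Fin.castSucc_injective N)]

theorem lift_CU {n N : ℕ} (w : Fin n → Fin N) (y s : Fin N) (h : (Fin n → Bool) → Bool) :
    lift (CU w y s h) = CU (Fin.castSucc ∘ w) y.castSucc s.castSucc h := by
  rw [lift_eq_map, map_CU (Fin.castSucc_injective N)]

/-! #### Commutation of oracles -/

theorem commute_CU_of {n N : ℕ} {w : Fin n → Fin N} {y s : Fin N} {h : (Fin n → Bool) → Bool}
    {Z : H N N} (h₁ : Commute (lift Z) (U (Fin.castSucc ∘ w) (Fin.last N) h))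
    (h₂ : Commute (lift Z) (T y.castSucc (Fin.last N) s.castSucc)) : Commute Z (CU w y s h) :=
  commute_anc0 ((h₁.mul_right h₂).mul_right h₁)

theorem T_commute_U : ∀ {n N : ℕ} {a b c : Fin N} {w : Fin n → Fin N} {s : Fin N}
    (h : (Fin n → Bool) → Bool), (∀ i, w i ≠ c) → s ≠ a → s ≠ b → Commute (T a b c) (U w s h)
  | 0, N, a, b, c, w, s, h, _, ha, hb => by
    rw [U_zero]
    split
    · exact (X_commute_T ha hb).symm
    · exact Commute.one_right _
  | n + 1, N, a, b, c, w, s, h, hw, ha, hb => by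
    rw [U_succ]
    refine (T_commute_U _ (fun i => hw i.castSucc) ha hb).mul_right (commute_CU_of ?_ ?_)
    · rw [lift_T]
      exact T_commute_U _ (fun i h => hw i.castSucc (Fin.castSucc_injective N h))
        (Fin.castSucc_lt_last a).ne' (Fin.castSucc_lt_last b).ne'
    · rw [lift_T]
      exact T_commute (by simpa using (hw (Fin.last n)).symm) (Fin.castSucc_lt_last c).ne
        (by simpa using ha) (by simpa using hb)

section commute

variable {n N : ℕ} {a b c y s : Fin N} {w : Fin n → Fin N}

theorem castSucc_comp_ne (hw : ∀ i, w i ≠ c) : ∀ i, (Fin.castSucc ∘ w) i ≠ c.castSucc :=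
  fun i h => hw i (Fin.castSucc_injective N h)

theorem castSucc_comp_ne_last : ∀ i, (Fin.castSucc ∘ w) i ≠ Fin.last N :=
  fun i => (Fin.castSucc_lt_last (w i)).ne

theorem castSucc_ne_last (a : Fin N) : a.castSucc ≠ Fin.last N := (Fin.castSucc_lt_last a).ne

theorem last_ne_castSucc (a : Fin N) : Fin.last N ≠ a.castSucc := (Fin.castSucc_lt_last a).ne'

theorem castSucc_ne (h : a ≠ b) : a.castSucc ≠ b.castSucc := (Fin.castSucc_injective N).ne h

theorem C_commute_U (h : (Fin n → Bool) → Bool) (hw : ∀ i, w i ≠ c) (ha : s ≠ a) :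
    Commute (C a c) (U w s h) := by
  refine commute_of_addBit_true (addBit_true_T a c) ?_
  rw [lift_U]
  exact T_commute_U h (castSucc_comp_ne hw) (castSucc_ne_last s) (castSucc_ne ha)

theorem X_commute_U (h : (Fin n → Bool) → Bool) (hw : ∀ i, w i ≠ c) : Commute (X c) (U w s h) := by
  refine commute_of_addBit_true (addBit_true_C c) ?_
  rw [lift_U]
  exact C_commute_U h (castSucc_comp_ne hw) (castSucc_ne_last s)

theorem T_commute_CU (h : (Fin n → Bool) → Bool) (hw : ∀ i, w i ≠ c) (hy : y ≠ c) (ha : s ≠ a)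
    (hb : s ≠ b) : Commute (T a b c) (CU w y s h) := by
  refine commute_CU_of ?_ ?_
  · rw [lift_T]
    exact T_commute_U h (castSucc_comp_ne hw) (last_ne_castSucc a) (last_ne_castSucc b)
  · rw [lift_T]
    exact T_commute (castSucc_ne hy.symm) (castSucc_ne_last c) (castSucc_ne ha) (castSucc_ne hb)

theorem C_commute_CU (h : (Fin n → Bool) → Bool) (hw : ∀ i, w i ≠ c) (hy : y ≠ c) (ha : s ≠ a) :
    Commute (C a c) (CU w y s h) := by
  refine commute_of_addBit_true (addBit_true_T a c) ?_
  rw [lift_CU]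
  exact T_commute_CU h (castSucc_comp_ne hw) (castSucc_ne hy) (castSucc_ne_last s) (castSucc_ne ha)

end commute

theorem U_commute_U {n : ℕ} : ∀ {m N : ℕ} {w : Fin n → Fin N} {s : Fin N} {v : Fin m → Fin N}
    {t : Fin N} (h : (Fin n → Bool) → Bool) (k : (Fin m → Bool) → Bool), (∀ i, w i ≠ t) →
    (∀ i, v i ≠ s) → Commute (U w s h) (U v t k)
  | 0, N, w, s, v, t, h, k, hw, _ => by
    rw [U_zero v]
    split
    · exact (X_commute_U h hw).symm
    · exact Commute.one_right _
  | m + 1, N, w, s, v, t, h, k, hw, hv => by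
    rw [U_succ v]
    refine (U_commute_U h _ hw fun i => hv i.castSucc).mul_right (commute_CU_of ?_ ?_)
    · rw [lift_U]
      exact U_commute_U h _ castSucc_comp_ne_last
        fun i => castSucc_ne (hv i.castSucc)
    · rw [lift_U]
      exact (T_commute_U h (castSucc_comp_ne hw) (castSucc_ne (hv (Fin.last m)).symm)
        (castSucc_ne_last s)).symm

theorem U_commute_CU {n m N : ℕ} {w : Fin n → Fin N} {s : Fin N} {v : Fin m → Fin N}
    {y t : Fin N} (h : (Fin n → Bool) → Bool) (k : (Fin m → Bool) → Bool) (hw : ∀ i, w i ≠ t)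
    (hv : ∀ i, v i ≠ s) (hy : y ≠ s) : Commute (U w s h) (CU v y t k) := by
  refine commute_CU_of ?_ ?_
  · rw [lift_U]
    exact U_commute_U h _ castSucc_comp_ne_last (castSucc_comp_ne hv)
  · rw [lift_U]
    exact (T_commute_U h (castSucc_comp_ne hw) (castSucc_ne hy.symm) (castSucc_ne_last s)).symm

theorem CU_commute_CU {n m N : ℕ} {w : Fin n → Fin N} {x s : Fin N} {v : Fin m → Fin N}
    {y t : Fin N} (h : (Fin n → Bool) → Bool) (k : (Fin m → Bool) → Bool) (hw : ∀ i, w i ≠ t)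
    (hx : x ≠ t) (hv : ∀ i, v i ≠ s) (hy : y ≠ s) : Commute (CU w x s h) (CU v y t k) := by
  refine commute_CU_of ?_ ?_
  · rw [lift_CU]
    exact (U_commute_CU k h (castSucc_comp_ne hv) castSucc_comp_ne_last (castSucc_ne_last x)).symm
  · rw [lift_CU]
    exact (T_commute_CU h (castSucc_comp_ne hw) (castSucc_ne hx) (castSucc_ne hy.symm)
      (castSucc_ne_last s)).symm

/-! #### Conjugating a gate by an oracle on its control -/

/-- Oracles with `n` inputs are involutions, and push through the controls of `C`. -/
def Pushes (n : ℕ) : Prop :=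
  ∀ (N : ℕ) (w : Fin n → Fin N) (h : (Fin n → Bool) → Bool),
    (∀ s, (∀ i, w i ≠ s) → U w s h * U w s h = 1) ∧
    ∀ t s, t ≠ s → (∀ i, w i ≠ t) → (∀ i, w i ≠ s) →
      U w t h * C t s * U w t h = C t s * U w s h

/-- With an ancilla `L`, the product `T t y s * T L y s` is the conjugate of `T L y s` by `C t L`.
The oracle on `t` pushes through `C t L`, which moves it to `L`. On a zero ancilla the leftover gate
controlled by `L` is trivial, and what remains on `L` is the defining circuit of `CU`. -/
theorem Pushes.conj_T {n : ℕ} (H : Pushes n) {N : ℕ} {w : Fin n → Fin N} {y t s : Fin N}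
    (h : (Fin n → Bool) → Bool) (hty : t ≠ y) (hts : t ≠ s) (hys : y ≠ s) (ht : ∀ i, w i ≠ t)
    (hs : ∀ i, w i ≠ s) : U w t h * T y t s * U w t h = T y t s * CU w y s h := by
  have hC := C_conj_T (injective_four (castSucc_ne_last t) (castSucc_ne hty) (castSucc_ne hts)
    (last_ne_castSucc y) (last_ne_castSucc s) (castSucc_ne hys))
  have hU2 := (H _ (Fin.castSucc ∘ w) h).1 _ (castSucc_comp_ne ht)
  have hUC := (H _ (Fin.castSucc ∘ w) h).2 _ _ (castSucc_ne_last t) (castSucc_comp_ne ht)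
    castSucc_comp_ne_last
  set u := U (Fin.castSucc ∘ w) t.castSucc h with hu
  set v := U (Fin.castSucc ∘ w) (Fin.last N) h with hv
  set c := C t.castSucc (Fin.last N) with hc
  set a := T (Fin.last N) y.castSucc s.castSucc with ha
  set b := T t.castSucc y.castSucc s.castSucc with hb
  have hba : Commute b a := T_commute (castSucc_ne_last s) (castSucc_ne hys.symm)
    (castSucc_ne hts.symm) (castSucc_ne hys.symm)
  have hau : Commute a u := T_commute_U h (castSucc_comp_ne hs) (castSucc_ne_last t)
    (castSucc_ne hty)
  have hbv : Commute b v := T_commute_U h (castSucc_comp_ne hs) (last_ne_castSucc t)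
    (last_ne_castSucc y)
  have hcv : Commute c v := C_commute_U h castSucc_comp_ne_last (last_ne_castSucc t)
  have key : a * (u * b * u) = v * a * v * b := by
    calc a * (u * b * u) = u * (b * a) * u := by
          rw [hba.eq]; simp only [mul_assoc]; rw [hau.left_comm]
      _ = (u * c * u) * (u * a * u) * (u * c * u) := by
          rw [← hC, conj_mul hU2, conj_mul hU2]
      _ = (v * c) * a * (c * v) := by rw [hUC, conj_of_commute hU2 hau.symm, hcv.eq]
      _ = v * (b * a) * v := by rw [← hC]; simp only [mul_assoc]
      _ = v * a * v * b := by
          rw [hba.eq]; simp only [mul_assoc]; rw [hbv.eq]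
  have hz : ZEq (lift (U w t h * T y t s * U w t h)) (v * a * v * lift (T y t s)) := by
    rw [TOF.lift_mul, TOF.lift_mul, lift_U, lift_T, T_symm y.castSucc t.castSucc, ← hb, ← hu,
      ← key]
    exact ZEq.symm (by simpa only [one_mul] using (zEq_T y s).mul (u * b * u))
  have := hz.anc0_eq
  rw [anc0_lift, anc0_mul_lift, hv, ha, T_symm (Fin.last N)] at this
  rw [this, T_symm y t, ← CU, (T_commute_CU h hs hys hts.symm hys.symm).eq]

/-- The definition of `CU` ends the ancilla with zero without asserting that it is zero there.
Conjugating the Toffoli gate by the oracle on its ancilla control leaves that gate, trivial on a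
zero ancilla, times a map idle on the ancilla. -/
theorem Pushes.clean {n : ℕ} (H : Pushes n) {N : ℕ} {w : Fin n → Fin N} {y s : Fin N}
    (h : (Fin n → Bool) → Bool) (hys : y ≠ s) (hs : ∀ i, w i ≠ s) :
    ZEq (U (Fin.castSucc ∘ w) (Fin.last N) h * T y.castSucc (Fin.last N) s.castSucc *
      U (Fin.castSucc ∘ w) (Fin.last N) h) (lift (CU w y s h)) := by
  rw [H.conj_T h (last_ne_castSucc y) (last_ne_castSucc s) (castSucc_ne hys) castSucc_comp_ne_last
    (castSucc_comp_ne hs), ← lift_CU]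
  simpa only [one_mul] using (zEq_T' y s).mul (lift (CU w y s h))

theorem Pushes.CU_mul_self {n : ℕ} (H : Pushes n) {N : ℕ} {w : Fin n → Fin N} {y s : Fin N}
    (h : (Fin n → Bool) → Bool) (hys : y ≠ s) (hs : ∀ i, w i ≠ s) :
    CU w y s h * CU w y s h = 1 := by
  have hU2 := (H _ (Fin.castSucc ∘ w) h).1 _ castSucc_comp_ne_last
  have hz := H.clean h hys hs
  refine eq_of_zEq_lift ((hz.mul_mul hz).symm.trans ?_)
  rw [← conj_mul hU2, T_mul_self, mul_one, hU2, lift_one]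
  exact ZEq.refl _

/-- Each controlled oracle is replaced by its clean circuit, all with one ancilla. The oracles on
the ancilla commute with `C t s`, so the whole is a conjugate of three gates, to which `T_conj_C`
applies. -/
theorem Pushes.CU_conj_C {n : ℕ} (H : Pushes n) {N : ℕ} {w : Fin n → Fin N} {y t s : Fin N}
    (h : (Fin n → Bool) → Bool) (hyt : y ≠ t) (hys : y ≠ s) (hts : t ≠ s) (ht : ∀ i, w i ≠ t)
    (hs : ∀ i, w i ≠ s) : CU w y t h * C t s * CU w y t h = C t s * CU w y s h := by
  have hU2 := (H _ (Fin.castSucc ∘ w) h).1 _ castSucc_comp_ne_last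
  have hz := H.clean h hyt ht
  have hz' := H.clean h hys hs
  have hl : ZEq (lift (C t s)) (lift (C t s)) := ZEq.refl _
  have hCu := C_commute_U (w := Fin.castSucc ∘ w) h (castSucc_comp_ne hs) (last_ne_castSucc t)
  rw [(C_commute_CU h hs hys hts.symm).eq]
  refine eq_of_zEq_lift (((hz.mul_mul hl).mul_mul hz).symm.trans (ZEq.trans ?_ (hz'.mul_mul hl)))
  have e := T_conj_C (injective_four (castSucc_ne_last y) (castSucc_ne hyt) (castSucc_ne hys)
    (last_ne_castSucc t) (last_ne_castSucc s) (castSucc_ne hts))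
  set u := U (Fin.castSucc ∘ w) (Fin.last N) h
  rw [lift_C]
  have e2 := conj_of_commute hU2 hCu.symm
  nth_rewrite 1 [← e2]
  rw [← conj_mul hU2, ← conj_mul hU2, e, conj_mul hU2, e2]
  exact ZEq.refl _

/-- The two properties are carried through the recursion together, since the laws of `CU` in the
next step need both. They pass to the product `U * CU` because its factors commute. -/
theorem pushes : ∀ n, Pushes n
  | 0 => fun N w h => by
    constructor
    · intro s _
      rw [U_zero]
      split
      · exact X_mul_self s
      · exact one_mul 1
    · intro t s hts _ _
      rw [U_zero, U_zero]
      split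
      · rw [X_conj_C hts, (X_commute_C hts.symm).eq]
      · rw [one_mul]
  | n + 1 => fun N w h => by
    have H := pushes n
    have hU2 : ∀ s, (∀ i, w i ≠ s) →
        U (Fin.init w) s (low h) * U (Fin.init w) s (low h) = 1 :=
      fun s hs => (H _ (Fin.init w) (low h)).1 s fun i => hs i.castSucc
    have hcomm : ∀ s, (∀ i, w i ≠ s) →
        Commute (U (Fin.init w) s (low h)) (CU (Fin.init w) (w (Fin.last n)) s (diff h)) :=
      fun s hs => U_commute_CU _ _ (fun i => hs i.castSucc) (fun i => hs i.castSucc) (hs _)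
    constructor
    · intro s hs
      rw [U_succ]
      nth_rewrite 1 [(hcomm s hs).eq]
      rw [mul_assoc, ← mul_assoc (U _ _ _), hU2 s hs, one_mul]
      exact H.CU_mul_self _ (hs _) fun i => hs i.castSucc
    · intro t s hts ht hs
      have hc := (U_commute_CU (low h) (diff h) (fun i => hs i.castSucc) (fun i => ht i.castSucc)
        (ht (Fin.last n)) : Commute (U (Fin.init w) t (low h))
          (CU (Fin.init w) (w (Fin.last n)) s (diff h)))
      have ht' : ∀ i, Fin.init w i ≠ t := fun i => ht i.castSucc
      have hs' : ∀ i, Fin.init w i ≠ s := fun i => hs i.castSucc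
      rw [U_succ, U_succ, ← conj_conj (hcomm t ht), H.CU_conj_C _ (ht _) (hs _) hts ht' hs',
        conj_mul (hU2 t ht), (H _ (Fin.init w) (low h)).2 t s hts ht' hs', conj_of_commute (hU2 t ht) hc, mul_assoc]

section rules

variable {n N : ℕ} {w : Fin n → Fin N} {y s t r : Fin N} {g h k : (Fin n → Bool) → Bool}

theorem U_mul_self (h : (Fin n → Bool) → Bool) (hs : ∀ i, w i ≠ s) : U w s h * U w s h = 1 :=
  (pushes n N w h).1 s hs

theorem U_conj_C (h : (Fin n → Bool) → Bool) (hts : t ≠ s) (ht : ∀ i, w i ≠ t)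
    (hs : ∀ i, w i ≠ s) : U w t h * C t s * U w t h = C t s * U w s h :=
  (pushes n N w h).2 t s hts ht hs

theorem U_conj_T (h : (Fin n → Bool) → Bool) (hty : t ≠ y) (hts : t ≠ s) (hys : y ≠ s)
    (ht : ∀ i, w i ≠ t) (hs : ∀ i, w i ≠ s) :
    U w t h * T y t s * U w t h = T y t s * CU w y s h := (pushes n).conj_T h hty hts hys ht hs

theorem zEq_CU (h : (Fin n → Bool) → Bool) (hys : y ≠ s) (hs : ∀ i, w i ≠ s) :
    ZEq (U (Fin.castSucc ∘ w) (Fin.last N) h * T y.castSucc (Fin.last N) s.castSucc *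
      U (Fin.castSucc ∘ w) (Fin.last N) h) (lift (CU w y s h)) := (pushes n).clean h hys hs

theorem CU_mul_self (h : (Fin n → Bool) → Bool) (hys : y ≠ s) (hs : ∀ i, w i ≠ s) :
    CU w y s h * CU w y s h = 1 := (pushes n).CU_mul_self h hys hs

end rules

/-! #### Oracles are additive in the function -/

theorem U_false : ∀ {n N : ℕ} (w : Fin n → Fin N) (s : Fin N), U w s (fun _ => false) = 1
  | 0, N, w, s => by rw [U_zero]; rfl
  | n + 1, N, w, s => by
    have e : diff (fun _ : Fin (n + 1) → Bool => false) = fun _ => false := rfl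
    have e' : low (fun _ : Fin (n + 1) → Bool => false) = fun _ => false := rfl
    rw [U_succ, e', U_false, CU, e, U_false, one_mul, mul_one, one_mul,
      ← anc0_one]
    exact (zEq_T' _ _).anc0_eq

theorem CU_false {n N : ℕ} (w : Fin n → Fin N) (y s : Fin N) : CU w y s (fun _ => false) = 1 := by
  rw [CU, U_false, one_mul, mul_one, ← anc0_one]
  exact (zEq_T' _ _).anc0_eq

/-- Moving the oracle of `g` on the ancilla past the Toffoli gate creates the factor `CU g`. The
oracle of the sum is the product of the two oracles, so moving it past the gate creates both `CU (g
+ h)` and `CU g * CU h`; everything else cancels. -/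
theorem CU_mul_of {n : ℕ} (H : ∀ {N : ℕ} {w : Fin n → Fin N} {s : Fin N}
      (g h : (Fin n → Bool) → Bool), (∀ i, w i ≠ s) →
      U w s g * U w s h = U w s fun x => xor (g x) (h x))
    {N : ℕ} {w : Fin n → Fin N} {y s : Fin N}
    (g h : (Fin n → Bool) → Bool) (hys : y ≠ s) (hs : ∀ i, w i ≠ s) :
    CU w y s g * CU w y s h = CU w y s fun x => xor (g x) (h x) := by
  have key : ∀ g : (Fin n → Bool) → Bool, lift (CU w y s g) =
      T y.castSucc (Fin.last N) s.castSucc * (U (Fin.castSucc ∘ w) (Fin.last N) g *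
        T y.castSucc (Fin.last N) s.castSucc * U (Fin.castSucc ∘ w) (Fin.last N) g) := by
    intro g
    rw [U_conj_T g (last_ne_castSucc y) (last_ne_castSucc s) (castSucc_ne hys)
      castSucc_comp_ne_last (castSucc_comp_ne hs), ← mul_assoc, T_mul_self, one_mul, lift_CU]
  have hc : ∀ g k : (Fin n → Bool) → Bool, Commute (lift (CU w y s g))
      (U (Fin.castSucc ∘ w) (Fin.last N) k) := by
    intro g k
    rw [lift_CU]
    exact (U_commute_CU _ _ (castSucc_comp_ne hs) castSucc_comp_ne_last (castSucc_ne_last y)).symm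
  have hT : ∀ g : (Fin n → Bool) → Bool, Commute (lift (CU w y s g))
      (T y.castSucc (Fin.last N) s.castSucc) := by
    intro g
    rw [lift_CU]
    exact (T_commute_CU g (castSucc_comp_ne hs) (castSucc_ne hys) (castSucc_ne hys.symm)
      (castSucc_ne_last s)).symm
  have hUU := U_mul_self (w := Fin.castSucc ∘ w) (s := Fin.last N)
  have hTU : ∀ g : (Fin n → Bool) → Bool, U (Fin.castSucc ∘ w) (Fin.last N) g *
      T y.castSucc (Fin.last N) s.castSucc = lift (CU w y s g) *
      T y.castSucc (Fin.last N) s.castSucc * U (Fin.castSucc ∘ w) (Fin.last N) g := by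
    intro g
    rw [(hT g).eq, key g, ← mul_assoc, ← mul_assoc, T_mul_self, one_mul, mul_assoc,
      hUU g castSucc_comp_ne_last, mul_one]
  have e := H g h (castSucc_comp_ne_last (w := w))
  have h1 := hTU fun x => xor (g x) (h x)
  have h2 : U (Fin.castSucc ∘ w) (Fin.last N) (fun x => xor (g x) (h x)) *
      T y.castSucc (Fin.last N) s.castSucc = lift (CU w y s g * CU w y s h) *
      T y.castSucc (Fin.last N) s.castSucc *
      U (Fin.castSucc ∘ w) (Fin.last N) (fun x => xor (g x) (h x)) := by
    rw [← e, mul_assoc, hTU h, mul_assoc, ← (hc h g).left_comm, ← mul_assoc (U _ _ g), hTU g,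
      TOF.lift_mul, (CU_commute_CU g h hs hys hs hys |> commute_lift).eq]
    simp only [mul_assoc]
  have h3 := h1.symm.trans h2
  have h4 := congrArg (· * (U (Fin.castSucc ∘ w) (Fin.last N) (fun x => xor (g x) (h x)) *
    T y.castSucc (Fin.last N) s.castSucc)) h3
  simp only [mul_assoc] at h4
  simp only [← mul_assoc (U _ _ _) (U _ _ _), hUU _ castSucc_comp_ne_last, one_mul, T_mul_self,
    mul_one] at h4
  exact (lift_injective h4).symm

theorem U_mul : ∀ {n N : ℕ} {w : Fin n → Fin N} {s : Fin N} (g h : (Fin n → Bool) → Bool),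
    (∀ i, w i ≠ s) → U w s g * U w s h = U w s fun x => xor (g x) (h x)
  | 0, N, w, s, g, h, _ => by
    simp only [U_zero]
    cases g ![] <;> cases h ![] <;> simp [X_mul_self]
  | n + 1, N, w, s, g, h, hs => by
    have hs' : ∀ i, Fin.init w i ≠ s := fun i => hs i.castSucc
    have e : diff (fun x => xor (g x) (h x)) = fun x => xor (diff g x) (diff h x) := by
      funext x
      simp only [diff]
      generalize g _ = a, g _ = b, h _ = c, h _ = d
      revert a b c d
      decide
    have e' : low (fun x => xor (g x) (h x)) = fun x => xor (low g x) (low h x) := rfl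
    have hc := U_commute_CU (y := w (Fin.last n)) (low h) (diff g) hs' hs' (hs _)
    rw [U_succ, U_succ, U_succ, e, e', ← U_mul _ _ hs', ← CU_mul_of U_mul _ _ (hs _) hs',
      mul_assoc, mul_assoc, ← hc.left_comm]

theorem CU_mul {n N : ℕ} {w : Fin n → Fin N} {y s : Fin N} (g h : (Fin n → Bool) → Bool)
    (hys : y ≠ s) (hs : ∀ i, w i ≠ s) :
    CU w y s g * CU w y s h = CU w y s fun x => xor (g x) (h x) := CU_mul_of U_mul g h hys hs

/-! #### Oracles for constants and variables -/

theorem U_true : ∀ {n N : ℕ} (w : Fin n → Fin N) (s : Fin N), U w s (fun _ => true) = X s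
  | 0, N, w, s => by rw [U_zero]; rfl
  | n + 1, N, w, s => by
    have e : diff (fun _ : Fin (n + 1) → Bool => true) = fun _ => false := rfl
    have e' : low (fun _ : Fin (n + 1) → Bool => true) = fun _ => true := rfl
    rw [U_succ, e', U_true, e, CU_false, mul_one]

theorem CU_true {n N : ℕ} (w : Fin n → Fin N) (y s : Fin N) : CU w y s (fun _ => true) = C y s := by
  rw [CU, U_true, anc0]
  simp only [mul_def, Category.assoc]
  rw [X_removeBit, ← Category.assoc, addBit_X, Bool.not_false, T_symm,
    ← Category.assoc (addBit true N), addBit_true_T,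
    Category.assoc]
  exact (congrArg _ (addBit_comp_removeBit true N)).trans (comp_one _)

/-- A function which does not depend on the last argument. -/
theorem U_init {n N : ℕ} (w : Fin (n + 1) → Fin N) (s : Fin N) (g : (Fin n → Bool) → Bool) :
    U w s (fun x => g (Fin.init x)) = U (Fin.init w) s g := by
  have e : diff (fun x : Fin (n + 1) → Bool => g (Fin.init x)) = fun _ => false := by
    funext x; simp [diff]
  have e' : low (fun x : Fin (n + 1) → Bool => g (Fin.init x)) = g := by
    funext x; simp [low]
  rw [U_succ, e, e', CU_false, mul_one]

theorem CU_init {n N : ℕ} (w : Fin (n + 1) → Fin N) (y s : Fin N) (g : (Fin n → Bool) → Bool) :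
    CU w y s (fun x => g (Fin.init x)) = CU (Fin.init w) y s g := by
  rw [CU, U_init]; rfl

/-- A multiple of the last argument. -/
theorem U_last_and {n N : ℕ} (w : Fin (n + 1) → Fin N) (s : Fin N) (g : (Fin n → Bool) → Bool) :
    U w s (fun x => x (Fin.last n) && g (Fin.init x)) =
      CU (Fin.init w) (w (Fin.last n)) s g := by
  have e : diff (fun x : Fin (n + 1) → Bool => x (Fin.last n) && g (Fin.init x)) = g := by
    funext x; simp [diff]
  have e' : low (fun x : Fin (n + 1) → Bool => x (Fin.last n) && g (Fin.init x)) =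
      fun _ => false := by
    funext x; simp [low]
  rw [U_succ, e, e', U_false, one_mul]

theorem U_apply : ∀ {n N : ℕ} (w : Fin n → Fin N) (s : Fin N) (i : Fin n),
    U w s (fun x => x i) = C (w i) s
  | n + 1, N, w, s, i => by
    induction i using Fin.lastCases with
    | last =>
      have := U_last_and w s fun _ => true
      simp only [Bool.and_true] at this
      rw [this, CU_true]
    | cast i => exact (U_init w s fun x => x i).trans (U_apply _ s i)

/-! #### Products -/

/-- The gate `D a b d e` adds the product of the bits `a`, `b`, `d` to `e`. -/
noncomputable def D {N : ℕ} (a b d e : Fin N) : H N N :=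
  anc0 (T a.castSucc b.castSucc (Fin.last N) * T (Fin.last N) d.castSucc e.castSucc *
    T a.castSucc b.castSucc (Fin.last N))

theorem map_D {N M : ℕ} {φ : Fin N → Fin M} (hφ : Function.Injective φ) (a b d e : Fin N) :
    map φ (D a b d e) = D (φ a) (φ b) (φ d) (φ e) := by
  have hφ' := extend_injective hφ
  rw [D, map_anc0 hφ, map_mul', map_mul', map_T hφ', map_T hφ', extend_last]
  simp only [extend_castSucc]
  rw [D]

theorem D_symm_left {N : ℕ} (a b d e : Fin N) : D a b d e = D b a d e := by
  rw [D, T_symm a.castSucc, D]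

/-- The circuit has its ancilla in the middle; two crossings carry it to the end, where `anc0`
expects it. -/
theorem ofCircuit_cccnot : ofCircuit Circuit.cccnot = (D 0 1 2 3 : H 4 4) := by
  have h : ofCircuit Circuit.cccnot = lift (lift (addBit false 2)) ≫
      (ofCircuit (.tof ⊠ Circuit.id 2) * ofCircuit (Circuit.id 2 ⊠ .tof) *
        ofCircuit (.tof ⊠ Circuit.id 2)) ≫ lift (lift (removeBit false 2)) := by
    have h' : ofCircuit Circuit.cccnot = ((((addBit false 2 ⊙ one 2) ≫
      ofCircuit (.tof ⊠ Circuit.id 2)) ≫ ofCircuit (Circuit.id 2 ⊠ .tof)) ≫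
        ofCircuit (.tof ⊠ Circuit.id 2)) ≫ (removeBit false 2 ⊙ one 2) := rfl
    rw [lift_lift, lift_lift, h']
    simp only [mul_def, Category.assoc]
  rw [h, ofCircuit_id_tens, ofCircuit_tens_id, ofCircuit_tof, map_T (Fin.natAdd_injective _ _),
    map_T (Fin.castAdd_injective _ _)]
  have hs : (swapLast 3 ≫ lift (swapLast 2) : H 5 5) =
      perm (Equiv.swap 3 4 * Equiv.swap 2 3 : Equiv.Perm (Fin 5)) := by
    rw [map_mul, swapLast_eq_perm, swapLast_eq_perm, lift_perm]
    congr 2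
    ext x
    revert x
    decide
  have hs' : (lift (swapLast 2) ≫ swapLast 3 : H 5 5) =
      perm (Equiv.swap 3 4 * Equiv.swap 2 3 : Equiv.Perm (Fin 5))⁻¹ := by
    have h : (perm (Equiv.swap 2 3 * Equiv.swap 3 4) : H 5 5) = lift (swapLast 2) ≫ swapLast 3 := by
      rw [map_mul, swapLast_eq_perm, swapLast_eq_perm, lift_perm]
      congr 2
      ext x
      revert x
      decide
    rw [← h, mul_inv_rev, Equiv.swap_inv, Equiv.swap_inv]
  rw [← addBit_comp_swapLast, ← swapLast_comp_removeBit, lift_comp, lift_comp,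
    ← addBit_comp_swapLast, ← swapLast_comp_removeBit]
  have e : ∀ Y : H 5 5, ((addBit false 4 ≫ swapLast 3) ≫ lift (swapLast 2)) ≫ Y ≫
      (lift (swapLast 2) ≫ swapLast 3 ≫ removeBit false 4) =
      anc0 (map (Equiv.swap 3 4 * Equiv.swap 2 3 : Equiv.Perm (Fin 5)) Y) := by
    intro Y
    rw [← perm_conj, ← hs, ← hs', anc0]
    simp only [mul_def, Category.assoc]
  refine (e _).trans ?_
  rw [map_mul', map_mul', map_T (Equiv.injective _), map_T (Equiv.injective _)]
  rfl

/-- This is the identity `cccnot_cross` placed on arbitrary wires: a product of three bits does not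
depend on which two are multiplied first. -/
theorem D_symm_right {N : ℕ} {a b d e : Fin N} (h : Function.Injective ![a, b, d, e]) :
    D a b d e = D a d b e := by
  have h1 : ofCircuit Circuit.cccnot =
      (ofCircuit (Circuit.id 1 ⊠ Circuit.cross ⊠ Circuit.id 1) * ofCircuit Circuit.cccnot) *
        ofCircuit (Circuit.id 1 ⊠ Circuit.cross ⊠ Circuit.id 1) := sound (.ax .cccnot_cross)
  have h2 : ofCircuit (Circuit.id 1 ⊠ Circuit.cross ⊠ Circuit.id 1) =
      (perm (Equiv.swap 1 2) : H 4 4) := by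
    change lift (swapLast 1) = _
    rw [swapLast_eq_perm, lift_perm]
    congr 1
    ext x
    revert x
    decide
  rw [h2, ofCircuit_cccnot] at h1
  have h3 := h1.trans (congrArg _ (congrArg perm (Equiv.swap_inv _ _).symm))
  rw [perm_conj, map_D (Equiv.injective _)] at h3
  have h4 := congrArg (map ![a, b, d, e]) h3
  rw [map_D h, map_D h] at h4
  exact h4

/-! #### Oracles for products -/

theorem swapLast_conj {N : ℕ} (V : H (N + 2) (N + 2)) : swapLast N * V * swapLast N =
    map (Equiv.swap (Fin.last N).castSucc (Fin.last (N + 1))) V := by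
  have h := perm_conj (Equiv.swap (Fin.last N).castSucc (Fin.last (N + 1))) V
  rw [Equiv.swap_inv] at h
  rw [swapLast_eq_perm]
  exact h

theorem anc0_anc0_swap {N : ℕ} (V : H (N + 2) (N + 2)) :
    anc0 (anc0 (map (Equiv.swap (Fin.last N).castSucc (Fin.last (N + 1))) V)) = anc0 (anc0 V) := by
  rw [← swapLast_conj]
  simp only [anc0, mul_def, Category.assoc]
  rw [← Category.assoc (addBit false (N + 1)), addBit_comp_swapLast,
    ← Category.assoc (addBit false N), addBit_comp_lift, Category.assoc,
    ← Category.assoc (swapLast N), swapLast_comp_removeBit, lift_comp_removeBit]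

theorem CU_last_and {n N : ℕ} (w : Fin (n + 1) → Fin N) (r s : Fin N)
    (g : (Fin n → Bool) → Bool) :
    CU w r s (fun x => x (Fin.last n) && g (Fin.init x)) =
      anc0 (CU (Fin.castSucc ∘ Fin.init w) (w (Fin.last n)).castSucc (Fin.last N) g *
        T r.castSucc (Fin.last N) s.castSucc *
        CU (Fin.castSucc ∘ Fin.init w) (w (Fin.last n)).castSucc (Fin.last N) g) := by
  rw [CU, U_last_and]
  rfl

/-- Both controlled oracles share one inner ancilla for `g`, whose oracle commutes with the middle
Toffoli gate and so can be moved to the outside. After the two ancillas are exchanged, the three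
Toffoli gates left inside form `D`. -/
theorem anc0_CU_conj {n N : ℕ} {w : Fin n → Fin N} {y r s : Fin N} (g : (Fin n → Bool) → Bool)
    (hs : ∀ i, w i ≠ s) :
    anc0 (CU (Fin.castSucc ∘ w) y.castSucc (Fin.last N) g * T r.castSucc (Fin.last N) s.castSucc *
      CU (Fin.castSucc ∘ w) y.castSucc (Fin.last N) g) =
    anc0 (U (Fin.castSucc ∘ w) (Fin.last N) g * D y.castSucc (Fin.last N) r.castSucc s.castSucc *
      U (Fin.castSucc ∘ w) (Fin.last N) g) := by
  have hz := zEq_CU (w := Fin.castSucc ∘ w) g (castSucc_ne_last y) castSucc_comp_ne_last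
  have hl : ZEq (lift (T r.castSucc (Fin.last N) s.castSucc)) (lift _) := ZEq.refl _
  rw [((hz.mul_mul hl).mul_mul hz).eq_anc0]
  have hU2 := U_mul_self (w := Fin.castSucc ∘ Fin.castSucc ∘ w) (s := Fin.last (N + 1)) g
    castSucc_comp_ne_last
  have hTu := T_commute_U (w := Fin.castSucc ∘ Fin.castSucc ∘ w) (s := Fin.last (N + 1))
    (a := r.castSucc.castSucc) (b := (Fin.last N).castSucc) (c := s.castSucc.castSucc) g
    (castSucc_comp_ne (castSucc_comp_ne hs)) (last_ne_castSucc _) (last_ne_castSucc _)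
  have hi : Function.Injective (Equiv.swap (Fin.last N).castSucc (Fin.last (N + 1))) :=
    Equiv.injective _
  have hsw : ∀ a : Fin N, Equiv.swap (Fin.last N).castSucc (Fin.last (N + 1)) a.castSucc.castSucc =
      a.castSucc.castSucc := fun a => Equiv.swap_apply_of_ne_of_ne
        (castSucc_ne (castSucc_ne_last a)) (castSucc_ne_last _)
  rw [lift_T]
  nth_rewrite 1 [← conj_of_commute hU2 hTu.symm]
  rw [← conj_mul hU2, ← conj_mul hU2, ← anc0_anc0_swap, map_mul', map_mul', map_mul', map_mul',
    map_T hi, map_T hi, map_U hi, Equiv.swap_apply_left, Equiv.swap_apply_right, hsw, hsw, hsw]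
  have hw : (Equiv.swap (Fin.last N).castSucc (Fin.last (N + 1)) : _ → _) ∘
      (Fin.castSucc ∘ Fin.castSucc ∘ w) = Fin.castSucc ∘ Fin.castSucc ∘ w := by
    funext i
    exact hsw (w i)
  rw [hw, ← lift_U, anc0_mul_lift, anc0_lift_mul,
    T_symm r.castSucc.castSucc]
  rfl

/-- Both sides add the triple product of `y`, `g` and `r`, bracketed differently; the symmetries of
`D` exchange `y` and `r`. -/
theorem anc0_CU_exchange {n N : ℕ} {w : Fin n → Fin N} {y r s : Fin N}
    (g : (Fin n → Bool) → Bool) (hyr : y ≠ r) (hr : r ≠ s) (hy : y ≠ s) (hs : ∀ i, w i ≠ s) :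
    anc0 (CU (Fin.castSucc ∘ w) y.castSucc (Fin.last N) g * T r.castSucc (Fin.last N) s.castSucc *
      CU (Fin.castSucc ∘ w) y.castSucc (Fin.last N) g) =
    anc0 (CU (Fin.castSucc ∘ w) r.castSucc (Fin.last N) g * T y.castSucc (Fin.last N) s.castSucc *
      CU (Fin.castSucc ∘ w) r.castSucc (Fin.last N) g) := by
  rw [anc0_CU_conj g hs, anc0_CU_conj g hs, D_symm_left, D_symm_right, D_symm_left]
  exact injective_four (last_ne_castSucc _) (last_ne_castSucc _) (last_ne_castSucc _)
    (castSucc_ne hyr) (castSucc_ne hy) (castSucc_ne hr)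

/-- Idempotence of a bit, `y · y = y`. For gates it is the reduction of `D y l y s` to `T y l s`,
which comes from `T_conj_T`. -/
theorem CU_last_and_self {n N : ℕ} (w : Fin (n + 1) → Fin N) {s : Fin N}
    (g : (Fin n → Bool) → Bool) (hs : ∀ i, w i ≠ s) :
    CU w (w (Fin.last n)) s (fun x => x (Fin.last n) && g (Fin.init x)) =
      CU (Fin.init w) (w (Fin.last n)) s g := by
  have hs' : ∀ i, Fin.init w i ≠ s := fun i => hs _
  have e : ∀ {N : ℕ} (y l s : Fin N), y ≠ l → l ≠ s → y ≠ s → D y l y s = T y l s := by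
    intro N y l s hyl hls hys
    have h := T_conj_T (injective_four (castSucc_ne hyl.symm) (castSucc_ne_last l)
      (castSucc_ne hls) (castSucc_ne_last y) (castSucc_ne hys) (last_ne_castSucc s))
    have hz : ZEq (T y.castSucc (Fin.last N) s.castSucc) (lift 1) := by
      rw [lift_one]
      exact zEq_T' y s
    rw [D, T_symm y.castSucc, T_symm (Fin.last N), h, ← lift_T, anc0_lift_mul, ← hz.eq_anc0,
      mul_one, T_symm]
  rw [CU_last_and, anc0_CU_conj g hs', e _ _ _ (castSucc_ne_last _) (last_ne_castSucc _)
    (castSucc_ne (hs _)), CU]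

/-- Conjugating the controlled oracle for `g` by the oracle for `k` on its control leaves the oracle
for the product. -/
def ConjProd {n : ℕ} (g k : (Fin n → Bool) → Bool) : Prop :=
  ∀ (N : ℕ) (w : Fin n → Fin N) (r s : Fin N), r ≠ s → (∀ i, w i ≠ r) → (∀ i, w i ≠ s) →
    U w r k * CU w r s g * U w r k = CU w r s g * U w s fun x => g x && k x

section ConjProd

variable {n : ℕ} {g g' k k' : (Fin n → Bool) → Bool}

theorem ConjProd.add_left (h : ConjProd g k) (h' : ConjProd g' k) :
    ConjProd (fun x => xor (g x) (g' x)) k := by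
  intro N w r s hrs hr hs
  have hc := U_commute_CU (y := r) (fun x => g x && k x) g' hs hs hrs
  have e : (fun x => xor (g x) (g' x) && k x) = fun x => xor (g x && k x) (g' x && k x) := by
    funext x
    exact Bool.and_xor_distrib_right _ _ _
  rw [← CU_mul _ _ hrs hs, conj_mul (U_mul_self k hr), h _ _ _ _ hrs hr hs, h' _ _ _ _ hrs hr hs, e,
    ← U_mul _ _ hs, mul_assoc, mul_assoc, hc.left_comm]

theorem ConjProd.add_right (h : ConjProd g k) (h' : ConjProd g k') :
    ConjProd g (fun x => xor (k x) (k' x)) := by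
  intro N w r s hrs hr hs
  have hc := U_commute_U k k' hr hr
  have hc' := U_commute_U k (fun x => g x && k' x) hs hr
  have e : (fun x => g x && xor (k x) (k' x)) = fun x => xor (g x && k x) (g x && k' x) := by
    funext x
    exact Bool.and_xor_distrib_left _ _ _
  rw [← U_mul _ _ hr, ← conj_conj hc, h' _ _ _ _ hrs hr hs, conj_mul (U_mul_self k hr),
    h _ _ _ _ hrs hr hs, conj_of_commute (U_mul_self k hr) hc', e, ← U_mul _ _ hs, mul_assoc]

/-- Conjugate the Toffoli gate with controls `r` and an ancilla by the commuting oracles of `g` on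
`r` and of `k` on the ancilla. One order of conjugation is evaluated by the hypothesis, the other
contains the conjugation that is sought, and the two results are equal. -/
theorem ConjProd.symm (h : ConjProd g k) : ConjProd k g := by
  intro N w r s hrs hr hs
  refine lift_injective ?_
  simp only [TOF.lift_mul, lift_U, lift_CU]
  have hr' := castSucc_comp_ne hr
  have hs' := castSucc_comp_ne hs
  have hl := castSucc_comp_ne_last (w := w)
  have h1 := h _ _ _ _ (last_ne_castSucc s) hl hs'
  have eg := U_conj_T g (castSucc_ne_last r) (castSucc_ne hrs) (last_ne_castSucc s) hr' hs'
  have ek := U_conj_T k (last_ne_castSucc r) (last_ne_castSucc s) (castSucc_ne hrs) hl hs'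
  have hc : Commute (U (Fin.castSucc ∘ w) (Fin.last N) k) (U (Fin.castSucc ∘ w) r.castSucc g) :=
    U_commute_U k g hr' hl
  have hk2 := U_mul_self k hl
  have hg2 := U_mul_self g hr'
  have hT := T_mul_self (Fin.last N) r.castSucc s.castSucc
  rw [T_symm r.castSucc] at ek
  have e1 := conj_conj hc (T (Fin.last N) r.castSucc s.castSucc)
  have e2 := conj_conj hc.symm (T (Fin.last N) r.castSucc s.castSucc)
  rw [eg, conj_mul hk2, ek, h1] at e1
  rw [ek, conj_mul hg2, eg, ← hc.eq, ← e1] at e2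
  have hcc := CU_commute_CU (w := Fin.castSucc ∘ w) (v := Fin.castSucc ∘ w) (x := r.castSucc)
    (y := Fin.last N) k g hs' (castSucc_ne hrs) hs' (last_ne_castSucc s)
  have hcg := CU_mul_self (w := Fin.castSucc ∘ w) g (last_ne_castSucc s) hs'
  have e3 := congrArg (fun z => CU (Fin.castSucc ∘ w) (Fin.last N) s.castSucc g *
    (T (Fin.last N) r.castSucc s.castSucc * z)) e2
  simp only [mul_assoc] at e3
  simp only [← mul_assoc (T _ _ _) (T _ _ _), hT, one_mul] at e3
  rw [← hcc.left_comm] at e3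
  simp only [← mul_assoc (CU _ (Fin.last N) _ _) (CU _ (Fin.last N) _ _), hcg, one_mul] at e3
  rw [mul_assoc, e3]
  simp only [Bool.and_comm]

theorem conjProd_zero (g k : (Fin 0 → Bool) → Bool) : ConjProd g k := by
  intro N w r s hrs hr hs
  have hconst : ∀ g : (Fin 0 → Bool) → Bool, g = fun _ => g ![] := fun g => by
    funext x
    exact congrArg g (Subsingleton.elim _ _)
  rw [hconst g, hconst k]
  cases g ![] <;> cases k ![] <;>
    simp only [U_true, U_false, CU_false, CU_true, Bool.and_true, Bool.and_false,
      mul_one, one_mul, X_mul_self]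
  -- Only the case where both constants are true is left: a not gate on the control of a controlled
  -- not.
  rw [X_conj_C hrs, (X_commute_C hrs.symm).eq]

theorem conjProd_init (h : ConjProd g k) :
    ConjProd (fun x : Fin (n + 1) → Bool => g (Fin.init x)) (fun x => k (Fin.init x)) := by
  intro N w r s hrs hr hs
  rw [U_init, CU_init, U_init w s fun x => g x && k x]
  exact h _ _ _ _ hrs (fun i => hr _) fun i => hs _

/-- The exchange rule makes `r` the control next to `g`, so that the hypothesis applies with the
ancilla as target. The product of `g` and `k` created on the ancilla then passes the Toffoli gate
controlled by the last input, which gives the controlled oracle of the product. -/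
theorem conjProd_last_init (h : ConjProd g k) :
    ConjProd (fun x : Fin (n + 1) → Bool => x (Fin.last n) && g (Fin.init x))
      (fun x => k (Fin.init x)) := by
  intro N w r s hrs hr hs
  have hr' : ∀ i, Fin.init w i ≠ r := fun i => hr _
  have hs' : ∀ i, Fin.init w i ≠ s := fun i => hs _
  have e : (fun x : Fin (n + 1) → Bool => (x (Fin.last n) && g (Fin.init x)) && k (Fin.init x)) =
      fun x => x (Fin.last n) && (fun x => g x && k x) (Fin.init x) := by
    funext x
    exact Bool.and_assoc _ _ _
  rw [e, U_last_and w s fun x => g x && k x, U_init, CU_last_and, anc0_CU_exchange g (hr _) hrs (hs _) hs']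
  have hl := castSucc_comp_ne_last (w := Fin.init w)
  have hu2 : U (Fin.castSucc ∘ Fin.init w) r.castSucc k *
    U (Fin.castSucc ∘ Fin.init w) r.castSucc k = 1 := U_mul_self k (castSucc_comp_ne hr')
  have h1 := h _ _ _ _ (castSucc_ne_last r) (castSucc_comp_ne hr') hl
  have hTu := T_commute_U (w := Fin.castSucc ∘ Fin.init w) (s := r.castSucc)
    (a := (w (Fin.last n)).castSucc) (b := Fin.last N) (c := s.castSucc) k
    (castSucc_comp_ne hs') (castSucc_ne (hr _).symm) (castSucc_ne_last r)
  have hcomm : Commute (U (Fin.castSucc ∘ Fin.init w) (Fin.last N) fun x => g x && k x)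
      (CU (Fin.castSucc ∘ Fin.init w) r.castSucc (Fin.last N) g) :=
    U_commute_CU _ _ hl hl (castSucc_ne_last r)
  have hcomm' : Commute (lift (CU (Fin.init w) (w (Fin.last n)) s fun x => g x && k x))
      (CU (Fin.castSucc ∘ Fin.init w) r.castSucc (Fin.last N) g) := by
    rw [lift_CU]
    exact CU_commute_CU _ _ hl (castSucc_ne_last _) (castSucc_comp_ne hs') (castSucc_ne hrs)
  rw [← anc0_mul_lift, ← anc0_lift_mul, ← anc0_mul_lift, lift_U, conj_mul hu2, conj_mul hu2, h1,
    conj_of_commute hu2 hTu.symm]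
  nth_rewrite 2 [← hcomm.eq]
  rw [mul_assoc _ _ (lift _), ← hcomm'.eq, lift_CU]
  have h2 := U_conj_T (w := Fin.castSucc ∘ Fin.init w) (fun x => g x && k x)
    (last_ne_castSucc (w (Fin.last n))) (last_ne_castSucc s) (castSucc_ne (hs _)) hl
    (castSucc_comp_ne hs')
  simp only [mul_assoc] at h2 ⊢
  rw [← mul_assoc (T _ _ _) (CU _ _ _ _) (CU _ _ _ _), ← h2]
  simp only [mul_assoc]

theorem conjProd_last_last (h' : ConjProd k g) :
    ConjProd (fun x : Fin (n + 1) → Bool => x (Fin.last n) && g (Fin.init x))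
      (fun x => x (Fin.last n) && k (Fin.init x)) := by
  -- Here the first function must not involve the last input while the second does. Symmetry
  -- provides this, hence the reversed order in the hypothesis.
  have hk := (conjProd_last_init h').symm
  intro N w r s hrs hr hs
  have hr' : ∀ i, Fin.init w i ≠ r := fun i => hr _
  have hs' : ∀ i, Fin.init w i ≠ s := fun i => hs _
  have e : (fun x : Fin (n + 1) → Bool =>
      (x (Fin.last n) && g (Fin.init x)) && (x (Fin.last n) && k (Fin.init x))) =
      fun x => x (Fin.last n) && (fun x => g x && k x) (Fin.init x) := by
    funext x
    cases x (Fin.last n) <;> simp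
  have e' : (fun x : Fin (n + 1) → Bool => g (Fin.init x) && (x (Fin.last n) && k (Fin.init x))) =
      fun x => x (Fin.last n) && (fun x => g x && k x) (Fin.init x) := by
    funext x
    cases x (Fin.last n) <;> simp
  have hl := castSucc_comp_ne_last (w := Fin.init w)
  have hl' := castSucc_comp_ne_last (w := w)
  have h1 := hk _ (Fin.castSucc ∘ w) _ _ (castSucc_ne_last r) (castSucc_comp_ne hr) hl'
  have h2 := U_conj_T (w := Fin.castSucc ∘ w)
    (fun x => x (Fin.last n) && (fun x => g x && k x) (Fin.init x))
    (last_ne_castSucc (w (Fin.last n))) (last_ne_castSucc s) (castSucc_ne (hs _)) hl'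
    (castSucc_comp_ne hs)
  have h3 := CU_last_and_self (Fin.castSucc ∘ w) (fun x => g x && k x) (castSucc_comp_ne hs)
  have hT : Commute (T (w (Fin.last n)).castSucc (Fin.last N) s.castSucc)
      (CU (Fin.castSucc ∘ Fin.init w) (w (Fin.last n)).castSucc r.castSucc k) :=
    T_commute_CU _ (castSucc_comp_ne hs') (castSucc_ne (hs _)) (castSucc_ne (hr _).symm)
      (castSucc_ne_last r)
  have hu2 := CU_mul_self (w := Fin.castSucc ∘ Fin.init w) k (castSucc_ne (hr (Fin.last n)))
    (castSucc_comp_ne hr')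
  have hcomm : Commute (CU (Fin.castSucc ∘ Fin.init w) (w (Fin.last n)).castSucc (Fin.last N)
      fun x => g x && k x) (CU (Fin.castSucc ∘ Fin.init w) r.castSucc (Fin.last N) g) :=
    CU_commute_CU _ _ hl (castSucc_ne_last _) hl (castSucc_ne_last _)
  have hcomm' : Commute (lift (CU (Fin.init w) (w (Fin.last n)) s fun x => g x && k x))
      (CU (Fin.castSucc ∘ Fin.init w) r.castSucc (Fin.last N) g) := by
    rw [lift_CU]
    exact CU_commute_CU _ _ hl (castSucc_ne_last _) (castSucc_comp_ne hs') (castSucc_ne hrs)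
  rw [e', U_last_and, U_last_and _ _ fun x => g x && k x, CU_init] at h1
  rw [U_last_and _ _ fun x => g x && k x] at h2
  simp only [Function.comp_apply] at h1 h2 h3
  rw [h3] at h2
  rw [e, U_last_and, U_last_and w s fun x => g x && k x, CU_last_and, anc0_CU_exchange g (hr _) hrs (hs _) hs',
    ← anc0_mul_lift, ← anc0_lift_mul, ← anc0_mul_lift, lift_CU, conj_mul hu2, conj_mul hu2]
  have hw : Fin.init (Fin.castSucc ∘ w) = Fin.castSucc ∘ Fin.init w := rfl
  rw [hw] at h1 h2
  rw [h1, conj_of_commute hu2 hT.symm]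
  nth_rewrite 2 [← hcomm.eq]
  rw [mul_assoc _ _ (lift _), ← hcomm'.eq, lift_CU]
  simp only [mul_assoc] at h2 ⊢
  rw [← mul_assoc (T _ _ _) (CU _ _ s.castSucc _), ← h2]
  simp only [mul_assoc]

/-- The property is biadditive, so splitting both functions as `low + xₙ · diff` leaves four cases
with one input fewer, of which the two mixed ones are exchanged by symmetry. -/
theorem conjProd : ∀ {n : ℕ} (g k : (Fin n → Bool) → Bool), ConjProd g k
  | 0, g, k => conjProd_zero g k
  | n + 1, g, k => by
    have hd : ∀ g : (Fin (n + 1) → Bool) → Bool, g = fun x =>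
        xor (low g (Fin.init x)) (x (Fin.last n) && diff g (Fin.init x)) := by
      intro g
      funext x
      refine Fin.snocCases (fun y b => ?_) x
      cases b <;> simp [low, diff, Fin.init_snoc]
    rw [hd g, hd k]
    refine ConjProd.add_left (ConjProd.add_right ?_ ?_) (ConjProd.add_right ?_ ?_)
    · exact conjProd_init (conjProd _ _)
    · exact (conjProd_last_init (conjProd _ _)).symm
    · exact conjProd_last_init (conjProd _ _)
    · exact conjProd_last_last (conjProd _ _)

end ConjProd

/-! #### Controlled oracles whose control has a known value -/

/-- Write `|0⟩` as `|1⟩` followed by a not gate. Moving that gate through the control creates a not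
gate on the target, which cancels the one produced by the control `|1⟩`. -/
theorem addBit_false_C {N : ℕ} (i : Fin N) :
    addBit false N ≫ C (Fin.last N) i.castSucc = addBit false N := by
  have hc : Commute (X (Fin.last N)) (lift (X i)) := by
    rw [lift_X]
    exact X_commute_X _ _
  have h := X_conj_C (last_ne_castSucc i)
  have h' := mul_eq_of_conj_eq (X_mul_self _) h
  rw [show addBit false N = addBit true N ≫ X (Fin.last N) from (addBit_X true N).symm,
    Category.assoc, ← mul_def, h', comp_mul, comp_mul, ← lift_X, addBit_comp_lift,
    Category.assoc (X i), addBit_true_C, ← Category.assoc, ← mul_def, X_mul_self, one_comp]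

theorem swapLast_lift_CU {n N : ℕ} (w : Fin n → Fin N) (s : Fin N) (h : (Fin n → Bool) → Bool) :
    lift (CU (Fin.castSucc ∘ w) (Fin.last N) s.castSucc h) * swapLast N =
      swapLast N * CU (Fin.castSucc ∘ Fin.castSucc ∘ w) (Fin.last (N + 1)) s.castSucc.castSucc h := by
  have e := swapLast_conj (lift (CU (Fin.castSucc ∘ w) (Fin.last N) s.castSucc h))
  have hsw : ∀ a : Fin N, Equiv.swap (Fin.last N).castSucc (Fin.last (N + 1)) a.castSucc.castSucc =
      a.castSucc.castSucc := fun a => Equiv.swap_apply_of_ne_of_ne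
        (castSucc_ne (castSucc_ne_last a)) (castSucc_ne_last _)
  have hw : (Equiv.swap (Fin.last N).castSucc (Fin.last (N + 1)) : _ → _) ∘
      (Fin.castSucc ∘ Fin.castSucc ∘ w) = Fin.castSucc ∘ Fin.castSucc ∘ w := by
    funext i
    exact hsw (w i)
  rw [lift_CU, map_CU (Equiv.injective _), Equiv.swap_apply_left, hsw, hw] at e
  rw [← e, lift_CU, ← mul_assoc, ← mul_assoc, swapLast_swapLast, one_mul]

section control

variable {n N : ℕ} {w : Fin n → Fin N} {s : Fin N}

/-- The controlled oracle, in the presence of an additional wire. -/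
theorem CU_last_eq (h : (Fin n → Bool) → Bool) (hs : ∀ i, w i ≠ s) :
    CU (Fin.castSucc ∘ Fin.castSucc ∘ w) (Fin.last (N + 1)) s.castSucc.castSucc h =
      T (Fin.last (N + 1)) (Fin.last N).castSucc s.castSucc.castSucc *
        (lift (U (Fin.castSucc ∘ w) (Fin.last N) h) *
          T (Fin.last (N + 1)) (Fin.last N).castSucc s.castSucc.castSucc *
          lift (U (Fin.castSucc ∘ w) (Fin.last N) h)) := by
  rw [lift_U, U_conj_T h (castSucc_ne_last _) (castSucc_ne (last_ne_castSucc s))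
    (last_ne_castSucc _) (castSucc_comp_ne castSucc_comp_ne_last)
    (castSucc_comp_ne (castSucc_comp_ne hs)), ← mul_assoc, T_mul_self, one_mul]

/-- With an additional wire for `h`, the controlled oracle becomes two Toffoli gates and two
uncontrolled oracles. A zero control removes the gates and the oracles cancel; the additional wire
is dropped because `lift` is injective. -/
theorem addBit_false_CU (h : (Fin n → Bool) → Bool) (hs : ∀ i, w i ≠ s) :
    addBit false N ≫ CU (Fin.castSucc ∘ w) (Fin.last N) s.castSucc h = addBit false N := by
  refine lift_injective ?_
  have hz : ∀ Z : H (N + 1) (N + 1), addBit false (N + 1) ≫ (lift Z *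
      T (Fin.last (N + 1)) (Fin.last N).castSucc s.castSucc.castSucc) = Z ≫ addBit false (N + 1) := by
    intro Z
    rw [comp_mul, addBit_comp_lift, Category.assoc, addBit_false_T]
  have h0 : addBit false (N + 1) ≫ CU (Fin.castSucc ∘ Fin.castSucc ∘ w) (Fin.last (N + 1))
      s.castSucc.castSucc h = addBit false (N + 1) := by
    rw [CU_last_eq h hs, comp_mul, addBit_false_T, comp_mul, hz, Category.assoc, addBit_comp_lift,
      ← Category.assoc, ← mul_def, U_mul_self _ castSucc_comp_ne_last, one_comp]
  rw [lift_comp, ← addBit_comp_swapLast, Category.assoc]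
  have e := swapLast_lift_CU w s h
  have e' := congrArg (fun z => swapLast N * z * swapLast N) e
  simp only [mul_assoc, swapLast_swapLast, mul_one] at e'
  rw [← mul_assoc (swapLast N) (swapLast N), swapLast_swapLast, one_mul] at e'
  rw [← mul_def, e', comp_mul, h0]

/-- In the same decomposition, a control ended with `⟨1|` turns the Toffoli gates into controlled
nots from the additional wire, and pushing an oracle through one of them leaves the plain oracle. -/
theorem CU_removeBit_true (h : (Fin n → Bool) → Bool) (hs : ∀ i, w i ≠ s) :
    CU (Fin.castSucc ∘ w) (Fin.last N) s.castSucc h ≫ removeBit true N =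
      removeBit true N ≫ U w s h := by
  refine lift_injective ?_
  have hz : ∀ Z : H (N + 1) (N + 1), (T (Fin.last (N + 1)) (Fin.last N).castSucc
      s.castSucc.castSucc * lift Z) ≫ removeBit true (N + 1) =
      removeBit true (N + 1) ≫ (C (Fin.last N) s.castSucc * Z) := by
    intro Z
    rw [mul_comp, lift_comp_removeBit, ← Category.assoc, T_removeBit_true, Category.assoc, mul_def]
  have h0 : CU (Fin.castSucc ∘ Fin.castSucc ∘ w) (Fin.last (N + 1))
      s.castSucc.castSucc h ≫ removeBit true (N + 1) = removeBit true (N + 1) ≫ lift (U w s h) := by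
    rw [CU_last_eq h hs, mul_assoc (lift _), mul_comp, mul_comp, hz, ← Category.assoc (lift _),
      lift_comp_removeBit, Category.assoc, ← mul_def (U _ _ _), ← mul_assoc,
      U_conj_C h (last_ne_castSucc s) castSucc_comp_ne_last (castSucc_comp_ne hs),
      ← Category.assoc, T_removeBit_true, Category.assoc, ← mul_def, ← mul_assoc, C_mul_self,
      one_mul, lift_U]
  rw [lift_comp, ← swapLast_comp_removeBit, ← Category.assoc, ← mul_def, swapLast_lift_CU, mul_comp,
    h0, ← Category.assoc, swapLast_comp_removeBit, lift_comp]

/-! #### Projections -/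

/-- The projection on the states where the function `g` of the wires `w` is true. -/
noncomputable def Pj {n N : ℕ} (w : Fin n → Fin N) (g : (Fin n → Bool) → Bool) : H N N :=
  addBit false N ≫ U (Fin.castSucc ∘ w) (Fin.last N) g ≫ removeBit true N

theorem Pj_commute {g : (Fin n → Bool) → Bool} {Y : H N N}
    (h : Commute (lift Y) (U (Fin.castSucc ∘ w) (Fin.last N) g)) : Commute Y (Pj w g) := by
  rw [commute_iff_eq, mul_def, mul_def, Pj, ← Category.assoc, ← addBit_comp_lift, Category.assoc,
    ← Category.assoc (lift Y), ← mul_def, h.eq, mul_def, Category.assoc, lift_comp_removeBit]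
  simp only [Category.assoc]

theorem Pj_commute_U {m : ℕ} {v : Fin m → Fin N} (g : (Fin n → Bool) → Bool)
    (k : (Fin m → Bool) → Bool) (hs : ∀ i, w i ≠ s) : Commute (Pj w g) (U v s k) := by
  refine (Pj_commute ?_).symm
  rw [lift_U]
  exact U_commute_U _ _ castSucc_comp_ne_last (castSucc_comp_ne hs)

/-- Before the effect `⟨1|`, the oracle of `k` may be controlled by the ancilla which holds `g`.
Moving the controlled oracle back through the oracle of `g` creates, by `conjProd`, the oracle of
the product, and leaves a controlled oracle whose control is still zero, hence trivial. -/
theorem Pj_mul_U_and (g k : (Fin n → Bool) → Bool) (hs : ∀ i, w i ≠ s) :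
    Pj w g * U w s k = Pj w g * U w s fun x => k x && g x := by
  have h := conjProd k g _ (Fin.castSucc ∘ w) _ _ (last_ne_castSucc s) castSucc_comp_ne_last
    (castSucc_comp_ne hs)
  have h' := mul_eq_of_conj_eq (U_mul_self g castSucc_comp_ne_last) h
  rw [(Pj_commute_U g (fun x => k x && g x) hs).eq, mul_def, mul_def, Pj, Category.assoc, Category.assoc,
    ← CU_removeBit_true k hs, ← Category.assoc (U _ _ _) (CU _ _ _ _), ← mul_def (U _ _ _), h',
    mul_def, mul_def, Category.assoc, Category.assoc, ← Category.assoc (addBit false N),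
    addBit_false_CU k hs, ← lift_U, ← Category.assoc, addBit_comp_lift, Category.assoc]

theorem Pj_mul_U {g k k' : (Fin n → Bool) → Bool} (hs : ∀ i, w i ≠ s)
    (h : ∀ x, g x = true → k x = k' x) : Pj w g * U w s k = Pj w g * U w s k' := by
  rw [Pj_mul_U_and g k hs, Pj_mul_U_and g k' hs]
  congr 2
  funext x
  cases e : g x
  · simp
  · simp [h x e]

theorem map_Pj {N M : ℕ} {φ : Fin N → Fin M} (hφ : Function.Injective φ) {n : ℕ}
    (w : Fin n → Fin N) (g : (Fin n → Bool) → Bool) : map φ (Pj w g) = Pj (φ ∘ w) g := by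
  rw [Pj, show addBit false N ≫ U (Fin.castSucc ∘ w) (Fin.last N) g ≫ removeBit true N =
    anc (ketB false) (braB true) (U (Fin.castSucc ∘ w) (Fin.last N) g) from rfl, map_anc _ _ hφ,
    map_U (extend_injective hφ), extend_last, extend_comp_castSucc]
  rfl

theorem lift_Pj (g : (Fin n → Bool) → Bool) : lift (Pj w g) = Pj (Fin.castSucc ∘ w) g := by
  rw [lift_eq_map, map_Pj (Fin.castSucc_injective N)]

theorem Pj_true : Pj w (fun _ => true) = 1 := by
  rw [Pj, U_true, ← Category.assoc, addBit_X]
  exact addBit_comp_removeBit true N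

theorem Pj_mul_Pj_of {g k k' : (Fin n → Bool) → Bool} (h : ∀ x, g x = true → k x = k' x) :
    Pj w g * Pj w k = Pj w g * Pj w k' := by
  have e : ∀ k, Pj w g * Pj w k = addBit false N ≫ (Pj (Fin.castSucc ∘ w) g *
      U (Fin.castSucc ∘ w) (Fin.last N) k) ≫ removeBit true N := by
    intro k
    rw [← lift_Pj, ← Category.assoc, comp_mul, addBit_comp_lift, mul_def]
    simp only [Category.assoc]
    rfl
  rw [e, e, Pj_mul_U castSucc_comp_ne_last h]

/-- After projecting to `g`, `k` may be replaced by `g · k`; the two projections commute, and after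
projecting to `g · k`, `g` may be replaced by the constant true. -/
theorem Pj_mul_Pj (g k : (Fin n → Bool) → Bool) :
    Pj w g * Pj w k = Pj w fun x => g x && k x := by
  have hc : Commute (Pj w g) (Pj w fun x => g x && k x) := by
    refine Pj_commute ?_
    rw [lift_Pj]
    exact Pj_commute_U _ _ castSucc_comp_ne_last
  have e : ∀ x, (g x && k x) = true → g x = true := fun x h => by
    rw [Bool.and_eq_true] at h
    exact h.1
  rw [Pj_mul_Pj_of (k' := fun x => g x && k x) fun x hx => by rw [hx, Bool.true_and], hc.eq,
    Pj_mul_Pj_of (k' := fun _ => true) e, Pj_true, mul_one]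

end control

/-! #### Oracles and transformations of their inputs -/

/-- Every Boolean function is obtained from constants and variables by sums and products. -/
theorem boolFun_induction {m : ℕ} {P : ((Fin m → Bool) → Bool) → Prop}
    (h0 : P fun _ => false) (h1 : P fun _ => true) (hv : ∀ i, P fun x => x i)
    (hx : ∀ g h, P g → P h → P fun x => xor (g x) (h x))
    (ha : ∀ g h, P g → P h → P fun x => g x && h x) (g : (Fin m → Bool) → Bool) : P g := by
  have key : ∀ (n : ℕ) (e : Fin n → Fin m) (g : (Fin n → Bool) → Bool), P fun x => g (x ∘ e) := by
    intro n
    induction n with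
    | zero =>
      intro e g
      have : (fun x : Fin m → Bool => g (x ∘ e)) = fun _ => g ![] := by
        funext x
        exact congrArg g (Subsingleton.elim _ _)
      rw [this]
      cases g ![]
      · exact h0
      · exact h1
    | succ n ih =>
      intro e g
      have : (fun x : Fin m → Bool => g (x ∘ e)) = fun x =>
          xor (low g (x ∘ Fin.init e)) (x (e (Fin.last n)) && diff g (x ∘ Fin.init e)) := by
        funext x
        have hs : x ∘ e = Fin.snoc (α := fun _ => Bool) (x ∘ Fin.init e) (x (e (Fin.last n))) := by
          funext i
          refine Fin.lastCases ?_ (fun i => ?_) i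
          · simp
          · simp [Fin.init]
        rw [hs]
        cases x (e (Fin.last n)) <;> simp [low, diff]
      rw [this]
      exact hx _ _ (ih _ _) (ha _ _ (hv _) (ih _ _))
  exact key m (fun i => i) g

theorem CU_apply {n N : ℕ} {w : Fin n → Fin N} {y s : Fin N} {a : Fin n} (hy : w a ≠ y)
    (hs : w a ≠ s) (hys : y ≠ s) : CU w y s (fun x => x a) = T (w a) y s := by
  have h := C_conj_T (injective_four (castSucc_ne_last (w a)) (castSucc_ne hy) (castSucc_ne hs)
    (last_ne_castSucc y) (last_ne_castSucc s) (castSucc_ne hys))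
  have hz : ZEq (T (Fin.last N) y.castSucc s.castSucc) (lift 1) := by
    rw [lift_one]
    exact zEq_T y s
  rw [CU, U_apply, T_symm y.castSucc]
  refine (congrArg anc0 h).trans ?_
  rw [← lift_T, anc0_lift_mul, ← hz.eq_anc0, mul_one]

/-- The conjugation of a Toffoli gate by a controlled not is known both from `conjProd` for two
variables and from the identity `C_conj_T`; comparing the results identifies the oracle of a product
of bits with the Toffoli gate. -/
theorem U_and {n N : ℕ} {w : Fin n → Fin N} {s : Fin N} {a b : Fin n} (hab : w a ≠ w b)
    (hs : ∀ i, w i ≠ s) : U w s (fun x => x a && x b) = T (w a) (w b) s := by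
  refine lift_injective ?_
  have h := conjProd (fun x : Fin n → Bool => x a) (fun x => x b) _ (Fin.castSucc ∘ w) _ _
    (last_ne_castSucc s) castSucc_comp_ne_last (castSucc_comp_ne hs)
  have h' := C_conj_T (injective_four (castSucc_ne_last (w b)) (castSucc_ne hab.symm)
    (castSucc_ne (hs b)) (last_ne_castSucc (w a)) (last_ne_castSucc s) (castSucc_ne (hs a)))
  rw [CU_apply (castSucc_comp_ne_last a) (castSucc_comp_ne hs a) (last_ne_castSucc s), U_apply,
    T_symm _ (Fin.last N)] at h
  have e := h'.symm.trans h
  have hc : Commute (T (w b).castSucc (w a).castSucc s.castSucc)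
      (T (Fin.last N) (w a).castSucc s.castSucc) :=
    T_commute (castSucc_ne_last s) (castSucc_ne (hs a).symm) (castSucc_ne (hs b).symm)
      (castSucc_ne (hs a).symm)
  rw [hc.eq] at e
  have e' := congrArg (T (Fin.last N) (w a).castSucc s.castSucc * ·) e
  simp only [Function.comp_apply, ← mul_assoc, T_mul_self, one_mul] at e'
  rw [lift_U, ← e', lift_T, T_symm]

theorem CU_comp_of {n k : ℕ} {ι : Fin k → Fin n} {F : (Fin k → Bool) → Bool}
    (H : ∀ {N : ℕ} {u : Fin n → Fin N} {s : Fin N}, (∀ i, u i ≠ s) →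
      U u s (fun x => F (x ∘ ι)) = U (u ∘ ι) s F) {N : ℕ} {u : Fin n → Fin N} (y s : Fin N) :
    CU u y s (fun x => F (x ∘ ι)) = CU (u ∘ ι) y s F := by
  rw [CU, CU, H castSucc_comp_ne_last]
  rfl

/-- The recursion defining `U` follows the order of the inputs, so reindexing is not visible in it.
It is checked on constants and variables and passes to sums by additivity. For products, `conjProd`
expresses the oracle of `g · h` through oracles of the factors. No injectivity of `ι` is needed. -/
theorem U_comp {n k N : ℕ} {ι : Fin k → Fin n} (F : (Fin k → Bool) → Bool) {u : Fin n → Fin N}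
    {s : Fin N} (hs : ∀ i, u i ≠ s) : U u s (fun x => F (x ∘ ι)) = U (u ∘ ι) s F := by
  refine boolFun_induction (P := fun F => ∀ {N : ℕ} {u : Fin n → Fin N} {s : Fin N},
    (∀ i, u i ≠ s) → U u s (fun x => F (x ∘ ι)) = U (u ∘ ι) s F) ?_ ?_ ?_ ?_ ?_ F hs
  · intro N u s hs
    exact (U_false u s).trans (U_false _ s).symm
  · intro N u s hs
    exact (U_true u s).trans (U_true _ s).symm
  · intro i N u s hs
    exact (U_apply u s (ι i)).trans (U_apply (u ∘ ι) s i).symm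
  · intro g h hg hh N u s hs
    rw [← U_mul (w := u ∘ ι) _ _ fun i => hs (ι i), ← hg hs, ← hh hs, U_mul _ _ hs]
  · intro g h hg hh N u s hs
    refine lift_injective ?_
    have hs' := castSucc_comp_ne hs
    have hl := castSucc_comp_ne_last (w := u)
    have hc := conjProd (fun x => g (x ∘ ι)) (fun x => h (x ∘ ι)) _ (Fin.castSucc ∘ u) _ _
      (last_ne_castSucc s) hl hs'
    have hc' := conjProd g h _ ((Fin.castSucc ∘ u) ∘ ι) _ _ (last_ne_castSucc s)
      (fun i => hl (ι i)) (fun i => hs' (ι i))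
    rw [hh hl, CU_comp_of hg, hc'] at hc
    have e := congrArg (CU ((Fin.castSucc ∘ u) ∘ ι) (Fin.last N) s.castSucc g * ·) hc
    simp only [← mul_assoc] at e
    rw [CU_mul_self (w := (Fin.castSucc ∘ u) ∘ ι) _ (last_ne_castSucc s) (fun i => hs' (ι i)),
      one_mul, one_mul] at e
    rw [lift_U, lift_U]
    exact e.symm

/-- Add `F` of the bits `ι` to the bit `c`. -/
def upd {n k : ℕ} (ι : Fin k → Fin n) (c : Fin n) (F : (Fin k → Bool) → Bool) (x : Fin n → Bool) :
    Fin n → Bool :=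
  Function.update x c (xor (x c) (F (x ∘ ι)))

theorem upd_self {n k : ℕ} {ι : Fin k → Fin n} {c : Fin n} {F : (Fin k → Bool) → Bool}
    {x : Fin n → Bool} : upd ι c F x c = xor (x c) (F (x ∘ ι)) := Function.update_self ..

theorem upd_of_ne {n k : ℕ} {ι : Fin k → Fin n} {c i : Fin n} {F : (Fin k → Bool) → Bool}
    {x : Fin n → Bool} (h : i ≠ c) : upd ι c F x i = x i := Function.update_of_ne h ..

theorem CU_conj {n N k : ℕ} {w : Fin n → Fin N} {y s : Fin N} {v : Fin k → Fin N} {t : Fin N}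
    {F : (Fin k → Bool) → Bool} {g g' : (Fin n → Bool) → Bool} (ht : ∀ i, v i ≠ t)
    (hs : ∀ i, v i ≠ s) (hty : t ≠ y)
    (H : U (Fin.castSucc ∘ v) t.castSucc F * U (Fin.castSucc ∘ w) (Fin.last N) g *
      U (Fin.castSucc ∘ v) t.castSucc F = U (Fin.castSucc ∘ w) (Fin.last N) g') :
    U v t F * CU w y s g * U v t F = CU w y s g' := by
  have ht' := castSucc_comp_ne ht
  have hT : Commute (T y.castSucc (Fin.last N) s.castSucc) (U (Fin.castSucc ∘ v) t.castSucc F) :=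
    T_commute_U F (castSucc_comp_ne hs) (castSucc_ne hty) (castSucc_ne_last t)
  rw [CU, ← anc0_lift_mul, ← anc0_mul_lift, lift_U, conj_mul (U_mul_self F ht'),
    conj_mul (U_mul_self F ht'), conj_of_commute (U_mul_self F ht') hT.symm, H]
  rfl

/-- Oracles act on the inputs of oracles by addition. -/
theorem U_conj_U {n k N : ℕ} {u : Fin n → Fin N} {s : Fin N} {ι : Fin k → Fin n} {c : Fin n}
    (F : (Fin k → Bool) → Bool) (hu : Function.Injective u) (hc : ∀ i, ι i ≠ c)
    (hs : ∀ i, u i ≠ s) (h : (Fin n → Bool) → Bool) :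
    U (u ∘ ι) (u c) F * U u s h * U (u ∘ ι) (u c) F = U u s fun x => h (upd ι c F x) := by
  refine boolFun_induction (P := fun h => ∀ {N : ℕ} {u : Fin n → Fin N} {s : Fin N},
    Function.Injective u → (∀ i, u i ≠ s) →
      U (u ∘ ι) (u c) F * U u s h * U (u ∘ ι) (u c) F = U u s fun x => h (upd ι c F x))
    ?_ ?_ ?_ ?_ ?_ h hu hs
  all_goals clear hu hs
  · intro N u s hu hs
    have hne : ∀ i, (u ∘ ι) i ≠ u c := fun i => hu.ne (hc i)
    have hF := U_mul_self F hne
    exact ((congrArg (fun X => _ * X * _) (U_false u s)).trans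
      ((congrArg (· * _) (mul_one _)).trans hF)).trans (U_false u s).symm
  · intro N u s hu hs
    have hne : ∀ i, (u ∘ ι) i ≠ u c := fun i => hu.ne (hc i)
    have hF := U_mul_self F hne
    refine ((congrArg (fun X => _ * X * _) (U_true u s)).trans ?_).trans (U_true u s).symm
    exact conj_of_commute hF (X_commute_U F fun i => hs _).symm
  · intro i N u s hu hs
    have hne : ∀ i, (u ∘ ι) i ≠ u c := fun i => hu.ne (hc i)
    have hF := U_mul_self F hne
    rw [U_apply]
    rcases eq_or_ne i c with rfl | hi
    · simp only [upd_self]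
      rw [← U_mul _ _ hs, U_comp F hs, U_apply,
        U_conj_C F (hs i) hne (fun j => hs _)]
    · simp only [upd_of_ne hi]
      rw [U_apply]
      exact conj_of_commute hF (C_commute_U (w := u ∘ ι) F (fun j => hs _) (hu.ne hi.symm)).symm
  · intro g h hg hh N u s hu hs
    have hne : ∀ i, (u ∘ ι) i ≠ u c := fun i => hu.ne (hc i)
    have hF := U_mul_self F hne
    rw [← U_mul _ _ hs, conj_mul hF, hg hu hs, hh hu hs, U_mul _ _ hs]
  · intro g h hg hh N u s hu hs
    refine lift_injective ?_
    have hu' := (Fin.castSucc_injective N).comp hu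
    have hs' := castSucc_comp_ne hs
    have hl := castSucc_comp_ne_last (w := u)
    have hne : ∀ i, ((Fin.castSucc ∘ u) ∘ ι) i ≠ (Fin.castSucc ∘ u) c := fun i => hu'.ne (hc i)
    have hF := U_mul_self F hne
    -- The oracle of the product is isolated in the identity of `conjProd`. Conjugating that
    -- identity by the oracle of `F` and comparing with the identity for the substituted functions
    -- gives the claim.
    have hp := conjProd g h _ (Fin.castSucc ∘ u) _ _ (last_ne_castSucc s) hl hs'
    have hp' := conjProd (fun x => g (upd ι c F x)) (fun x => h (upd ι c F x)) _
      (Fin.castSucc ∘ u) _ _ (last_ne_castSucc s) hl hs'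
    have hCU := CU_conj (s := s.castSucc) hne (fun i => hs' (ι i)) (hl c)
      (hg ((Fin.castSucc_injective (N + 1)).comp hu') castSucc_comp_ne_last)
    have e := congrArg (fun X => U ((Fin.castSucc ∘ u) ∘ ι) ((Fin.castSucc ∘ u) c) F * X *
      U ((Fin.castSucc ∘ u) ∘ ι) ((Fin.castSucc ∘ u) c) F) hp
    simp only [conj_mul hF] at e
    rw [hh hu' hl, hCU, hp'] at e
    have e' := congrArg (CU (Fin.castSucc ∘ u) (Fin.last N) s.castSucc
      (fun x => g (upd ι c F x)) * ·) e
    simp only [← mul_assoc] at e'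
    rw [CU_mul_self _ (last_ne_castSucc s) hs', one_mul, one_mul] at e'
    rw [lift_U, e', lift_mul, lift_mul, lift_U, lift_U]
    rfl

theorem T_conj_U {n N : ℕ} {w : Fin n → Fin N} {s : Fin N} {a b c : Fin n}
    (hw : Function.Injective w) (hab : a ≠ b) (hac : a ≠ c) (hbc : b ≠ c) (hs : ∀ i, w i ≠ s)
    (h : (Fin n → Bool) → Bool) :
    T (w a) (w b) (w c) * U w s h * T (w a) (w b) (w c) =
      U w s fun x => h (upd ![a, b] c (fun y => y 0 && y 1) x) := by
  have hc : ∀ i, ![a, b] i ≠ c := Fin.forall_fin_two.2 ⟨hac, hbc⟩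
  have e := U_and (w := w ∘ ![a, b]) (a := 0) (b := 1) (s := w c) (hw.ne hab)
    fun i => hw.ne (hc i)
  have e' : U (w ∘ ![a, b]) (w c) (fun x => x 0 && x 1) = T (w a) (w b) (w c) := e
  rw [← e']
  exact U_conj_U _ hw hc hs h

/-- An input ended with `⟨1|` turns the controlled oracle of `diff h` into the plain one, and `low h
+ diff h` is `h` with its last argument set to true. -/
theorem U_snoc_removeBit_true {n N : ℕ} {w : Fin n → Fin N} {s : Fin N}
    {v : Fin (n + 1) → Fin (N + 1)} (hv : ∀ i : Fin n, v i.castSucc = (w i).castSucc)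
    (hv' : v (Fin.last n) = Fin.last N) (hs : ∀ i, w i ≠ s) (h : (Fin (n + 1) → Bool) → Bool) :
    U v s.castSucc h ≫ removeBit true N =
      removeBit true N ≫ U w s fun x => h (Fin.snoc (α := fun _ => Bool) x true) := by
  have hi : Fin.init v = Fin.castSucc ∘ w := funext hv
  have e : (fun x => h (Fin.snoc (α := fun _ => Bool) x true)) =
      fun x => xor (low h x) (diff h x) := by
    funext x
    simp [low, diff]
  rw [U_succ, hi, hv', mul_comp, CU_removeBit_true _ hs, ← lift_U, ← Category.assoc,
    lift_comp_removeBit, Category.assoc, ← mul_def, U_mul _ _ hs, e]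

/-! #### Properties of the outputs of a map -/

theorem Pj_comp {n k N : ℕ} {ι : Fin k → Fin n} (g : (Fin k → Bool) → Bool) (u : Fin n → Fin N) :
    Pj u (fun x => g (x ∘ ι)) = Pj (u ∘ ι) g := by
  rw [Pj, U_comp g castSucc_comp_ne_last]
  rfl

/-- Every output of the map `A` has the property `g`. -/
def Sat {k N : ℕ} (A : H k N) (g : (Fin N → Bool) → Bool) : Prop := A ≫ Pj id g = A

theorem Sat.and {k N : ℕ} {A : H k N} {g g' : (Fin N → Bool) → Bool} (h : Sat A g)
    (h' : Sat A g') : Sat A fun x => g x && g' x := by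
  rw [Sat, ← Pj_mul_Pj, comp_mul, h.symm.symm, h'.symm.symm]

theorem Sat.mono {k N : ℕ} {A : H k N} {g g' : (Fin N → Bool) → Bool} (h : Sat A g)
    (h' : ∀ x, g x = true → g' x = true) : Sat A g' := by
  have e : Pj id g * Pj id g' = Pj (N := N) id g := by
    rw [Pj_mul_Pj_of (k' := fun _ => true) h', Pj_true, mul_one]
  calc A ≫ Pj id g' = (A ≫ Pj id g) ≫ Pj id g' := congrArg (· ≫ _) h.symm
    _ = A ≫ Pj id g := by rw [Category.assoc, ← mul_def, e]
    _ = A := h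

theorem Sat.comp_Pj {k p N : ℕ} {A : H k N} {g : (Fin N → Bool) → Bool} (h : Sat A g)
    {w : Fin p → Fin N} {e : (Fin p → Bool) → Bool} (h' : ∀ z, g z = true → e (z ∘ w) = true) :
    A ≫ Pj w e = A := by
  have := h.mono (g' := fun z => e (z ∘ w)) h'
  rwa [Sat, Pj_comp e id] at this

/-- Oracles which agree on the outputs of a map agree after that map. -/
theorem Sat.comp_U_congr {k p q N : ℕ} {A : H k N} {g : (Fin N → Bool) → Bool} (h : Sat A g)
    {w₁ : Fin p → Fin N} {w₂ : Fin q → Fin N} {s : Fin N} {k₁ : (Fin p → Bool) → Bool}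
    {k₂ : (Fin q → Bool) → Bool} (h₁ : ∀ i, w₁ i ≠ s) (h₂ : ∀ i, w₂ i ≠ s)
    (hk : ∀ z, g z = true → k₁ (z ∘ w₁) = k₂ (z ∘ w₂)) : A ≫ U w₁ s k₁ = A ≫ U w₂ s k₂ := by
  -- Both oracles are read as functions of the concatenated list of wires, where repetitions do no
  -- harm. Their difference is an oracle which vanishes under the projection to equal values.
  have hs : ∀ i, Fin.append w₁ w₂ i ≠ s := fun i =>
    Fin.addCases (fun i => by rw [Fin.append_left]; exact h₁ i)
      (fun i => by rw [Fin.append_right]; exact h₂ i) i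
  have e₁ : Fin.append w₁ w₂ ∘ Fin.castAdd q = w₁ := funext fun i => Fin.append_left _ _ _
  have e₂ : Fin.append w₁ w₂ ∘ Fin.natAdd p = w₂ := funext fun i => Fin.append_right _ _ _
  have u₁ := U_comp (ι := Fin.castAdd q) k₁ hs
  have u₂ := U_comp (ι := Fin.natAdd p) k₂ hs
  rw [e₁] at u₁
  rw [e₂] at u₂
  have hx := U_mul (fun x => xor (k₁ (x ∘ Fin.castAdd q)) (k₂ (x ∘ Fin.natAdd p)))
    (fun x => k₂ (x ∘ Fin.natAdd p)) hs
  have hP := h.comp_Pj (w := Fin.append w₁ w₂)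
    (e := fun x => !xor (k₁ (x ∘ Fin.castAdd q)) (k₂ (x ∘ Fin.natAdd p))) fun z hz => by
      have := hk z hz
      rw [Function.comp_assoc, Function.comp_assoc, e₁, e₂, this, Bool.xor_self, Bool.not_false]
  have hU := Pj_mul_U (g := fun x => !xor (k₁ (x ∘ Fin.castAdd q)) (k₂ (x ∘ Fin.natAdd p)))
    (k := fun x => xor (k₁ (x ∘ Fin.castAdd q)) (k₂ (x ∘ Fin.natAdd p))) (k' := fun _ => false)
    hs fun x hx => by simpa using hx
  rw [U_false, mul_one] at hU
  simp only [Bool.xor_assoc, Bool.xor_self, Bool.xor_false] at hx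
  rw [← u₁, ← u₂, ← hx, comp_mul]
  congr 1
  rw [← hP, Category.assoc, ← mul_def, hU]

theorem U_conj_Pj {k N : ℕ} {w : Fin k → Fin N} {s : Fin N} (F : (Fin k → Bool) → Bool)
    (hs : ∀ i, w i ≠ s) (g : (Fin N → Bool) → Bool) :
    U w s F * Pj id g * U w s F = Pj id fun z => g (upd w s F z) := by
  have h := U_conj_U (u := Fin.castSucc) (s := Fin.last N) F (Fin.castSucc_injective N) hs
    castSucc_ne_last g
  have hU := lift_U w s F
  rw [← hU] at h
  rw [Pj, Pj]
  simp only [Function.comp_id]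
  rw [← h, mul_def, mul_def, mul_def, mul_def, ← Category.assoc, ← addBit_comp_lift]
  simp only [Category.assoc, lift_comp_removeBit]

/-- The oracle is an involution, so conjugating the projection by it pulls `g` back along the
oracle's own action. -/
theorem Sat.comp_U {k p N : ℕ} {A : H k N} {g : (Fin N → Bool) → Bool} (h : Sat A g)
    {w : Fin p → Fin N} {s : Fin N} (F : (Fin p → Bool) → Bool) (hs : ∀ i, w i ≠ s) :
    Sat (A ≫ U w s F) fun z => g (upd w s F z) := by
  rw [Sat, ← U_conj_Pj F hs, ← comp_mul, ← mul_assoc, ← mul_assoc, U_mul_self F hs, one_mul,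
    mul_def, ← Category.assoc, h.symm.symm]

theorem sat_Pj {N : ℕ} (g : (Fin N → Bool) → Bool) : Sat (Pj id g) g := by
  rw [Sat, ← mul_def, Pj_mul_Pj]
  simp

/-- Two fresh zero wires are interchangeable, so the control may be taken to be the last wire, where
a zero control is known to be trivial. -/
theorem addBit_false_addBit_false_C (N : ℕ) :
    addBit false N ≫ addBit false (N + 1) ≫ C (Fin.last N).castSucc (Fin.last (N + 1)) =
      addBit false N ≫ addBit false (N + 1) := by
  have h := swapLast_conj (C (Fin.last N).castSucc (Fin.last (N + 1)))
  rw [map_C (Equiv.injective _), Equiv.swap_apply_left, Equiv.swap_apply_right] at h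
  have e : addBit false N ≫ addBit false (N + 1) ≫ swapLast N =
      addBit false N ≫ addBit false (N + 1) := by
    rw [addBit_comp_swapLast, addBit_comp_lift]
  have e' : swapLast N * C (Fin.last N).castSucc (Fin.last (N + 1)) =
      C (Fin.last (N + 1)) (Fin.last N).castSucc * swapLast N := by
    rw [← h, mul_assoc, swapLast_swapLast, mul_one]
  calc _ = (addBit false N ≫ addBit false (N + 1) ≫ swapLast N) ≫
        C (Fin.last N).castSucc (Fin.last (N + 1)) := by rw [e, Category.assoc]
    _ = addBit false N ≫ (addBit false (N + 1) ≫ C (Fin.last (N + 1)) (Fin.last N).castSucc) ≫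
        swapLast N := by
      simp only [Category.assoc]
      rw [← mul_def, e', mul_def]
    _ = _ := by rw [addBit_false_C, e]

theorem sat_addBit_false (N : ℕ) : Sat (addBit false N) fun z => !z (Fin.last N) := by
  have e : (fun z : Fin (N + 1) → Bool => !z (Fin.last N)) =
      fun z => xor (z (Fin.last N)) true := by
    funext z
    rw [Bool.xor_true]
  have hU := U_mul (w := Fin.castSucc) (s := Fin.last (N + 1))
    (fun z : Fin (N + 1) → Bool => z (Fin.last N)) (fun _ => true) castSucc_ne_last
  rw [U_true, U_apply] at hU
  rw [Sat, Pj, e, Function.comp_id, ← hU, mul_def]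
  have h := addBit_false_addBit_false_C N
  calc _ = (addBit false N ≫ addBit false (N + 1) ≫
        C (Fin.last N).castSucc (Fin.last (N + 1))) ≫ X (Fin.last (N + 1)) ≫
        removeBit true (N + 1) := by simp only [Category.assoc]
    _ = addBit false N ≫ (addBit false (N + 1) ≫ X (Fin.last (N + 1))) ≫
        removeBit true (N + 1) := by rw [h]; simp only [Category.assoc]
    _ = addBit false N := by
      rw [addBit_X, Bool.not_false, addBit_comp_removeBit]
      exact Category.comp_id _

theorem lift_Pj_id {N : ℕ} (g : (Fin N → Bool) → Bool) :
    lift (Pj id g) = Pj id fun z => g (Fin.init z) := by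
  rw [lift_Pj]
  exact (Pj_comp (ι := Fin.castSucc) g id).symm

theorem Sat.comp_addBit_false {k N : ℕ} {A : H k N} {g : (Fin N → Bool) → Bool} (h : Sat A g) :
    Sat (A ≫ addBit false N) fun z => g (Fin.init z) && !z (Fin.last N) := by
  refine Sat.and ?_ ?_
  · rw [Sat, ← lift_Pj_id, Category.assoc, addBit_comp_lift, ← Category.assoc, h.symm.symm]
  · rw [Sat, Category.assoc, (sat_addBit_false N).symm.symm]

/-! #### Graphs of Boolean functions -/

/-- On the inputs `x` with `d x`, add the bits `φ x` after `x`. -/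
noncomputable def graph {n : ℕ} (d : (Fin n → Bool) → Bool) :
    (m : ℕ) → ((Fin n → Bool) → Fin m → Bool) → H n (n + m)
  | 0, _ => Pj (N := n) id d
  | m + 1, φ => graph d m (fun x => Fin.init (φ x)) ≫ addBit false (n + m) ≫
      U (Fin.castAdd (m + 1)) (Fin.last (n + m)) fun x => φ x (Fin.last m)

section graph

variable {n : ℕ} {d : (Fin n → Bool) → Bool}

theorem graph_succ (m : ℕ) (φ : (Fin n → Bool) → Fin (m + 1) → Bool) :
    graph d (m + 1) φ = graph d m (fun x => Fin.init (φ x)) ≫ addBit false (n + m) ≫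
      U (Fin.castAdd (m + 1)) (Fin.last (n + m)) fun x => φ x (Fin.last m) := rfl

theorem castAdd_ne_natAdd {n m : ℕ} (i : Fin n) (j : Fin m) :
    Fin.castAdd m i ≠ Fin.natAdd n j := by
  intro h
  have := congrArg Fin.val h
  simp only [Fin.val_castAdd, Fin.val_natAdd] at this
  omega

/-- A fresh wire satisfies `z = 0`; the oracle changes this into `z + φ = 0`, which says that the
wire holds the value of `φ`. The inputs are kept, so the other conditions persist. -/
theorem sat_graph : ∀ (m : ℕ) (φ : (Fin n → Bool) → Fin m → Bool), Sat (graph d m φ) fun z =>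
    d (z ∘ Fin.castAdd m) && decide (z ∘ Fin.natAdd n = φ (z ∘ Fin.castAdd m))
  | 0, φ => by
    refine Sat.mono (sat_Pj d) fun z hz => ?_
    rw [Bool.and_eq_true, decide_eq_true_iff]
    exact ⟨hz, Subsingleton.elim _ _⟩
  | m + 1, φ => by
    have hc : ∀ i, Fin.castAdd (m + 1) i ≠ Fin.last (n + m) := fun i =>
      castAdd_ne_natAdd i (Fin.last m)
    have h := ((sat_graph m fun x => Fin.init (φ x)).comp_addBit_false).comp_U
      (fun x => φ x (Fin.last m)) hc
    rw [graph_succ, ← Category.assoc]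
    refine h.mono fun z hz => ?_
    have hi : Fin.init (upd (Fin.castAdd (m + 1)) (Fin.last (n + m)) (fun x => φ x (Fin.last m)) z) =
        Fin.init z := funext fun i => upd_of_ne (castSucc_ne_last i)
    rw [hi, upd_self] at hz
    simp only [Bool.and_eq_true, decide_eq_true_iff, Bool.not_eq_true', bne_eq_false_iff_eq] at hz ⊢
    obtain ⟨⟨h1, h2⟩, h3⟩ := hz
    refine ⟨h1, funext fun j => ?_⟩
    refine Fin.lastCases ?_ (fun j => ?_) j
    · exact h3
    · exact congrFun h2 j

theorem castAdd_ne_last {n m : ℕ} (i : Fin n) : Fin.castAdd (m + 1) i ≠ Fin.last (n + m) :=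
  castAdd_ne_natAdd i (Fin.last m)

/-- The states before each oracle satisfy `d`, so that oracle may be replaced by one which agrees
with it on `d`. -/
theorem graph_congr : ∀ (m : ℕ) {φ φ' : (Fin n → Bool) → Fin m → Bool},
    (∀ x, d x = true → φ x = φ' x) → graph d m φ = graph d m φ'
  | 0, _, _, _ => rfl
  | m + 1, φ, φ', h => by
    rw [graph_succ, graph_succ, graph_congr m (fun x hx => congrArg Fin.init (h x hx)),
      ← Category.assoc, ← Category.assoc]
    refine ((sat_graph m _).comp_addBit_false).comp_U_congr castAdd_ne_last castAdd_ne_last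
      fun z hz => ?_
    simp only [Bool.and_eq_true] at hz
    exact congrFun (h _ hz.1.1) _

theorem graph_comp_Pj (e : (Fin n → Bool) → Bool) : ∀ (m : ℕ) (φ : (Fin n → Bool) → Fin m → Bool),
    graph d m φ ≫ Pj (Fin.castAdd m) e = graph (fun x => d x && e x) m φ
  | 0, _ => Pj_mul_Pj d e
  | m + 1, φ => by
    rw [graph_succ, graph_succ, ← graph_comp_Pj e m, Category.assoc, Category.assoc, Category.assoc,
      ← mul_def, ← (Pj_commute_U _ _ castAdd_ne_last).eq, mul_def, ← Category.assoc (addBit _ _)]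
    have : Pj (Fin.castAdd (m + 1)) e = lift (Pj (Fin.castAdd m) e) := by
      rw [lift_Pj]
      rfl
    rw [this, addBit_comp_lift, Category.assoc]

theorem graph_comp_U (G : (Fin n → Bool) → Bool) : ∀ (m : ℕ) (φ : (Fin n → Bool) → Fin m → Bool)
    (k : Fin m), graph d m φ ≫ U (Fin.castAdd m) (Fin.natAdd n k) G =
      graph d m fun x => Function.update (φ x) k (xor (φ x k) (G x))
  | m + 1, φ, k => by
    induction k using Fin.lastCases with
    | last =>
      have := U_mul (w := Fin.castAdd (m + 1)) (s := Fin.last (n + m)) (fun x => φ x (Fin.last m)) G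
        castAdd_ne_last
      rw [graph_succ, graph_succ, Category.assoc, Category.assoc]
      simp only [Function.update_self, ← this, mul_def]
      congr 2
      funext x j
      exact (Function.update_of_ne (castSucc_ne_last j) _ _).symm
    | cast k =>
      have hU : U (Fin.castAdd (m + 1)) (Fin.natAdd n k.castSucc) G =
          lift (U (Fin.castAdd m) (Fin.natAdd n k) G) := by
        rw [lift_U]
        rfl
      have hc := U_commute_U (w := Fin.castAdd (m + 1)) (v := Fin.castAdd (m + 1))
        (s := Fin.natAdd n k.castSucc) (t := Fin.last (n + m)) G (fun x => φ x (Fin.last m))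
        castAdd_ne_last (fun i => castAdd_ne_natAdd _ _)
      rw [graph_succ, graph_succ, Category.assoc, Category.assoc, ← mul_def, ← hc.eq, mul_def, hU,
        ← Category.assoc (addBit _ _), addBit_comp_lift, Category.assoc, ← Category.assoc,
        graph_comp_U G m]
      congr 1
      · congr 2
        funext x
        rw [Fin.init_update_castSucc]
        rfl
      · congr 1
        congr 1
        funext x
        exact (Function.update_of_ne (castSucc_ne_last k).symm _ _).symm

/-- The action of the Toffoli gate on lists of bits. -/
abbrev toffoli {n : ℕ} (a b c : Fin n) : (Fin n → Bool) → Fin n → Bool :=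
  upd ![a, b] c fun y => y 0 && y 1

theorem T_eq_U {N : ℕ} {a b c : Fin N} (hab : a ≠ b) (hac : a ≠ c) (hbc : b ≠ c) :
    T a b c = U ![a, b] c fun y => y 0 && y 1 :=
  (U_and (w := ![a, b]) (a := 0) (b := 1) hab (Fin.forall_fin_two.2 ⟨hac, hbc⟩)).symm

/-- The gate reads output bits which are known functions of the inputs that were kept. It can
therefore be traded for an oracle on the inputs, which merges with the oracle that wrote the target
wire. -/
theorem graph_comp_T {m : ℕ} {i j k : Fin m} (hij : i ≠ j) (hik : i ≠ k) (hjk : j ≠ k)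
    (φ : (Fin n → Bool) → Fin m → Bool) :
    graph d m φ ≫ T (Fin.natAdd n i) (Fin.natAdd n j) (Fin.natAdd n k) =
      graph d m fun x => toffoli i j k (φ x) := by
  have hinj := Fin.natAdd_injective m n
  rw [T_eq_U (hinj.ne hij) (hinj.ne hik) (hinj.ne hjk),
    (sat_graph m φ).comp_U_congr (w₂ := Fin.castAdd m) (k₂ := fun x => φ x i && φ x j)
      (Fin.forall_fin_two.2 ⟨hinj.ne hik, hinj.ne hjk⟩) (fun i => castAdd_ne_natAdd _ _),
    graph_comp_U]
  · rfl
  · intro z hz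
    rw [Bool.and_eq_true, decide_eq_true_iff] at hz
    rw [← hz.2]
    rfl

theorem graph_comp_addBit_true {m : ℕ} (φ : (Fin n → Bool) → Fin m → Bool) :
    graph d m φ ≫ addBit true (n + m) =
      graph d (m + 1) fun x => Fin.snoc (α := fun _ => Bool) (φ x) true := by
  rw [graph_succ]
  simp only [Fin.snoc_last, Fin.init_snoc]
  rw [U_true, addBit_X, Bool.not_false]

/-- A fresh zero, an oracle and `⟨1|` on the same wire are by definition a projection, which shrinks
the domain. -/
theorem graph_comp_removeBit_true {m : ℕ} (φ : (Fin n → Bool) → Fin (m + 1) → Bool) :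
    graph d (m + 1) φ ≫ removeBit true (n + m) =
      graph (fun x => d x && φ x (Fin.last m)) m fun x => Fin.init (φ x) := by
  rw [graph_succ, ← graph_comp_Pj, Pj]
  simp only [Category.assoc]
  rfl

end graph

/-! #### Adding several functions of the same wires -/

/-- Add the bits `ψ` of the wires `v` to the wires `t`. -/
noncomputable def adds {m N : ℕ} (v : Fin m → Fin N) : {n : ℕ} → (Fin n → Fin N) →
    ((Fin m → Bool) → Fin n → Bool) → H N N
  | 0, _, _ => 1
  | n + 1, t, ψ => adds v (Fin.init t) (fun x => Fin.init (ψ x)) *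
      U v (t (Fin.last n)) fun x => ψ x (Fin.last n)

section adds

variable {m : ℕ}

theorem adds_succ {n N : ℕ} (v : Fin m → Fin N) (t : Fin (n + 1) → Fin N)
    (ψ : (Fin m → Bool) → Fin (n + 1) → Bool) :
    adds v t ψ = adds v (Fin.init t) (fun x => Fin.init (ψ x)) *
      U v (t (Fin.last n)) fun x => ψ x (Fin.last n) := rfl

theorem lift_adds {N : ℕ} (v : Fin m → Fin N) : ∀ {n : ℕ} (t : Fin n → Fin N)
    (ψ : (Fin m → Bool) → Fin n → Bool),
    lift (adds v t ψ) = adds (Fin.castSucc ∘ v) (Fin.castSucc ∘ t) ψ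
  | 0, _, _ => lift_one N
  | n + 1, t, ψ => by
    rw [adds_succ, lift_mul, lift_adds v, lift_U]
    rfl

theorem adds_comp {k N : ℕ} {ι : Fin k → Fin m} {v : Fin m → Fin N} :
    ∀ {n : ℕ} {t : Fin n → Fin N} (_ : ∀ i j, v i ≠ t j) (ψ : (Fin k → Bool) → Fin n → Bool),
      adds v t (fun x => ψ (x ∘ ι)) = adds (v ∘ ι) t ψ
  | 0, _, _, _ => rfl
  | n + 1, t, ht, ψ => by
    rw [adds_succ, adds_succ, U_comp (ι := ι) (fun x => ψ x (Fin.last n)) fun i => ht i _]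
    exact congrArg (· * _) (adds_comp (t := Fin.init t) (fun i j => ht i _)
      fun x => Fin.init (ψ x))

theorem T_mul_adds {N : ℕ} {v : Fin m → Fin N} (hv : Function.Injective v) {a b c : Fin m}
    (hab : a ≠ b) (hac : a ≠ c) (hbc : b ≠ c) :
    ∀ {n : ℕ} {t : Fin n → Fin N} (_ : ∀ i j, v i ≠ t j) (ψ : (Fin m → Bool) → Fin n → Bool),
      adds v t ψ * T (v a) (v b) (v c) =
        T (v a) (v b) (v c) * adds v t fun x => ψ (toffoli a b c x)
  | 0, _, _, _ => (one_mul _).trans (mul_one _).symm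
  | n + 1, t, ht, ψ => by
    have h := T_conj_U hv hab hac hbc (fun i => ht i (Fin.last n)) fun x => ψ x (Fin.last n)
    have h' : U v (t (Fin.last n)) (fun x => ψ x (Fin.last n)) * T (v a) (v b) (v c) =
        T (v a) (v b) (v c) * U v (t (Fin.last n)) fun x => ψ (toffoli a b c x) (Fin.last n) := by
      rw [← h, ← mul_assoc, ← mul_assoc, T_mul_self, one_mul]
    rw [adds_succ, adds_succ, mul_assoc, h', ← mul_assoc, ← mul_assoc,
      T_mul_adds hv hab hac hbc (t := Fin.init t) fun i j => ht i j.castSucc]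

theorem adds_snoc_removeBit_true {N : ℕ} {v : Fin m → Fin N} {v' : Fin (m + 1) → Fin (N + 1)}
    (hv : ∀ i : Fin m, v' i.castSucc = (v i).castSucc) (hv' : v' (Fin.last m) = Fin.last N) :
    ∀ {n : ℕ} {t : Fin n → Fin N} (_ : ∀ i j, v i ≠ t j) (ψ : (Fin (m + 1) → Bool) → Fin n → Bool),
      adds v' (Fin.castSucc ∘ t) ψ ≫ removeBit true N =
        removeBit true N ≫ adds v t fun x => ψ (Fin.snoc (α := fun _ => Bool) x true)
  | 0, _, _, _ => (Category.id_comp _).trans (Category.comp_id _).symm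
  | n + 1, t, ht, ψ => by
    rw [adds_succ, adds_succ, mul_comp, Function.comp_apply,
      U_snoc_removeBit_true hv hv' (fun i => ht i (Fin.last n)), ← Category.assoc]
    have := adds_snoc_removeBit_true hv hv' (t := Fin.init t) (fun i j => ht i _)
      fun x => Fin.init (ψ x)
    rw [show Fin.init (Fin.castSucc ∘ t) = Fin.castSucc ∘ Fin.init t from rfl, this,
      Category.assoc, ← mul_def]

/-- Functions which agree on the outputs of a map are added with the same result. -/
theorem Sat.comp_adds_congr {k N : ℕ} {v : Fin m → Fin N} {A : H k N} {g : (Fin m → Bool) → Bool}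
    (h : Sat A fun z => g (z ∘ v)) :
    ∀ {n : ℕ} {t : Fin n → Fin N} (_ : ∀ i j, v i ≠ t j) {ψ ψ' : (Fin m → Bool) → Fin n → Bool}
      (_ : ∀ y, g y = true → ψ y = ψ' y), A ≫ adds v t ψ = A ≫ adds v t ψ' ∧
        Sat (A ≫ adds v t ψ) fun z => g (z ∘ v)
  | 0, _, _, _, _, _ => ⟨rfl, by
      have : A ≫ (1 : H N N) = A := Category.comp_id A
      rwa [adds, this]⟩
  | n + 1, t, ht, ψ, ψ', hψ => by
    obtain ⟨h1, h2⟩ := h.comp_adds_congr (t := Fin.init t) (fun i j => ht i _)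
      (ψ := fun x => Fin.init (ψ x)) (ψ' := fun x => Fin.init (ψ' x))
      fun y hy => congrArg Fin.init (hψ y hy)
    have ht' : ∀ i, v i ≠ t (Fin.last n) := fun i => ht i _
    constructor
    · rw [adds_succ, adds_succ, comp_mul, comp_mul, ← h1]
      exact h2.comp_U_congr ht' ht' fun z hz => congrFun (hψ _ hz) _
    · rw [adds_succ, comp_mul]
      refine (h2.comp_U (fun x => ψ x (Fin.last n)) ht').mono fun z hz => ?_
      have : upd v (t (Fin.last n)) (fun x => ψ x (Fin.last n)) z ∘ v = z ∘ v :=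
        funext fun i => upd_of_ne (ht' i)
      rwa [this] at hz

end adds

/-! #### Normal forms -/

/-- End all wires with zeros. -/
def killAll : (n : ℕ) → H n 0
  | 0 => 1
  | n + 1 => removeBit false n ≫ killAll n

/-- End the first `n` wires with zeros. -/
def kill (n : ℕ) : (m : ℕ) → H (n + m) m
  | 0 => killAll n
  | m + 1 => lift (kill n m)

theorem kill_succ (n m : ℕ) : kill n (m + 1) = lift (kill n m) := rfl

theorem kill_eq (n : ℕ) : ∀ m, kill n m = tens (killAll n) (one m) ≫ strands (zero_add m)
  | 0 => by
    rw [tens_one_zero]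
    exact (Category.comp_id _).symm
  | m + 1 => by
    have h : lift (strands (zero_add m)) = strands (zero_add (m + 1)) :=
      sound (wire_tensor (zero_add m) (rfl : 1 = 1))
    rw [kill_succ, kill_eq n m, lift_comp, h, lift, tens_assoc_one, tens_one]

theorem map_comp_kill {m : ℕ} (n : ℕ) (V : H m m) :
    map (Fin.natAdd n) V ≫ kill n m = kill n m ≫ V := by
  have h : (tens (one n) V) ≫ tens (killAll n) (one m) =
      tens (killAll n) (one m) ≫ (tens (one 0) V) := by
    rw [← tens_comp, ← tens_comp]
    simp only [Category.id_comp, Category.comp_id]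
  rw [← one_tens_eq_map, kill_eq, ← Category.assoc, h, Category.assoc, Category.assoc,
    one_zero_tens]

theorem kill_succ_comp_removeBit_true (n m : ℕ) :
    kill n (m + 1) ≫ removeBit true m = removeBit true (n + m) ≫ kill n m := by
  rw [kill_succ]
  exact lift_comp_removeBit true _

theorem kill_comp_addBit_true (n m : ℕ) :
    kill n m ≫ addBit true m = addBit true (n + m) ≫ kill n (m + 1) := by
  rw [kill_succ]
  exact (addBit_comp_lift true _).symm

/-- The map which computes `φ` on the inputs with `d`, uses `ψ` to erase the inputs, and ends the
erased wires with zeros. -/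
noncomputable def normal {n m : ℕ} (d : (Fin n → Bool) → Bool)
    (φ : (Fin n → Bool) → Fin m → Bool) (ψ : (Fin m → Bool) → Fin n → Bool) : H n m :=
  graph d m φ ≫ adds (Fin.natAdd n) (Fin.castAdd m) ψ ≫ kill n m

section normal

variable {n m : ℕ} {d : (Fin n → Bool) → Bool} {φ : (Fin n → Bool) → Fin m → Bool}
  {ψ : (Fin m → Bool) → Fin n → Bool}

theorem natAdd_ne_castAdd {n m : ℕ} (j : Fin m) (i : Fin n) : Fin.natAdd n j ≠ Fin.castAdd m i :=
  (castAdd_ne_natAdd i j).symm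

/-- The output wires only hold values in `φ(d)`, so changing `ψ` elsewhere has no effect on the
erasure of the inputs. -/
theorem normal_congr {d' : (Fin n → Bool) → Bool} {φ' : (Fin n → Bool) → Fin m → Bool}
    {ψ' : (Fin m → Bool) → Fin n → Bool} (hd : d = d') (hφ : ∀ x, d x = true → φ x = φ' x)
    (hψ : ∀ x, d x = true → ψ (φ x) = ψ' (φ x)) : normal d φ ψ = normal d' φ' ψ' := by
  classical
  subst hd
  rw [normal, normal, ← graph_congr m hφ, ← Category.assoc, ← Category.assoc]
  congr 1
  refine (Sat.comp_adds_congr (g := fun y => decide (∃ x, d x = true ∧ φ x = y))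
    ((sat_graph m φ).mono fun z hz => ?_) natAdd_ne_castAdd fun y hy => ?_).1
  · rw [Bool.and_eq_true, decide_eq_true_iff] at hz
    exact decide_eq_true ⟨_, hz.1, hz.2.symm⟩
  · obtain ⟨x, hx, rfl⟩ := of_decide_eq_true hy
    exact hψ x hx

/-- The gate slides leftwards past the effects on the erased wires, then past the erasure, where it
substitutes into `ψ`, and is finally absorbed by the graph of `φ`. -/
theorem normal_comp_T {i j k : Fin m} (hij : i ≠ j) (hik : i ≠ k) (hjk : j ≠ k) :
    normal d φ ψ ≫ T i j k =
      normal d (fun x => toffoli i j k (φ x)) fun y => ψ (toffoli i j k y) := by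
  have hinj := Fin.natAdd_injective m n
  rw [normal, Category.assoc, Category.assoc, ← map_comp_kill n, map_T hinj, ← Category.assoc (adds _ _ _),
    ← mul_def, T_mul_adds hinj hij hik hjk natAdd_ne_castAdd, mul_def, Category.assoc,
    ← Category.assoc, graph_comp_T hij hik hjk]
  rfl

theorem normal_comp_addBit_true : normal d φ ψ ≫ addBit true m =
    normal d (fun x => Fin.snoc (α := fun _ => Bool) (φ x) true) fun y => ψ (Fin.init y) := by
  have h : adds (Fin.natAdd n) (Fin.castAdd (m + 1)) (fun y => ψ (Fin.init y)) =
      lift (adds (Fin.natAdd n) (Fin.castAdd m) ψ) := by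
    rw [lift_adds]
    exact adds_comp (ι := Fin.castSucc) (v := Fin.natAdd n) natAdd_ne_castAdd ψ
  rw [normal, normal, h, ← graph_comp_addBit_true, Category.assoc, Category.assoc, Category.assoc,
    ← Category.assoc (addBit _ _), addBit_comp_lift, kill_comp_addBit_true, Category.assoc]

theorem normal_comp_removeBit_true {φ : (Fin n → Bool) → Fin (m + 1) → Bool}
    {ψ : (Fin (m + 1) → Bool) → Fin n → Bool} : normal d φ ψ ≫ removeBit true m =
    normal (fun x => d x && φ x (Fin.last m)) (fun x => Fin.init (φ x))
      fun y => ψ (Fin.snoc (α := fun _ => Bool) y true) := by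
  have h := adds_snoc_removeBit_true (v := Fin.natAdd n) (v' := Fin.natAdd n) (N := n + m)
    (t := Fin.castAdd m) (fun i => rfl) rfl natAdd_ne_castAdd ψ
  have h' : adds (Fin.natAdd n) (Fin.castAdd (m + 1)) ψ ≫ removeBit true (n + m) = _ := h
  rw [normal, normal, Category.assoc, Category.assoc, kill_succ_comp_removeBit_true,
    ← Category.assoc (adds _ _ _), h', ← graph_comp_removeBit_true]
  simp only [Category.assoc]

end normal

end TOF

namespace Circuit

/-! ### Soundness of evaluation -/

theorem eval_comp {n m k : ℕ} (f : Circuit n m) (g : Circuit m k) (x : Fin n → Bool) :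
    eval (f ⨟ g) x = (eval f x).bind (eval g) := rfl

theorem eval_tensor {n m n' m' : ℕ} (f : Circuit n m) (g : Circuit n' m')
    (x : Fin (n + n') → Bool) : eval (f ⊠ g) x =
      (eval f fun i => x (Fin.castAdd n' i)).bind fun y =>
        (eval g fun i => x (Fin.natAdd n i)).map fun y' => Fin.append y y' := rfl

theorem eval_append {n m n' m' : ℕ} (f : Circuit n m) (g : Circuit n' m') (x : Fin n → Bool)
    (x' : Fin n' → Bool) : eval (f ⊠ g) (Fin.append x x') =
      (eval f x).bind fun y => (eval g x').map fun y' => Fin.append y y' := by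
  simp only [eval_tensor, Fin.append_left, Fin.append_right]

theorem eval_id {n : ℕ} (x : Fin n → Bool) : eval (id n) x = some x := rfl

theorem eval_eq_of_identity {n m : ℕ} {f g : Circuit n m} (h : Identity f g) :
    f.eval = g.eval := by
  funext x
  revert x
  cases h <;> decide +kernel

theorem exists_append {n m : ℕ} (x : Fin (n + m) → Bool) :
    ∃ (y : Fin n → Bool) (z : Fin m → Bool), x = Fin.append y z :=
  ⟨_, _, (Fin.append_castAdd_natAdd (f := x)).symm⟩

theorem append_cast_assoc {a b c : ℕ} (x : Fin a → Bool) (y : Fin b → Bool) (z : Fin c → Bool) :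
    (fun i => Fin.append (Fin.append x y) z (Fin.cast (add_assoc a b c).symm i)) =
      Fin.append x (Fin.append y z) := by
  rw [Fin.append_assoc]
  rfl

theorem eval_wire_assoc {a b c : ℕ} (x : Fin a → Bool) (y : Fin b → Bool) (z : Fin c → Bool) :
    eval (wire (add_assoc a b c)) (Fin.append (Fin.append x y) z) =
      some (Fin.append x (Fin.append y z)) := congrArg some (append_cast_assoc x y z)

theorem eval_wire_assoc' {a b c : ℕ} (x : Fin a → Bool) (y : Fin b → Bool) (z : Fin c → Bool) :
    eval (wire (add_assoc a b c).symm) (Fin.append x (Fin.append y z)) =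
      some (Fin.append (Fin.append x y) z) := by
  rw [← append_cast_assoc]
  rfl

theorem eval_swap {n m : ℕ} (x : Fin n → Bool) (y : Fin m → Bool) :
    eval (swap n m) (Fin.append x y) = some (Fin.append y x) := by
  simp only [eval, Fin.append_left, Fin.append_right]

theorem eval_eq_of_eqv {n m : ℕ} {f g : Circuit n m} (h : Eqv f g) : f.eval = g.eval := by
  induction h with
  | ax h => exact eval_eq_of_identity h
  | refl f => rfl
  | symm _ h => exact h.symm
  | trans _ _ h h' => exact h.trans h'
  | comp _ _ h h' =>
    funext x
    rw [eval_comp, eval_comp, h, h']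
  | tensor _ _ h h' =>
    funext x
    rw [eval_tensor, eval_tensor, h, h']
  | id_comp f => rfl
  | comp_id f =>
    funext x
    rw [eval_comp]
    cases eval f x <;> rfl
  | assoc f g h =>
    funext x
    exact Option.bind_assoc _ _ _
  | tensor_id n m =>
    funext x
    obtain ⟨y, z, rfl⟩ := exists_append x
    rw [eval_append]
    rfl
  | interchange f g f' g' =>
    funext x
    obtain ⟨y, z, rfl⟩ := exists_append x
    rw [eval_comp, eval_append, eval_append, eval_comp, eval_comp]
    cases eval f y with
    | none => rfl
    | some y =>
      cases eval f' z with
      | none =>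
        cases h : eval g y <;> simp [h]
      | some z => exact eval_append g g' y z
  | tensor_assoc f g h =>
    funext x
    obtain ⟨y, z, rfl⟩ := exists_append x
    obtain ⟨x, y, rfl⟩ := exists_append y
    rw [eval_comp, eval_comp, eval_wire_assoc, Option.bind_some, eval_append, eval_append,
      eval_append, eval_append]
    cases eval f x with
    | none => rfl
    | some x =>
      cases eval g y with
      | none => rfl
      | some y =>
        cases eval h z with
        | none => rfl
        | some z => exact eval_wire_assoc x y z
  | id_zero_tensor f =>
    funext x
    obtain ⟨x, y, rfl⟩ := exists_append x
    have e : ∀ {k : ℕ} (x : Fin 0 → Bool) (y : Fin k → Bool),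
        eval (wire (zero_add k)) (Fin.append x y) = some y := by
      intro k x y
      refine congrArg some (funext fun i => ?_)
      exact (congrArg _ (Fin.ext (Nat.zero_add i.val).symm)).trans (Fin.append_right x y i)
    rw [eval_comp, eval_comp, e, Option.bind_some, eval_append, eval_id, Option.bind_some]
    cases eval f y with
    | none => rfl
    | some y => exact e x y
  | tensor_id_zero f =>
    funext x
    obtain ⟨x, y, rfl⟩ := exists_append x
    have e : ∀ {k : ℕ} (x : Fin k → Bool) (y : Fin 0 → Bool),
        eval (wire (add_zero k)) (Fin.append x y) = some x := by
      intro k x y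
      exact congrArg some (funext fun i => Fin.append_left x y i)
    rw [eval_comp, eval_comp, e, Option.bind_some, eval_append]
    cases eval f x with
    | none => rfl
    | some x => exact e x y
  | swap_natural f g =>
    funext x
    obtain ⟨y, z, rfl⟩ := exists_append x
    rw [eval_comp, eval_comp, eval_append, eval_swap, Option.bind_some, eval_append]
    cases eval f y with
    | none => cases h : eval g z <;> simp
    | some y =>
      cases eval g z with
      | none => rfl
      | some z => exact eval_swap y z
  | swap_swap n m =>
    funext x
    obtain ⟨y, z, rfl⟩ := exists_append x
    rw [eval_comp, eval_swap, Option.bind_some, eval_swap, eval_id]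
  | hexagon n m k =>
    funext x
    obtain ⟨y, z, rfl⟩ := exists_append x
    obtain ⟨x, y, rfl⟩ := exists_append y
    rw [eval_comp, eval_wire_assoc, Option.bind_some, eval_comp, eval_swap, Option.bind_some,
      eval_wire_assoc, eval_comp, eval_append, eval_swap]
    simp only [eval_id, Option.bind_some, Option.map_some]
    rw [eval_comp, eval_wire_assoc, Option.bind_some, eval_append, eval_swap]
    rfl

end Circuit

namespace TOF

/-- The value of a map on bits. -/
def evalHom {n m : ℕ} : H n m → (Fin n → Bool) → Option (Fin m → Bool) :=
  Quotient.lift Circuit.eval fun _ _ h => Circuit.eval_eq_of_eqv h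

theorem evalHom_ofCircuit {n m : ℕ} (c : Circuit n m) : evalHom (ofCircuit c) = c.eval := rfl

theorem evalHom_comp {n m k : ℕ} (f : H n m) (g : H m k) (x : Fin n → Bool) :
    evalHom (f ≫ g) x = (evalHom f x).bind (evalHom g) := by
  obtain ⟨f⟩ := f
  obtain ⟨g⟩ := g
  rfl

theorem evalHom_tens {n m n' m' : ℕ} (f : H n m) (g : H n' m') (x : Fin n → Bool)
    (x' : Fin n' → Bool) : evalHom (tens f g) (Fin.append x x') =
      (evalHom f x).bind fun y => (evalHom g x').map fun y' => Fin.append y y' := by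
  obtain ⟨f⟩ := f
  obtain ⟨g⟩ := g
  exact Circuit.eval_append f g x x'

theorem evalHom_one {n : ℕ} (x : Fin n → Bool) : evalHom (1 : H n n) x = some x := rfl

theorem evalHom_id {n : ℕ} (x : Fin n → Bool) : evalHom (𝟙 (TOF.mk n)) x = some x := rfl

theorem evalHom_comp_of {n m k : ℕ} {f : H n m} {x : Fin n → Bool} {y : Fin m → Bool}
    (h : evalHom f x = some y) (g : H m k) : evalHom (f ≫ g) x = evalHom g y := by
  rw [evalHom_comp, h, Option.bind_some]

theorem append_single {k : ℕ} (x : Fin k → Bool) (b : Bool) :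
    Fin.append x ![b] = Fin.snoc (α := fun _ => Bool) x b := by
  funext i
  refine Fin.lastCases ?_ (fun i => ?_) i
  · rw [Fin.snoc_last]
    exact Fin.append_right x ![b] 0
  · rw [Fin.snoc_castSucc]
    exact Fin.append_left x ![b] i

theorem evalHom_lift {n m : ℕ} (f : H n m) (x : Fin n → Bool) (b : Bool) :
    evalHom (lift f) (Fin.snoc (α := fun _ => Bool) x b) =
      (evalHom f x).map fun y => Fin.snoc (α := fun _ => Bool) y b := by
  have h := evalHom_tens f (one 1) x ![b]
  rw [append_single] at h
  refine h.trans ?_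
  cases evalHom f x with
  | none => rfl
  | some y => exact congrArg some (append_single y b)

theorem evalHom_ketB (b : Bool) (x : Fin 0 → Bool) : evalHom (ketB b) x = some ![b] := by
  revert x
  cases b <;> decide +kernel

theorem evalHom_braB (b c : Bool) : evalHom (braB b) ![c] = if c = b then some ![] else none := by
  cases b <;> cases c <;> decide +kernel

theorem evalHom_addBit (b : Bool) (n : ℕ) (x : Fin n → Bool) :
    evalHom (addBit b n) x = some (Fin.snoc (α := fun _ => Bool) x b) := by
  have h := evalHom_tens (one n) (ketB b) x ![]
  have e : Fin.append x ![] = x := funext fun i => Fin.append_left x ![] i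
  rw [e, evalHom_ketB, evalHom_id, Option.bind_some, Option.map_some, append_single] at h
  exact h

theorem evalHom_removeBit (b : Bool) (n : ℕ) (x : Fin n → Bool) (c : Bool) :
    evalHom (removeBit b n) (Fin.snoc (α := fun _ => Bool) x c) =
      if c = b then some x else none := by
  have h := evalHom_tens (one n) (braB b) x ![c]
  have e : Fin.append x ![] = x := funext fun i => Fin.append_left x ![] i
  rw [append_single, evalHom_braB, evalHom_id, Option.bind_some] at h
  refine h.trans ?_
  split
  · exact congrArg some e
  · rfl

/-! ### Values of permutations and gates -/

theorem evalHom_swapLast {n : ℕ} (x : Fin n → Bool) (a b : Bool) :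
    evalHom (swapLast n) (Fin.snoc (α := fun _ => Bool) (Fin.snoc (α := fun _ => Bool) x a) b) =
      some (Fin.snoc (α := fun _ => Bool) (Fin.snoc (α := fun _ => Bool) x b) a) := by
  have e : ∀ a b, Fin.append x ![a, b] =
      Fin.snoc (α := fun _ => Bool) (Fin.snoc (α := fun _ => Bool) x a) b := by
    intro a b
    funext i
    refine Fin.lastCases ?_ (fun i => Fin.lastCases ?_ (fun i => ?_) i) i
    · rw [Fin.snoc_last]
      exact Fin.append_right x ![a, b] 1
    · rw [Fin.snoc_castSucc, Fin.snoc_last]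
      exact Fin.append_right x ![a, b] 0
    · rw [Fin.snoc_castSucc, Fin.snoc_castSucc]
      exact Fin.append_left x ![a, b] i
  have hc : evalHom cr ![a, b] = some ![b, a] := by
    cases a <;> cases b <;> decide +kernel
  have h := evalHom_tens (one n) cr x ![a, b]
  rw [evalHom_id, Option.bind_some, hc, Option.map_some, e, e] at h
  exact h

theorem Mv.evalHom_get {n : ℕ} {Γ : Ctx Bool (n + 1)} {a : Bool} {Γ' : Ctx Bool n}
    {f : H (n + 1) (n + 1)} (h : Mv Γ a Γ' f) :
    evalHom f Γ.get = some (Fin.snoc (α := fun _ => Bool) Γ'.get a) := by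
  induction h with
  | here => rfl
  | there b _ ih =>
    refine (evalHom_comp_of (g := swapLast _) ((evalHom_lift _ _ b).trans
      (congrArg (Option.map _) ih))).trans ?_
    exact evalHom_swapLast _ _ _

/-- With bits as labels, repetitions allowed, a relabelling is the action on rows of bits; this
evaluates `perm` with no reference to how it was chosen. -/
theorem Rho.evalHom_get {n : ℕ} {Γ Δ : Ctx Bool n} {c : H n n} (h : Rho Γ Δ c) :
    evalHom c Γ.get = some Δ.get := by
  induction h with
  | nil => rfl
  | snoc hf _ ih =>
    refine (evalHom_comp_of hf.evalHom_get _).trans ?_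
    rw [evalHom_lift, ih]
    rfl

theorem evalHom_perm {n : ℕ} (σ : Equiv.Perm (Fin n)) (x : Fin n → Bool) :
    evalHom (perm σ) x = some (x ∘ σ) := by
  have h := ((rho_perm σ).map x).evalHom_get
  rwa [Ctx.map_ofFn, Ctx.map_ofFn, Ctx.get_ofFn, Ctx.get_ofFn] at h

theorem evalHom_map {n m : ℕ} {φ : Fin n → Fin m} (hφ : Function.Injective φ) {V : H n n}
    {x y : Fin m → Bool} (h : evalHom V (x ∘ φ) = some (y ∘ φ))
    (hxy : ∀ j, (∀ i, φ i ≠ j) → y j = x j) : evalHom (map φ V) x = some y := by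
  revert x y
  refine injection_induction (P := fun φ => ∀ {x y}, evalHom V (x ∘ φ) = some (y ∘ φ) →
    (∀ j, (∀ i, φ i ≠ j) → y j = x j) → evalHom (map φ V) x = some y) ?_ ?_ ?_ hφ
  · intro x y h _
    rw [map_id]
    exact h
  · intro m φ ih x y h hxy
    rw [← lift_map, ← Fin.snoc_init_self x, evalHom_lift,
      ih (x := Fin.init x) (y := Fin.init y) h fun j hj =>
        hxy _ fun i hi => hj i (Fin.castSucc_injective m hi), Option.map_some,
      ← hxy (Fin.last m) fun i => castSucc_ne_last _, Fin.snoc_init_self]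
  · intro m φ σ ih x y h hxy
    have e : map (fun i => σ (φ i)) V = perm σ * map φ V * perm σ⁻¹ := by
      by_cases hφ : Function.Injective φ
      · rw [perm_conj, map_map σ.injective]
      · rw [map_of_not_injective hφ, map_of_not_injective (φ := fun i => σ (φ i)) fun h =>
          hφ (Function.Injective.of_comp (f := σ) h),
          mul_one, perm_mul_perm_inv]
    have h2 := ih (x := x ∘ σ) (y := y ∘ σ) h fun j hj => hxy _ fun i hi => hj i (σ.injective hi)
    rw [e, mul_def, mul_def, Category.assoc, evalHom_comp_of (evalHom_perm σ x),
      evalHom_comp_of h2, evalHom_perm]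
    congr 1
    funext i
    simp

theorem evalHom_T {n : ℕ} {a b c : Fin n} (hab : a ≠ b) (hac : a ≠ c) (hbc : b ≠ c)
    (x : Fin n → Bool) : evalHom (T a b c) x = some (toffoli a b c x) := by
  refine evalHom_map (injective_three hab hac hbc) ?_ ?_
  · rw [evalHom_ofCircuit]
    refine congrArg some (funext fun i => ?_)
    fin_cases i
    · change x a = toffoli a b c x a
      exact (upd_of_ne hac).symm
    · change x b = toffoli a b c x b
      exact (upd_of_ne hbc).symm
    · change xor (x a && x b) (x c) = toffoli a b c x c
      rw [toffoli, upd_self, Bool.xor_comm]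
      rfl
  · intro j hj
    exact upd_of_ne (hj 2).symm

theorem evalHom_X {n : ℕ} (a : Fin n) (x : Fin n → Bool) :
    evalHom (X a) x = some (Function.update x a (!x a)) := by
  refine evalHom_map (injective_single a) ?_ ?_
  · have h : ∀ b, evalHom (ofCircuit Circuit.not) ![b] = some ![!b] := by decide +kernel
    have e : ∀ y : Fin n → Bool, y ∘ ![a] = ![y a] := fun y => by
      funext i
      fin_cases i
      rfl
    rw [e, e, h, Function.update_self]
  · intro j hj
    exact Function.update_of_ne (hj 0).symm _ _

/-! ### Values of oracles and normal forms -/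

theorem evalHom_anc0 {n : ℕ} {V : H (n + 1) (n + 1)} {x y : Fin n → Bool}
    (h : evalHom V (Fin.snoc (α := fun _ => Bool) x false) =
      some (Fin.snoc (α := fun _ => Bool) y false)) : evalHom (anc0 V) x = some y := by
  rw [anc0, evalHom_comp_of (evalHom_addBit _ _ _), evalHom_comp_of h, evalHom_removeBit, if_pos rfl]

theorem evalHom_CU_of {n : ℕ} {h : (Fin n → Bool) → Bool}
    (H : ∀ {N : ℕ} {w : Fin n → Fin N} {s : Fin N} (_ : ∀ i, w i ≠ s) (x : Fin N → Bool),
      evalHom (U w s h) x = some (upd w s h x)) {N : ℕ} {w : Fin n → Fin N} {y s : Fin N}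
    (hys : y ≠ s) (hs : ∀ i, w i ≠ s) (x : Fin N → Bool) :
    evalHom (CU w y s h) x = some (Function.update x s (xor (x s) (x y && h (x ∘ w)))) := by
  have e : ∀ (z : Fin N → Bool) (b : Bool),
      upd (Fin.castSucc ∘ w) (Fin.last N) h (Fin.snoc (α := fun _ => Bool) z b) =
        Fin.snoc (α := fun _ => Bool) z (xor b (h (z ∘ w))) := by
    intro z b
    have : (Fin.snoc z b : Fin (N + 1) → Bool) ∘ Fin.castSucc ∘ w = z ∘ w :=
      funext fun i => Fin.snoc_castSucc (α := fun _ => Bool) _ _ _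
    rw [upd, this, Fin.snoc_last, Fin.update_snoc_last]
  refine evalHom_anc0 ?_
  rw [mul_def, mul_def, Category.assoc, evalHom_comp_of (H castSucc_comp_ne_last _), e,
    evalHom_comp_of (evalHom_T (castSucc_ne_last y) (castSucc_ne hys) (last_ne_castSucc s) _),
    H castSucc_comp_ne_last]
  have e' : toffoli y.castSucc (Fin.last N) s.castSucc
      (Fin.snoc (α := fun _ => Bool) x (xor false (h (x ∘ w)))) =
      Fin.snoc (α := fun _ => Bool) (Function.update x s (xor (x s) (x y && h (x ∘ w))))
        (h (x ∘ w)) := by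
    rw [Fin.snoc_update, toffoli, upd]
    simp
  have e'' : Function.update x s (xor (x s) (x y && h (x ∘ w))) ∘ w = x ∘ w :=
    funext fun i => Function.update_of_ne (hs i) _ _
  rw [e', e, e'', Bool.xor_self]

theorem evalHom_U : ∀ {n N : ℕ} {w : Fin n → Fin N} {s : Fin N} (h : (Fin n → Bool) → Bool)
    (_ : ∀ i, w i ≠ s) (x : Fin N → Bool), evalHom (U w s h) x = some (upd w s h x)
  | 0, N, w, s, h, _, x => by
    rw [U_zero, upd, Subsingleton.elim (x ∘ w) ![]]
    cases h ![]
    · simp [evalHom_one]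
    · simp [evalHom_X]
  | n + 1, N, w, s, h, hs, x => by
    have hs' : ∀ i, Fin.init w i ≠ s := fun i => hs _
    rw [U_succ, mul_def, evalHom_comp_of (evalHom_U _ hs' x),
      evalHom_CU_of (fun hs x => evalHom_U _ hs x) (hs _) hs']
    have e : upd (Fin.init w) s (low h) x ∘ Fin.init w = x ∘ Fin.init w :=
      funext fun i => upd_of_ne (hs' i)
    have e' : x ∘ w = Fin.snoc (α := fun _ => Bool) (x ∘ Fin.init w) (x (w (Fin.last n))) :=
      (Fin.snoc_init_self (α := fun _ => Bool) (x ∘ w)).symm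
    rw [e, upd_self, upd_of_ne (hs _), upd, upd, Function.update_idem, e', Bool.xor_assoc]
    congr 4
    cases x (w (Fin.last n)) <;> simp [low, diff]

theorem evalHom_Pj {n N : ℕ} (w : Fin n → Fin N) (g : (Fin n → Bool) → Bool) (x : Fin N → Bool) :
    evalHom (Pj w g) x = if g (x ∘ w) then some x else none := by
  have e : (Fin.snoc x false : Fin (N + 1) → Bool) ∘ Fin.castSucc ∘ w = x ∘ w :=
      funext fun i => Fin.snoc_castSucc (α := fun _ => Bool) _ _ _
  rw [Pj, evalHom_comp_of (evalHom_addBit _ _ _), evalHom_comp_of (evalHom_U _ castSucc_comp_ne_last _),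
    upd, e, Fin.snoc_last, Fin.update_snoc_last, evalHom_removeBit, Bool.false_xor]

theorem append_snoc {n m : ℕ} (x : Fin n → Bool) (y : Fin m → Bool) (b : Bool) :
    Fin.append x (Fin.snoc (α := fun _ => Bool) y b) =
      Fin.snoc (α := fun _ => Bool) (Fin.append x y) b := by
  rw [← append_single, ← append_single, Fin.append_assoc]
  rfl

theorem evalHom_graph {n : ℕ} (d : (Fin n → Bool) → Bool) : ∀ (m : ℕ)
    (φ : (Fin n → Bool) → Fin m → Bool) (x : Fin n → Bool),
    evalHom (graph d m φ) x = if d x then some (Fin.append x (φ x)) else none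
  | 0, φ, x => by
    have e : Fin.append x (φ x) = x := funext fun i => Fin.append_left x (φ x) i
    rw [e]
    exact evalHom_Pj id d x
  | m + 1, φ, x => by
    rw [graph_succ, evalHom_comp, evalHom_graph d m]
    by_cases hx : d x
    · rw [if_pos hx, if_pos hx, Option.bind_some, evalHom_comp_of (evalHom_addBit _ _ _),
        evalHom_U _ castAdd_ne_last]
      have e : (Fin.snoc (Fin.append x (Fin.init (φ x))) false : Fin (n + m + 1) → Bool) ∘
          Fin.castAdd (m + 1) = x := by
        rw [← append_snoc]
        exact funext fun i => Fin.append_left _ _ i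
      rw [upd, e, Fin.snoc_last, Bool.false_xor]
      refine congrArg some ((Fin.update_snoc_last (α := fun _ => Bool) (n := n + m) false
        (Fin.append x (Fin.init (φ x))) (φ x (Fin.last m))).trans ?_)
      rw [← append_snoc, Fin.snoc_init_self]
    · rw [if_neg hx, if_neg hx, Option.bind_none]

theorem evalHom_adds {m N : ℕ} {v : Fin m → Fin N} : ∀ {n : ℕ} {t : Fin n → Fin N}
    (_ : ∀ i j, v i ≠ t j) (_ : Function.Injective t) (ψ : (Fin m → Bool) → Fin n → Bool)
    {x y : Fin N → Bool} (_ : ∀ j, y (t j) = xor (x (t j)) (ψ (x ∘ v) j))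
    (_ : ∀ i, (∀ j, t j ≠ i) → y i = x i), evalHom (adds v t ψ) x = some y
  | 0, t, _, _, ψ, x, y, _, h => by
    rw [funext fun i => h i fun j => j.elim0]
    exact evalHom_one x
  | n + 1, t, hv, ht, ψ, x, y, h, h' => by
    have hne : ∀ j : Fin n, t j.castSucc ≠ t (Fin.last n) := fun j => ht.ne (castSucc_ne_last j)
    have ih := evalHom_adds (t := Fin.init t) (x := x)
      (y := Function.update y (t (Fin.last n)) (x (t (Fin.last n)))) (fun i j => hv i _)
      (ht.comp (Fin.castSucc_injective n)) (fun z => Fin.init (ψ z))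
      (fun j => (Function.update_of_ne (hne j) _ _).trans (h _)) fun i hi => by
        rcases eq_or_ne i (t (Fin.last n)) with rfl | hi'
        · exact Function.update_self _ _ _
        · rw [Function.update_of_ne hi', h' i (Fin.lastCases hi'.symm hi)]
    have e : Function.update y (t (Fin.last n)) (x (t (Fin.last n))) ∘ v = x ∘ v := by
      funext i
      rw [Function.comp_apply, Function.update_of_ne (hv i _), h' _ fun j => (hv i j).symm]
      rfl
    rw [adds_succ, mul_def, evalHom_comp_of ih, evalHom_U _ fun i => hv i _, upd, e,
      Function.update_self, Function.update_idem, ← h, Function.update_eq_self]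

theorem evalHom_killAll : ∀ (n : ℕ) (x : Fin n → Bool),
    evalHom (killAll n) x = if x = fun _ => false then some ![] else none
  | 0, x => by
    rw [if_pos (Subsingleton.elim _ _)]
    exact congrArg some (Subsingleton.elim _ _)
  | n + 1, x => by
    have e : (x = fun _ => false) ↔ x (Fin.last n) = false ∧ Fin.init x = fun _ => false := by
      constructor
      · rintro rfl
        exact ⟨rfl, rfl⟩
      · rintro ⟨h, h'⟩
        exact funext fun i => Fin.lastCases h (fun i => congrFun h' i) i
    rw [killAll, evalHom_comp, ← Fin.snoc_init_self (α := fun _ => Bool) x, evalHom_removeBit,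
      Fin.snoc_init_self]
    by_cases h : x (Fin.last n) = false
    · rw [if_pos h, Option.bind_some, evalHom_killAll n]
      simp only [e, h, true_and]
    · rw [if_neg h, Option.bind_none, if_neg fun h' => h (e.1 h').1]

theorem evalHom_kill (n : ℕ) : ∀ (m : ℕ) (x : Fin n → Bool) (y : Fin m → Bool),
    evalHom (kill n m) (Fin.append x y) = if x = fun _ => false then some y else none
  | 0, x, y => by
    have e : Fin.append x y = x := funext fun i => Fin.append_left x y i
    rw [e, Subsingleton.elim y ![]]
    exact evalHom_killAll n x
  | m + 1, x, y => by
    rw [← Fin.snoc_init_self (α := fun _ => Bool) y, append_snoc, kill_succ, evalHom_lift,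
      evalHom_kill n m]
    split <;> rfl

theorem evalHom_normal {n m : ℕ} (d : (Fin n → Bool) → Bool) (φ : (Fin n → Bool) → Fin m → Bool)
    (ψ : (Fin m → Bool) → Fin n → Bool) (x : Fin n → Bool) : evalHom (normal d φ ψ) x =
      if d x = true ∧ ψ (φ x) = x then some (φ x) else none := by
  rw [normal, evalHom_comp, evalHom_graph]
  by_cases hx : d x = true
  · rw [if_pos hx, Option.bind_some, evalHom_comp_of (evalHom_adds (t := Fin.castAdd m)
      natAdd_ne_castAdd (Fin.castAdd_injective n m) ψ
      (y := Fin.append (fun i => xor (x i) (ψ (φ x) i)) (φ x)) ?_ ?_), evalHom_kill]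
    · have e : ((fun i => xor (x i) (ψ (φ x) i)) = fun _ => false) ↔ ψ (φ x) = x := by
        simp only [funext_iff, bne_eq_false_iff_eq]
        exact forall_congr' fun i => eq_comm
      simp only [e, hx, true_and]
    · intro j
      have e : Fin.append x (φ x) ∘ Fin.natAdd n = φ x := funext fun i => Fin.append_right _ _ _
      rw [Fin.append_left, Fin.append_left, e]
    · intro i hi
      refine Fin.addCases (fun i hi => absurd rfl (hi i)) (fun i _ => ?_) i hi
      rw [Fin.append_right, Fin.append_right]
  · rw [if_neg hx, Option.bind_none, if_neg fun h => hx h.1]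

/-! ### Permutations and gates -/

theorem map_perm_swap {n m : ℕ} {φ : Fin n → Fin m} (hφ : Function.Injective φ) (i j : Fin n) :
    map φ (perm (Equiv.swap i j)) = perm (Equiv.swap (φ i) (φ j)) := by
  suffices h : Function.Injective φ ∧
      map φ (perm (Equiv.swap i j)) = perm (Equiv.swap (φ i) (φ j)) from h.2
  refine injection_induction (P := fun φ => Function.Injective φ ∧
    map φ (perm (Equiv.swap i j)) = perm (Equiv.swap (φ i) (φ j))) ?_ ?_ ?_ hφ
  · exact ⟨fun _ _ h => h, map_id _⟩
  · rintro m φ ⟨hφ, h⟩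
    refine ⟨(Fin.castSucc_injective m).comp hφ, ?_⟩
    rw [← lift_map, h, lift_perm]
    congr 1
    ext k
    refine Fin.lastCases ?_ (fun k => ?_) k
    · rw [extendLast_last, Equiv.swap_apply_of_ne_of_ne (last_ne_castSucc _) (last_ne_castSucc _)]
    · rw [extendLast_castSucc, (Fin.castSucc_injective m).swap_apply]
  · rintro m φ σ ⟨hφ, h⟩
    refine ⟨σ.injective.comp hφ, ?_⟩
    rw [← map_map σ.injective, ← perm_conj, h, ← map_mul, ← map_mul]
    congr 1
    ext k
    simp [Equiv.swap_apply_def, Equiv.symm_apply_eq]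
    split_ifs <;> simp

/-- The identity `cnot_cross` placed on two wires. It removes crossings from the list of generators.
-/
theorem perm_swap {n : ℕ} {a b : Fin n} (hab : a ≠ b) :
    perm (Equiv.swap a b) = C a b * C b a * C a b := by
  have hinj : Function.Injective ![a, b] := injective_pair hab
  have h := congrArg (map ![a, b]) C_swap
  rw [map_perm_swap hinj, map_mul', map_mul', map_C hinj, map_C hinj] at h
  exact h.symm

/-- Maps which permute wires. -/
def IsPerm {n m : ℕ} (f : H n m) : Prop :=
  ∃ (h : n = m) (σ : Equiv.Perm (Fin n)), f = perm σ ≫ strands h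

theorem isPerm_perm {n : ℕ} (σ : Equiv.Perm (Fin n)) : IsPerm (perm σ) :=
  ⟨rfl, σ, (Category.comp_id _).symm⟩

theorem strands_rfl (n : ℕ) (h : n = n) : strands h = one n := rfl

theorem isPerm_strands {n m : ℕ} (h : n = m) : IsPerm (strands h) :=
  ⟨h, 1, by rw [map_one, one_comp]⟩

theorem IsPerm.comp {n m k : ℕ} {f : H n m} {g : H m k} (hf : IsPerm f) (hg : IsPerm g) :
    IsPerm (f ≫ g) := by
  obtain ⟨rfl, σ, rfl⟩ := hf
  obtain ⟨rfl, τ, rfl⟩ := hg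
  refine ⟨rfl, σ * τ, ?_⟩
  rw [map_mul, mul_def]
  simp only [strands_rfl, Category.comp_id]

theorem IsPerm.lift {n m : ℕ} {f : H n m} (hf : IsPerm f) : IsPerm (lift f) := by
  obtain ⟨rfl, σ, rfl⟩ := hf
  rw [lift_comp, lift_perm]
  exact (isPerm_perm _).comp (by
    rw [strands_rfl]
    exact (lift_one n).symm ▸ isPerm_strands (rfl : n + 1 = n + 1))

theorem isPerm_liftBy {n : ℕ} (σ : Equiv.Perm (Fin n)) :
    ∀ d, ∃ τ, liftBy (perm σ) d = perm τ
  | 0 => ⟨σ, rfl⟩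
  | d + 1 => by
    obtain ⟨τ, h⟩ := isPerm_liftBy σ d
    exact ⟨extendLast τ, by rw [liftBy, h, lift_perm]⟩

theorem IsPerm.one_tens {n m : ℕ} {f : H n m} (hf : IsPerm f) (a : ℕ) : IsPerm (tens (one a) f) := by
  obtain ⟨rfl, σ, rfl⟩ := hf
  rw [strands_rfl, Category.comp_id, one_tens_eq_map]
  obtain ⟨d, h, τ, -, hτ⟩ := isMap_map (Fin.natAdd_injective n a) (perm σ)
  obtain rfl : d = a := by omega
  rw [hτ]
  have key : ∀ {p q : ℕ} (h : p = q) (ρ : Equiv.Perm (Fin p)), IsPerm (h ▸ perm ρ : H q q) := by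
    rintro p _ rfl ρ
    exact isPerm_perm ρ
  obtain ⟨ρ, hρ⟩ := isPerm_liftBy σ d
  rw [hρ]
  exact ((isPerm_perm _).comp (key h ρ)).comp (isPerm_perm _)

theorem IsPerm.of_inverse {n m : ℕ} {f : H n m} {g : H m n} (hf : IsPerm f) (h : f ≫ g = one n) :
    IsPerm g := by
  obtain ⟨rfl, σ, rfl⟩ := hf
  rw [strands_rfl, Category.comp_id, ← mul_def] at h
  have h' : g = perm σ⁻¹ := by
    rw [← one_mul g, ← perm_inv_mul_perm σ, mul_assoc, h]
    exact mul_one _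
  rw [h']
  exact isPerm_perm _

theorem isPerm_sw_one (n : ℕ) : IsPerm (sw n 1) := by
  obtain ⟨σ, -, h⟩ := exists_perm_sw_one n
  refine IsPerm.of_inverse (f := sw 1 n) ?_ (sw_sw 1 n)
  rw [h]
  exact (isPerm_strands _).comp (isPerm_perm σ)

theorem sw_zero (n : ℕ) : sw n 0 = strands (Nat.zero_add n).symm :=
  (braiding_tensorUnit_right (TOF.mk n)).trans (strands_comp (add_zero n) (zero_add n).symm)

/-- The hexagon splits the second bundle into single wires, and crossing a bundle with one wire is
inverse to a crossing already known to be a permutation. -/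
theorem isPerm_sw (n : ℕ) : ∀ m, IsPerm (sw n m)
  | 0 => by
    rw [sw_zero]
    exact isPerm_strands _
  | m + 1 => by
    have h : strands (add_assoc n m 1) ≫ sw n (m + 1) ≫ strands (add_assoc m 1 n) =
      lift (sw n m) ≫ strands (add_assoc m n 1) ≫ tens (one m) (sw n 1) :=
        sound (.hexagon n m 1)
    have h' : sw n (m + 1) = (lift (sw n m) ≫ strands (add_assoc m n 1) ≫ tens (one m) (sw n 1)) ≫
        strands (add_assoc m 1 n).symm := by
      rw [← h, Category.assoc, Category.assoc, strands_comp]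
      simp only [strands_rfl, Category.comp_id]
      exact (Category.id_comp _).symm
    rw [h']
    exact ((isPerm_sw n m).lift.comp ((isPerm_strands _).comp ((isPerm_sw_one n).one_tens m))).comp
      (isPerm_strands _)

/-! ### Generation by Toffoli gates and ancillary bits -/

/-- The maps generated by Toffoli gates, ancillary bits in state one, and straight wires. -/
inductive Gen : {n m : ℕ} → H n m → Prop
  | T {n : ℕ} (a b c : Fin n) : Gen (T a b c)
  | addBit (n : ℕ) : Gen (addBit true n)
  | removeBit (n : ℕ) : Gen (removeBit true n)
  | strands {n m : ℕ} (h : n = m) : Gen (strands h)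
  | comp {n m k : ℕ} {f : H n m} {g : H m k} : Gen f → Gen g → Gen (f ≫ g)

theorem gen_C {n : ℕ} (a b : Fin n) : Gen (C a b) := by
  have h : C a b = (addBit true n ≫ T (Fin.last n) a.castSucc b.castSucc) ≫ removeBit true n := by
    rw [addBit_true_T, Category.assoc, addBit_comp_removeBit, comp_one]
  rw [h]
  exact ((Gen.addBit n).comp (.T _ _ _)).comp (.removeBit n)

theorem gen_perm {n : ℕ} (σ : Equiv.Perm (Fin n)) : Gen (perm σ) := by
  induction σ using Equiv.Perm.swap_induction_on with
  | one => exact map_one (perm (n := n)) ▸ Gen.strands rfl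
  | swap_mul σ a b hab h =>
    rw [map_mul, perm_swap hab]
    exact (((gen_C a b).comp (gen_C b a)).comp (gen_C a b)).comp h

theorem IsPerm.gen {n m : ℕ} {f : H n m} (hf : IsPerm f) : Gen f := by
  obtain ⟨h, σ, rfl⟩ := hf
  exact (gen_perm σ).comp (.strands h)

theorem gen_swapLast (n : ℕ) : Gen (swapLast n) := swapLast_eq_perm n ▸ gen_perm _

theorem Gen.lift {n m : ℕ} {f : H n m} (h : Gen f) : Gen (lift f) := by
  induction h with
  | T a b c => exact lift_T a b c ▸ Gen.T _ _ _
  | addBit n => exact addBit_comp_swapLast true n ▸ (Gen.addBit _).comp (gen_swapLast n)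
  | removeBit n => exact swapLast_comp_removeBit true n ▸ (gen_swapLast n).comp (.removeBit _)
  | strands h => exact (isPerm_strands h).lift.gen
  | comp _ _ hf hg =>
    rw [lift_comp]
    exact hf.comp hg

theorem Gen.tens_one {n m : ℕ} {f : H n m} (h : Gen f) : ∀ d, Gen (tens f (one d))
  | 0 => (tens_one_zero f).symm ▸ h
  | d + 1 => by
    have e : TOF.lift (tens f (one d)) = tens f (one (d + 1)) := by
      rw [TOF.lift, tens_assoc_one, TOF.tens_one]
    exact e ▸ (h.tens_one d).lift

theorem one_tens_addBit (a : ℕ) (b : Bool) (n : ℕ) :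
    tens (one a) (addBit b n) = addBit b (a + n) := by
  refine (eq_of_heq (tens_assoc_of (one a) (one n) (ketB b))).symm.trans ?_
  rw [tens_one]
  rfl

theorem one_tens_removeBit (a : ℕ) (b : Bool) (n : ℕ) :
    tens (one a) (removeBit b n) = removeBit b (a + n) := by
  refine (eq_of_heq (tens_assoc_of (one a) (one n) (braB b))).symm.trans ?_
  rw [tens_one]
  rfl

theorem Gen.one_tens (a : ℕ) {n m : ℕ} {f : H n m} (h : Gen f) : Gen (tens (one a) f) := by
  induction h with
  | T i j k =>
    rw [one_tens_eq_map, map_T (Fin.natAdd_injective _ a)]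
    exact .T _ _ _
  | addBit n => exact one_tens_addBit a true n ▸ Gen.addBit _
  | removeBit n => exact one_tens_removeBit a true n ▸ Gen.removeBit _
  | strands h => exact ((isPerm_strands h).one_tens a).gen
  | @comp _ _ _ f g _ _ hf hg =>
    have e : tens (one a) (f ≫ g) = tens (one a) f ≫ tens (one a) g := by
      rw [← tens_comp, Category.comp_id]
    exact e ▸ hf.comp hg

theorem Gen.tens {n m n' m' : ℕ} {f : H n m} {g : H n' m'} (hf : Gen f) (hg : Gen g) :
    Gen (tens f g) := by
  have e : TOF.tens f g = TOF.tens f (one n') ≫ TOF.tens (one m) g := by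
    rw [← tens_comp, Category.comp_id, Category.id_comp]
  exact e ▸ (hf.tens_one n').comp (hg.one_tens m)

theorem gen_ofCircuit {n m : ℕ} (c : Circuit n m) : Gen (ofCircuit c) := by
  induction c with
  | wire h => exact .strands h
  | comp f g hf hg => exact hf.comp hg
  | tensor f g hf hg => exact hf.tens hg
  | swap n m => exact (isPerm_sw n m).gen
  | ketOne =>
    have h : addBit true 0 = ofCircuit .ketOne :=
      (Category.comp_id _).symm.trans ((one_zero_tens (ketB true)).trans (Category.id_comp _))
    exact h ▸ Gen.addBit 0
  | braOne =>
    have h : removeBit true 0 = ofCircuit .braOne :=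
      (Category.comp_id _).symm.trans ((one_zero_tens (braB true)).trans (Category.id_comp _))
    exact h ▸ Gen.removeBit 0
  | tof => exact ofCircuit_tof ▸ Gen.T _ _ _

theorem gen {n m : ℕ} (f : H n m) : Gen f := by
  obtain ⟨c⟩ := f
  exact gen_ofCircuit c

/-! ### The normal form of the identity -/

/-- Start `m` wires with zeros. -/
def ketAll : (m : ℕ) → H 0 m
  | 0 => 1
  | m + 1 => ketAll m ≫ addBit false m

theorem ketAll_comp_killAll : ∀ n, ketAll n ≫ killAll n = 1
  | 0 => Category.comp_id _
  | n + 1 => by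
    rw [ketAll, killAll, Category.assoc, ← Category.assoc (addBit _ _), addBit_comp_removeBit,
      one_comp, ketAll_comp_killAll n]

/-- Add `m` wires in state zero. -/
def zeros (n m : ℕ) : H n (n + m) := tens (one n) (ketAll m)

theorem zeros_succ (n m : ℕ) : zeros n (m + 1) = zeros n m ≫ addBit false (n + m) := by
  rw [← one_tens_addBit]
  exact (congrArg (fun f => tens f (ketAll m ≫ addBit false m)) (Category.comp_id (one n))).symm.trans
    (tens_comp _ _ _ _)

/-- Starting a wire commutes with maps that ignore it, so all zeros can be prepared before the
oracles. -/
theorem graph_true {n : ℕ} : ∀ (m : ℕ) (φ : (Fin n → Bool) → Fin m → Bool),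
    graph (fun _ => true) m φ = zeros n m ≫ adds (Fin.castAdd m) (Fin.natAdd n) φ
  | 0, φ => by
    have h : zeros n 0 = one n := tens_one_zero (one n)
    exact (Pj_true (w := fun i : Fin n => i)).trans
      ((Category.comp_id _).trans h).symm
  | m + 1, φ => by
    have h := lift_adds (Fin.castAdd m) (Fin.natAdd n) fun x => Fin.init (φ x)
    have h' : adds (Fin.castAdd (m + 1)) (Fin.natAdd n) φ =
      lift (adds (Fin.castAdd m) (Fin.natAdd n) fun x => Fin.init (φ x)) *
        U (Fin.castAdd (m + 1)) (Fin.last (n + m)) fun x => φ x (Fin.last m) := by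
      rw [h]
      rfl
    rw [graph_succ, graph_true m, h', zeros_succ, Category.assoc, Category.assoc, mul_def,
      ← Category.assoc (addBit _ _), addBit_comp_lift, Category.assoc]

theorem adds_false {m N : ℕ} (v : Fin m → Fin N) : ∀ {n : ℕ} (t : Fin n → Fin N),
    adds v t (fun _ _ => false) = 1
  | 0, _ => rfl
  | _ + 1, t => by
    rw [adds_succ, U_false, mul_one]
    exact adds_false v _

theorem sat_zeros (n m : ℕ) :
    Sat (zeros n m) fun z => decide (z ∘ Fin.natAdd n = fun _ => false) := by
  have h := sat_graph (d := fun _ : Fin n → Bool => true) m fun _ _ => false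
  rw [graph_true, adds_false, comp_one] at h
  exact h.mono fun z hz => hz

theorem zeros_comp_adds (n : ℕ) :
    zeros n n ≫ adds (Fin.natAdd n) (Fin.castAdd n) (fun x => x) = zeros n n := by
  have h := (Sat.comp_adds_congr (v := Fin.natAdd n) (g := fun y => decide (y = fun _ => false))
    (sat_zeros n n) (t := Fin.castAdd n) natAdd_ne_castAdd (ψ := fun x => x)
    (ψ' := fun _ _ => false) fun y hy => of_decide_eq_true hy).1
  rw [h, adds_false, comp_one]

/-- A product of controlled not gates. -/
noncomputable def cnots {N : ℕ} : {k : ℕ} → (a b : Fin k → Fin N) → H N N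
  | 0, _, _ => 1
  | k + 1, a, b => cnots (Fin.init a) (Fin.init b) * C (a (Fin.last k)) (b (Fin.last k))

theorem adds_eq_cnots {m N : ℕ} (v : Fin m → Fin N) : ∀ {n : ℕ} (e : Fin n → Fin m)
    (t : Fin n → Fin N), adds v t (fun x => x ∘ e) = cnots (v ∘ e) t
  | 0, _, _ => rfl
  | n + 1, e, t => by
    rw [adds_succ, cnots]
    exact congrArg₂ (· * ·) (adds_eq_cnots v (Fin.init e) (Fin.init t)) (U_apply v _ _)

theorem cnots_commute_C {N : ℕ} {x y : Fin N} : ∀ {k : ℕ} {a b : Fin k → Fin N}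
    (_ : ∀ i, b i ≠ x) (_ : ∀ i, a i ≠ y), Commute (cnots a b) (C x y)
  | 0, _, _, _, _ => Commute.one_left _
  | _ + 1, a, b, hx, hy => by
    refine Commute.mul_left (cnots_commute_C (fun i => hx _) fun i => hy _) ?_
    exact C_commute_C (hx _) (hy _).symm

/-- The pairs of wires are disjoint, so gates of different pairs commute and the product can be
regrouped into a transposition for each pair. -/
theorem cnots_conj {N : ℕ} : ∀ {k : ℕ} {a b : Fin k → Fin N} (_ : Function.Injective a)
    (_ : Function.Injective b) (_ : ∀ i j, a i ≠ b j),
    ∃ τ, cnots b a * cnots a b * cnots b a = perm τ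
  | 0, _, _, _, _, _ => ⟨1, by rw [map_one]; simp [cnots]⟩
  | k + 1, a, b, ha, hb, hab => by
    obtain ⟨τ, h⟩ := cnots_conj (a := Fin.init a) (b := Fin.init b)
      (ha.comp (Fin.castSucc_injective k)) (hb.comp (Fin.castSucc_injective k)) fun i j => hab _ _
    have ha' : ∀ i, Fin.init a i ≠ a (Fin.last k) := fun i => ha.ne (castSucc_ne_last i)
    have hb' : ∀ i, Fin.init b i ≠ b (Fin.last k) := fun i => hb.ne (castSucc_ne_last i)
    have h1 : Commute (cnots (Fin.init a) (Fin.init b)) (C (b (Fin.last k)) (a (Fin.last k))) :=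
      cnots_commute_C hb' ha'
    have h2 : Commute (cnots (Fin.init b) (Fin.init a)) (C (b (Fin.last k)) (a (Fin.last k))) :=
      cnots_commute_C (fun i => hab _ _) fun i => (hab _ _).symm
    have h3 : Commute (cnots (Fin.init b) (Fin.init a)) (C (a (Fin.last k)) (b (Fin.last k))) :=
      cnots_commute_C ha' hb'
    refine ⟨τ * Equiv.swap (b (Fin.last k)) (a (Fin.last k)), ?_⟩
    rw [map_mul, ← h, perm_swap (hab _ _).symm, cnots, cnots]
    generalize cnots (Fin.init b) (Fin.init a) = B at *
    generalize cnots (Fin.init a) (Fin.init b) = A at *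
    generalize C (b (Fin.last k)) (a (Fin.last k)) = c at *
    generalize C (a (Fin.last k)) (b (Fin.last k)) = c' at *
    calc B * c * (A * c') * (B * c) = B * (c * A) * (c' * B) * c := by simp only [mul_assoc]
      _ = B * A * (c * B) * c' * c := by rw [← h1.eq, ← h3.eq]; simp only [mul_assoc]
      _ = B * A * B * (c * c' * c) := by rw [← h2.eq]; simp only [mul_assoc]

theorem zeros_comp_sw_comp_kill (n : ℕ) : zeros n n ≫ sw n n ≫ kill n n = 1 := by
  have h1 : zeros n n ≫ sw n n = sw n 0 ≫ tens (ketAll n) (one n) := sw_natural _ _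
  have h2 : tens (ketAll n) (one n) ≫ tens (killAll n) (one n) = one (0 + n) := by
    rw [← tens_comp, ketAll_comp_killAll, Category.comp_id]
    exact tens_one 0 n
  rw [kill_eq, ← Category.assoc, h1, Category.assoc, ← Category.assoc (tens _ _), h2,
    Category.id_comp, sw_zero, strands_comp]
  rfl

theorem append_comp_castAdd {n m : ℕ} (x : Fin n → Bool) (y : Fin m → Bool) :
    Fin.append x y ∘ Fin.castAdd m = x := funext fun i => Fin.append_left x y i

theorem append_comp_natAdd {n m : ℕ} (x : Fin n → Bool) (y : Fin m → Bool) :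
    Fin.append x y ∘ Fin.natAdd n = y := funext fun i => Fin.append_right x y i

theorem evalHom_adds_left {n : ℕ} (x y : Fin n → Bool) :
    evalHom (adds (Fin.castAdd n) (Fin.natAdd n) fun x => x) (Fin.append x y) =
      some (Fin.append x fun i => xor (y i) (x i)) := by
  refine evalHom_adds castAdd_ne_natAdd (Fin.natAdd_injective n n) _ (fun j => ?_) fun i hi => ?_
  · rw [Fin.append_right, Fin.append_right, append_comp_castAdd]
  · refine Fin.addCases (fun i _ => ?_) (fun i hi => absurd rfl (hi i)) i hi
    rw [Fin.append_left, Fin.append_left]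

theorem evalHom_adds_right {n : ℕ} (x y : Fin n → Bool) :
    evalHom (adds (Fin.natAdd n) (Fin.castAdd n) fun x => x) (Fin.append x y) =
      some (Fin.append (fun i => xor (x i) (y i)) y) := by
  refine evalHom_adds natAdd_ne_castAdd (Fin.castAdd_injective n n) _ (fun j => ?_) fun i hi => ?_
  · rw [Fin.append_left, Fin.append_left, append_comp_natAdd]
  · refine Fin.addCases (fun i hi => absurd rfl (hi i)) (fun i _ => ?_) i hi
    rw [Fin.append_right, Fin.append_right]

/-- The swap by three additions, for bundles. Both sides are permutations of wires, and a
permutation is determined by its values on bits, so it suffices to evaluate. -/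
theorem adds_conj (n : ℕ) : adds (Fin.natAdd n) (Fin.castAdd n) (fun x => x) *
    adds (Fin.castAdd n) (Fin.natAdd n) (fun x => x) *
    adds (Fin.natAdd n) (Fin.castAdd n) (fun x => x) = sw n n := by
  obtain ⟨τ, hτ⟩ := cnots_conj (Fin.castAdd_injective n n) (Fin.natAdd_injective n n)
    castAdd_ne_natAdd
  obtain ⟨h, σ, hσ⟩ := isPerm_sw n n
  rw [strands_rfl, Category.comp_id] at hσ
  have h1 := adds_eq_cnots (Fin.natAdd n) (fun i : Fin n => i) (Fin.castAdd n)
  have h2 := adds_eq_cnots (Fin.castAdd n) (fun i : Fin n => i) (Fin.natAdd n)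
  have key : adds (Fin.natAdd n) (Fin.castAdd n) (fun x => x) *
    adds (Fin.castAdd n) (Fin.natAdd n) (fun x => x) *
    adds (Fin.natAdd n) (Fin.castAdd n) (fun x => x) = perm τ :=
      (congrArg₂ (fun B A => B * A * B) h1 h2).trans hτ
  rw [key, hσ]
  congr 1
  refine Equiv.ext fun i => ?_
  have e : ∀ z : Fin (n + n) → Bool, z ∘ τ = z ∘ σ := by
    intro z
    have h3 : evalHom (perm τ) z = evalHom (perm σ) z := by
      rw [← key, ← hσ]
      obtain ⟨x, y, rfl⟩ := Circuit.exists_append z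
      rw [mul_def, mul_def, Category.assoc, evalHom_comp_of (evalHom_adds_right x y),
        evalHom_comp_of (evalHom_adds_left _ y), evalHom_adds_right]
      refine Eq.trans ?_ (Circuit.eval_swap x y).symm
      congr 2
      · funext i
        cases x i <;> cases y i <;> rfl
      · funext i
        cases x i <;> cases y i <;> rfl
    rwa [evalHom_perm, evalHom_perm, Option.some.injEq] at h3
  -- The row with a single one at position `σ i` detects the image of `i`.
  have h4 := congrFun (e fun j => decide (j = σ i)) i
  simp only [Function.comp_apply, decide_true] at h4
  exact of_decide_eq_true h4

/-- The graph of the identity followed by the erasure is two of the three additions in a swap, the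
missing first one being trivial on zero wires. After the swap, the zeros are on the wires that get
ended. -/
theorem normal_id (n : ℕ) :
    normal (fun _ => true) (fun x => x) (fun x => x) = (1 : H n n) := by
  have h : graph (fun _ => true) n (fun x : Fin n → Bool => x) ≫
      adds (Fin.natAdd n) (Fin.castAdd n) (fun x => x) = zeros n n ≫ sw n n := by
    rw [← adds_conj, graph_true, comp_mul, comp_mul, zeros_comp_adds]
  rw [normal, ← Category.assoc, h, Category.assoc, zeros_comp_sw_comp_kill]

/-! ### Completeness -/

/-- Maps with a normal form. -/
def IsNormal {n m : ℕ} (f : H n m) : Prop :=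
  ∃ d φ ψ, f = normal d φ ψ ∧ ∀ x, d x = true → ψ (φ x) = x

theorem toffoli_toffoli {n : ℕ} {a b c : Fin n} (hac : a ≠ c) (hbc : b ≠ c) (x : Fin n → Bool) :
    toffoli a b c (toffoli a b c x) = x := by
  funext i
  rcases eq_or_ne i c with rfl | hi
  · have e : ∀ z : Fin n → Bool, toffoli a b i z i = xor (z i) (z a && z b) := fun z => upd_self
    have e' : ∀ j, j ≠ i → toffoli a b i x j = x j := fun j hj => upd_of_ne hj
    rw [e, e, e' a hac, e' b hbc, Bool.xor_assoc, Bool.xor_self, Bool.xor_false]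
  · exact (upd_of_ne hi).trans (upd_of_ne hi)

/-- Besides the shape, the condition `ψ (φ x) = x` has to survive: the Toffoli action is an
involution, an added bit is forgotten by the new `ψ`, and a removed bit is restored as true, its
only possible value on the smaller domain. -/
theorem IsNormal.comp {n m k : ℕ} {f : H n m} (hf : IsNormal f) {g : H m k} (hg : Gen g) :
    IsNormal (f ≫ g) := by
  induction hg with
  | T i j k =>
    by_cases h : Function.Injective ![i, j, k]
    · obtain ⟨d, φ, ψ, rfl, hψ⟩ := hf
      have hij : i ≠ j := h.ne (a₁ := 0) (a₂ := 1) (by decide)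
      have hik : i ≠ k := h.ne (a₁ := 0) (a₂ := 2) (by decide)
      have hjk : j ≠ k := h.ne (a₁ := 1) (a₂ := 2) (by decide)
      refine ⟨_, _, _, normal_comp_T hij hik hjk, fun x hx => ?_⟩
      rw [toffoli_toffoli hik hjk, hψ x hx]
    · rw [T_of_not_injective h, comp_one]
      exact hf
  | addBit m =>
    obtain ⟨d, φ, ψ, rfl, hψ⟩ := hf
    refine ⟨_, _, _, normal_comp_addBit_true, fun x hx => ?_⟩
    rw [Fin.init_snoc, hψ x hx]
  | removeBit m =>
    obtain ⟨d, φ, ψ, rfl, hψ⟩ := hf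
    refine ⟨_, _, _, normal_comp_removeBit_true, fun x hx => ?_⟩
    rw [Bool.and_eq_true] at hx
    have e : Fin.snoc (α := fun _ => Bool) (Fin.init (φ x)) true = φ x := by
      rw [← hx.2, Fin.snoc_init_self]
    rw [e, hψ x hx.1]
  | strands h =>
    subst h
    rw [strands_rfl, Category.comp_id]
    exact hf
  | comp _ _ hg hh =>
    rw [← Category.assoc]
    exact hh (hg hf)

theorem isNormal {n m : ℕ} (f : H n m) : IsNormal f := by
  have h : IsNormal (1 : H n n) := ⟨_, _, _, (normal_id n).symm, fun _ _ => rfl⟩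
  have h' := h.comp (gen f)
  rwa [one_comp] at h'

/-- Maps are determined by their values. -/
theorem evalHom_injective {n m : ℕ} {f g : H n m} (h : evalHom f = evalHom g) : f = g := by
  obtain ⟨d, φ, ψ, rfl, hψ⟩ := isNormal f
  obtain ⟨d', φ', ψ', rfl, hψ'⟩ := isNormal g
  have e : ∀ x, (if d x = true then some (φ x) else none) =
      if d' x = true then some (φ' x) else none := by
    intro x
    have := congrFun h x
    rw [evalHom_normal, evalHom_normal] at this
    -- The left-inverse condition is automatic on the domain, so the values show exactly `d` and `φ`
    -- on `d`.
    simpa only [and_iff_left_of_imp (hψ x), and_iff_left_of_imp (hψ' x)] using this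
  have hd : d = d' := by
    funext x
    have := e x
    cases h1 : d x <;> cases h2 : d' x <;> simp_all
  subst hd
  have hφ : ∀ x, d x = true → φ x = φ' x := by
    intro x hx
    have := e x
    rwa [if_pos hx, if_pos hx, Option.some.injEq] at this
  refine normal_congr rfl hφ fun x hx => ?_
  rw [hψ x hx, hφ x hx, hψ' x hx]

theorem eqv_iff_eval_eq {n m : ℕ} (c d : Circuit n m) : Circuit.Eqv c d ↔ c.eval = d.eval :=
  ⟨Circuit.eval_eq_of_eqv, fun h => (ofCircuit_eq_iff c d).1 (evalHom_injective h)⟩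

/-- Every partial injection is the value of a map. -/
theorem exists_evalHom {n m : ℕ} (φ : (Fin n → Bool) ≃. (Fin m → Bool)) :
    ∃ f : H n m, ∀ x, evalHom f x = φ x := by
  -- The default rows are immaterial: `φ` is cut off outside its domain by `d`, and `ψ` only ever
  -- sees values of `φ` on that domain.
  refine ⟨normal (fun x => (φ x).isSome) (fun x => (φ x).getD fun _ => false)
    (fun y => (φ.symm y).getD fun _ => false), fun x => ?_⟩
  rw [evalHom_normal]
  cases h : φ x with
  | none => simp
  | some y =>
    have h' : φ.symm y = some x := (PEquiv.eq_some_iff φ).2 h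
    simp [h']

end TOF

/-! ### The flip of a circuit is its partial inverse -/

theorem Circuit.append_eq_append_iff {n m : ℕ} {x y : Fin n → Bool} {x' y' : Fin m → Bool} :
    Fin.append x x' = Fin.append y y' ↔ x = y ∧ x' = y' := by
  constructor
  · intro h
    constructor
    · funext i
      simpa only [Fin.append_left] using congrFun h (Fin.castAdd m i)
    · funext i
      simpa only [Fin.append_right] using congrFun h (Fin.natAdd n i)
  · rintro ⟨rfl, rfl⟩
    rfl

theorem Circuit.eval_flip {n m : ℕ} (c : Circuit n m) (x : Fin n → Bool) (y : Fin m → Bool) :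
    c.flip.eval y = some x ↔ c.eval x = some y := by
  induction c with
  | wire h =>
    subst h
    exact Option.some_inj.trans (eq_comm.trans Option.some_inj.symm)
  | comp f g ihf ihg =>
    simp only [flip, eval_comp, Option.bind_eq_some_iff, ihf, ihg, and_comm]
  | tensor f g ihf ihg =>
    obtain ⟨x, x', rfl⟩ := exists_append x
    obtain ⟨y, y', rfl⟩ := exists_append y
    simp only [flip, eval_append, Option.bind_eq_some_iff, Option.map_eq_some_iff,
      Circuit.append_eq_append_iff, ihf, ihg, ← exists_and_left]
    grind
  | swap n m =>
    obtain ⟨x, x', rfl⟩ := exists_append x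
    obtain ⟨y, y', rfl⟩ := exists_append y
    simp only [flip, eval_swap, Option.some_inj, Circuit.append_eq_append_iff]
    grind
  | ketOne => revert x y; decide +kernel
  | braOne => revert x y; decide +kernel
  | tof => revert x y; decide +kernel

/-- Completeness spares flipping each identity: flipped circuits compute inverse partial functions,
so equal values remain equal. -/
theorem Circuit.flip_eqv {n m : ℕ} {c d : Circuit n m} (h : Eqv c d) : Eqv c.flip d.flip := by
  refine (TOF.eqv_iff_eval_eq _ _).2 (funext fun y => Option.ext fun x => ?_)
  rw [eval_flip, eval_flip, eval_eq_of_eqv h]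

namespace TOF

/-- The horizontal flip of a map. -/
def dagger {n m : ℕ} : H n m → H m n := Quotient.map Circuit.flip fun _ _ h => Circuit.flip_eqv h

theorem evalHom_dagger {n m : ℕ} (f : H n m) (x : Fin n → Bool) (y : Fin m → Bool) :
    evalHom (dagger f) y = some x ↔ evalHom f x = some y := by
  obtain ⟨c⟩ := f
  exact Circuit.eval_flip c x y

theorem hom_ext_of_evalHom {n m : ℕ} {f g : H n m}
    (h : ∀ x y, evalHom f x = some y ↔ evalHom g x = some y) : f = g :=
  evalHom_injective (funext fun x => Option.ext fun y => h x y)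

theorem evalHom_comp_eq_some {n m k : ℕ} (f : H n m) (g : H m k) (x : Fin n → Bool)
    (z : Fin k → Bool) :
    evalHom (f ≫ g) x = some z ↔ ∃ y, evalHom f x = some y ∧ evalHom g y = some z := by
  rw [evalHom_comp, Option.bind_eq_some_iff]

theorem evalHom_inj {n m : ℕ} {f : H n m} {x x' : Fin n → Bool} {y : Fin m → Bool}
    (h : evalHom f x = some y) (h' : evalHom f x' = some y) : x = x' :=
  Option.some_inj.1 (((evalHom_dagger f x y).2 h).symm.trans ((evalHom_dagger f x' y).2 h'))

theorem evalHom_comp_dagger {n m : ℕ} (f : H n m) (x x' : Fin n → Bool) :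
    evalHom (f ≫ dagger f) x = some x' ↔ x = x' ∧ (evalHom f x).isSome := by
  simp only [evalHom_comp_eq_some, evalHom_dagger, Option.isSome_iff_exists]
  constructor
  · rintro ⟨y, h, h'⟩
    exact ⟨evalHom_inj h h', y, h⟩
  · rintro ⟨rfl, y, h⟩
    exact ⟨y, h, h⟩

/-- Flipping circuits makes `TOF` an inverse category. -/
def inverseStructure : InverseStructure TOF where
  dagger f := dagger f
  dagger_id _ := rfl
  dagger_comp := by rintro _ _ _ ⟨f⟩ ⟨g⟩; rfl
  dagger_dagger {X Y} f := hom_ext_of_evalHom (n := X.wires) (m := Y.wires) fun x y => by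
    rw [evalHom_dagger, evalHom_dagger]
  comp_dagger_comp {X Y} f := by
    rw [← Category.assoc]
    refine hom_ext_of_evalHom (n := X.wires) (m := Y.wires) fun x y => ?_
    refine (evalHom_comp_eq_some (n := X.wires) (m := X.wires) _ _ _ _).trans ?_
    constructor
    · rintro ⟨x', h, h'⟩
      rwa [((evalHom_comp_dagger _ _ _).1 h).1]
    · exact fun h => ⟨x, (evalHom_comp_dagger _ _ _).2 ⟨rfl, Option.isSome_of_eq_some h⟩, h⟩
  idem_comm {X Y Z} f g := by
    refine hom_ext_of_evalHom (n := X.wires) (m := X.wires) fun x y => ?_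
    refine (evalHom_comp_eq_some (n := X.wires) (m := X.wires) _ _ _ _).trans
      (Iff.trans ?_ (evalHom_comp_eq_some (n := X.wires) (m := X.wires) _ _ _ _).symm)
    simp only [evalHom_comp_dagger]
    grind

theorem isTotal_iff {n m : ℕ} (f : H n m) :
    inverseStructure.IsTotal f ↔ ∀ x, (evalHom f x).isSome := by
  constructor
  · intro h x
    have h' : evalHom (f ≫ dagger f) x = some x := congrArg (fun g => evalHom g x) h
    exact ((evalHom_comp_dagger f x x).1 h').2
  · intro h
    refine hom_ext_of_evalHom (n := n) (m := n) fun x x' => (evalHom_comp_dagger f x x').trans ?_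
    rw [evalHom_id, Option.some_inj, and_iff_left (h x)]

/-! ### The diagonals -/

theorem evalHom_wire_assoc {a b c : ℕ} (x : Fin a → Bool) (y : Fin b → Bool) (z : Fin c → Bool) :
    evalHom (ofCircuit (Circuit.wire (add_assoc a b c))) (Fin.append (Fin.append x y) z) =
      some (Fin.append x (Fin.append y z)) := Circuit.eval_wire_assoc x y z

theorem evalHom_wire_assoc_symm {a b c : ℕ} (x : Fin a → Bool) (y : Fin b → Bool)
    (z : Fin c → Bool) :
    evalHom (ofCircuit (Circuit.wire (add_assoc a b c).symm)) (Fin.append x (Fin.append y z)) =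
      some (Fin.append (Fin.append x y) z) := Circuit.eval_wire_assoc' x y z

theorem evalHom_tensorμ {a b c d : ℕ} (x : Fin a → Bool) (y : Fin b → Bool) (z : Fin c → Bool)
    (w : Fin d → Bool) :
    evalHom (n := a + b + (c + d)) (m := a + c + (b + d))
      (tensorμ (TOF.mk a) (TOF.mk b) (TOF.mk c) (TOF.mk d))
      (Fin.append (Fin.append x y) (Fin.append z w)) =
      some (Fin.append (Fin.append x z) (Fin.append y w)) := by
  have hβ := evalHom_tens (ofCircuit (Circuit.swap b c)) (one d) (Fin.append y z) w
  rw [evalHom_ofCircuit, Circuit.eval_swap] at hβ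
  have h2 := evalHom_tens (one a) (ofCircuit (Circuit.wire (add_assoc b c d).symm)) x
    (Fin.append y (Fin.append z w))
  rw [evalHom_wire_assoc_symm] at h2
  have h3 := evalHom_tens (one a) (tens (ofCircuit (Circuit.swap b c)) (one d)) x
    (Fin.append (Fin.append y z) w)
  rw [hβ] at h3
  have h4 := evalHom_tens (one a) (ofCircuit (Circuit.wire (add_assoc c b d))) x
    (Fin.append (Fin.append z y) w)
  rw [evalHom_wire_assoc] at h4
  refine (evalHom_comp_of (evalHom_wire_assoc x y (Fin.append z w)) _).trans ?_
  refine (evalHom_comp_of h2 _).trans ?_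
  refine (evalHom_comp_of h3 _).trans ?_
  exact (evalHom_comp_of h4 _).trans (evalHom_wire_assoc_symm x z (Fin.append y w))

/-- The diagonal as a map from `n` to `n + n` wires. -/
abbrev dup (n : ℕ) : H n (n + n) := diag n

theorem evalHom_dup (n : ℕ) (x : Fin n → Bool) : evalHom (dup n) x = some (Fin.append x x) := by
  have h1 : ∀ x : Fin 1 → Bool, evalHom (n := 1) (m := 1 + 1) diagOne x =
      some (Fin.append x x) := by decide +kernel
  induction n with
  | zero => exact congrArg some (funext fun i => i.elim0)
  | succ n ih =>
    cases n with
    | zero => exact h1 x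
    | succ n =>
      obtain ⟨x, z, rfl⟩ := Circuit.exists_append x
      have h2 := evalHom_tens (dup (n + 1)) (n' := 1) (m' := 1 + 1) diagOne x z
      rw [ih, h1] at h2
      exact (evalHom_comp_of h2 _).trans (evalHom_tensorμ x x z z)

theorem evalHom_dagger_dup {n : ℕ} (x y : Fin n → Bool) :
    evalHom (dagger (dup n)) (Fin.append x y) = if x = y then some x else none := by
  split
  · next h =>
    subst h
    exact (evalHom_dagger _ _ _).2 (evalHom_dup n x)
  · next h =>
    refine Option.eq_none_iff_forall_ne_some.2 fun z hz => h ?_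
    have e := Option.some_inj.1 ((evalHom_dup n z).symm.trans ((evalHom_dagger _ _ _).1 hz))
    obtain ⟨rfl, rfl⟩ := Circuit.append_eq_append_iff.1 e
    rfl

theorem dup_natural {n m : ℕ} (f : H n m) : f ≫ dup m = dup n ≫ tens f f := by
  refine evalHom_injective (funext fun x => ?_)
  rw [evalHom_comp_of (evalHom_dup n x), evalHom_comp, evalHom_tens]
  cases evalHom f x with
  | none => rfl
  | some y => exact evalHom_dup m y

theorem dup_swap (n : ℕ) : dup n ≫ ofCircuit (Circuit.swap n n) = dup n := by
  refine evalHom_injective (funext fun x => ?_)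
  rw [evalHom_comp_of (evalHom_dup n x), evalHom_dup]
  exact Circuit.eval_swap x x

theorem dup_assoc (n : ℕ) : dup n ≫ tens (one n) (dup n) =
    dup n ≫ tens (dup n) (one n) ≫ ofCircuit (Circuit.wire (add_assoc n n n)) := by
  refine evalHom_injective (funext fun x => ?_)
  rw [evalHom_comp_of (evalHom_dup n x), evalHom_comp_of (evalHom_dup n x), evalHom_comp,
    evalHom_tens, evalHom_tens, evalHom_dup]
  exact (Circuit.eval_wire_assoc x x x).symm

theorem dup_frobenius_left (n : ℕ) : tens (dup n) (one n) ≫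
    ofCircuit (Circuit.wire (add_assoc n n n)) ≫ tens (one n) (dagger (dup n)) =
      dagger (dup n) ≫ dup n := by
  refine evalHom_injective (funext fun x => ?_)
  obtain ⟨x, y, rfl⟩ := Circuit.exists_append x
  have h := evalHom_tens (dup n) (one n) x y
  rw [evalHom_dup, evalHom_id, Option.bind_some, Option.map_some] at h
  rw [evalHom_comp_of h, evalHom_comp_of (evalHom_wire_assoc x x y), evalHom_tens,
    evalHom_comp, evalHom_dagger_dup]
  split
  · next h =>
    subst h
    exact (evalHom_dup n x).symm
  · rfl

theorem dup_frobenius_right (n : ℕ) : tens (one n) (dup n) ≫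
    ofCircuit (Circuit.wire (add_assoc n n n).symm) ≫ tens (dagger (dup n)) (one n) =
      dagger (dup n) ≫ dup n := by
  refine evalHom_injective (funext fun x => ?_)
  obtain ⟨x, y, rfl⟩ := Circuit.exists_append x
  have h := evalHom_tens (one n) (dup n) x y
  rw [evalHom_dup, evalHom_id, Option.bind_some, Option.map_some] at h
  rw [evalHom_comp_of h, evalHom_comp_of (evalHom_wire_assoc_symm x y y), evalHom_tens,
    evalHom_comp, evalHom_dagger_dup]
  split
  · next h =>
    subst h
    exact (evalHom_dup n x).symm
  · rfl

theorem dup_add (n m : ℕ) : dup (n + m) = tens (dup n) (dup m) ≫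
    (tensorμ (TOF.mk n) (TOF.mk n) (TOF.mk m) (TOF.mk m) :) := by
  refine evalHom_injective (funext fun x => ?_)
  obtain ⟨x, y, rfl⟩ := Circuit.exists_append x
  have h := evalHom_tens (dup n) (dup m) x y
  rw [evalHom_dup, evalHom_dup] at h
  rw [evalHom_dup]
  exact ((evalHom_comp_of h _).trans (evalHom_tensorμ x x y y)).symm

/-- `TOF` is a discrete inverse category. -/
def discreteInverse : DiscreteInverseStructure TOF where
  toInverseStructure := inverseStructure
  dagger_tensor := by rintro _ _ _ _ ⟨f⟩ ⟨g⟩; rfl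
  diag X := diag X.wires
  diag_total X := (isTotal_iff (dup X.wires)).2 fun x => by rw [evalHom_dup]; rfl
  diag_natural f := dup_natural f
  diag_comm X := dup_swap X.wires
  diag_assoc X := dup_assoc X.wires
  frobenius_left X := dup_frobenius_left X.wires
  frobenius_right X := dup_frobenius_right X.wires
  diag_tensor X Y := dup_add X.wires Y.wires

end TOF

/-! ### Discrete inverse equivalences -/

/-- Cancelling the isomorphism on both sides of `f f° f = f` leaves its ordinary inverse. -/
theorem InverseStructure.dagger_iso {C : Type u} [Category.{v} C] (I : InverseStructure C)
    {X Y : C} (e : X ≅ Y) : I.dagger e.hom = e.inv := by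
  rw [← cancel_mono e.hom, ← cancel_epi e.hom, I.comp_dagger_comp, e.inv_hom_id, Category.comp_id]

section

variable {C : Type u} [Category.{v} C] [MonoidalCategory C] [SymmetricCategory C] {D : Type u'}
  [Category.{v'} D] [MonoidalCategory D] [SymmetricCategory D] {S : DiscreteInverseStructure C}
  {T : DiscreteInverseStructure D}

open Functor.LaxMonoidal Functor.OplaxMonoidal Functor.Monoidal

/-- A functor isomorphic to a braided functor is braided. -/
abbrev CategoryTheory.Functor.Braided.transport {F F' : C ⥤ D} [F.Braided] (i : F ≅ F') :
    F'.Braided :=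
  letI : F'.Monoidal := Functor.Monoidal.transport i
  { braided X Y := by
      have h := i.hom.naturality (β_ X Y).hom
      rw [transport_μ, transport_μ, Category.assoc, Category.assoc, ← h,
        Functor.LaxBraided.braided_assoc, BraidedCategory.braiding_naturality_assoc] }

/-- The dagger of an isomorphism is its inverse and diagonals are natural, so both preservation laws
are invariant under natural isomorphism. -/
theorem IsDiscreteInverseFunctor.transport {F F' : C ⥤ D} [F.Braided]
    (hF : IsDiscreteInverseFunctor S T F) (i : F ≅ F') :
    letI := Functor.Braided.transport i
    IsDiscreteInverseFunctor S T F' := by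
  let := Functor.Braided.transport i
  have e : ∀ {X Y : C} (f : X ⟶ Y), F'.map f = i.inv.app X ≫ F.map f ≫ i.hom.app Y := by
    intro X Y f
    rw [i.hom.naturality, Iso.inv_hom_id_app_assoc]
  refine ⟨fun {X Y} f => ?_, fun X => ?_⟩
  · have h := T.dagger_iso (i.app Y)
    have h' := T.dagger_iso (i.symm.app X)
    dsimp at h h'
    rw [e, e, T.dagger_comp, T.dagger_comp, hF.map_dagger, h, h', Category.assoc]
  · rw [e, hF.map_diag, transport_μ, ← Category.assoc (T.diag _), ← T.diag_natural]
    simp only [Category.assoc]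

/-- The inverse functor carries the monoidal structure induced by the equivalence. That it respects
braiding, dagger and diagonal is checked after applying the faithful functor `e.functor`, where the
counit reduces each claim to the corresponding law in `D`. -/
theorem IsDiscreteInverseFunctor.isDiscreteInverseEquivalence {e : C ≌ D} [e.functor.Braided]
    (hF : IsDiscreteInverseFunctor S T e.functor) : IsDiscreteInverseEquivalence S T e.functor := by
  let : e.inverse.Monoidal := e.inverseMonoidal
  have : e.IsMonoidal := ⟨rfl, fun _ _ => rfl⟩
  have hη : NatTrans.IsMonoidal e.unitIso.hom := inferInstanceAs (NatTrans.IsMonoidal e.unit)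
  have hε : NatTrans.IsMonoidal e.counitIso.hom := inferInstanceAs (NatTrans.IsMonoidal e.counit)
  have hμ : ∀ X Y : D, e.functor.map (μ e.inverse X Y) ≫ e.counitIso.hom.app (X ⊗ Y) =
      δ e.functor _ _ ≫ (e.counitIso.hom.app X ⊗ₘ e.counitIso.hom.app Y) :=
    e.functor_map_μ_inverse_comp_counitIso_hom_app_tensor
  let hG : e.inverse.Braided :=
    { braided X Y := by
        apply e.functor.map_injective
        rw [← cancel_mono (e.counitIso.hom.app _), Functor.map_comp, Functor.map_comp,
          Category.assoc, Category.assoc, hμ, Functor.map_braiding e.functor]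
        have h := e.counitIso.hom.naturality (β_ X Y).hom
        dsimp at h
        rw [h, reassoc_of% hμ, BraidedCategory.braiding_naturality]
        simp }
  refine ⟨inferInstance, e.inverse, hG, e.unitIso, e.counitIso, hF,
    ⟨fun {X Y} f => ?_, fun X => ?_⟩, hη, hε⟩
  · apply e.functor.map_injective
    have h := e.counitIso.inv.naturality
    have h1 := T.dagger_iso (e.counitIso.app X)
    have h2 := T.dagger_iso (e.counitIso.symm.app Y)
    dsimp at h h1 h2
    rw [hF.map_dagger]
    simp [T.dagger_comp, h1, h2]
  · apply e.functor.map_injective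
    have h := e.counitIso.hom.naturality (T.diag X)
    dsimp at h
    rw [← cancel_mono (e.counitIso.hom.app _), h, Functor.map_comp, Category.assoc, hμ,
      hF.map_diag, Category.assoc, μ_δ_assoc]
    exact T.diag_natural _

end

namespace TOF

/-! ### The realization of circuits as partial injections of bits -/

theorem isPow2_bits (n : ℕ) : Pinj.IsPow2 ⟨Fin n → Bool⟩ := ⟨n, by simp⟩

/-- Circuits as partial injections between sets of bits. -/
def realization : TOF ⥤ FPinj₂ where
  obj X := ⟨⟨Fin X.wires → Bool⟩, isPow2_bits X.wires⟩
  map {X Y} f := ObjectProperty.homMk (Pinj.mk' (X := ⟨Fin X.wires → Bool⟩)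
    (Y := ⟨Fin Y.wires → Bool⟩) (evalHom f) (evalHom (dagger f)) (evalHom_dagger f))
  map_id _ := rfl
  map_comp f g := ObjectProperty.hom_ext _ (Pinj.hom_ext fun x => evalHom_comp f g x)

theorem app_realization {X Y : TOF} (f : X ⟶ Y) (x : Fin X.wires → Bool) :
    Pinj.app (realization.map f).hom x = evalHom (n := X.wires) (m := Y.wires) f x := rfl

instance : realization.Faithful where
  map_injective {X Y} f g h := evalHom_injective (n := X.wires) (m := Y.wires) (funext fun x => by
    rw [← app_realization, ← app_realization, h])

instance : realization.Full where
  map_surjective {X Y} φ := by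
    obtain ⟨f, hf⟩ := exists_evalHom (n := X.wires) (m := Y.wires) φ.hom
    exact ⟨f, ObjectProperty.hom_ext _ (Pinj.hom_ext hf)⟩

instance : realization.EssSurj where
  mem_essImage := by
    rintro ⟨⟨Y⟩, n, hn⟩
    have : Finite Y := Nat.finite_of_card_ne_zero (by rw [hn]; positivity)
    have e : (Fin n → Bool) ≃ Y := Classical.choice
      (Finite.card_eq.1 ((by simp : _ = 2 ^ n).trans hn.symm))
    exact ⟨⟨n⟩, ⟨ObjectProperty.isoMk _
      (Pinj.isoOfEquiv (X := ⟨Fin n → Bool⟩) (Y := ⟨Y⟩) e)⟩⟩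

instance : realization.IsEquivalence where

/-- Pairs of rows of bits as rows of bits. -/
def appendEquiv (n m : ℕ) : (Fin n → Bool) × (Fin m → Bool) ≃ (Fin (n + m) → Bool) where
  toFun p := Fin.append p.1 p.2
  invFun x := (fun i => x (Fin.castAdd m i), fun i => x (Fin.natAdd n i))
  left_inv p := by simp
  right_inv x := Fin.append_castAdd_natAdd

def coreMonoidalRealization : realization.CoreMonoidal where
  εIso := ObjectProperty.isoMk _ (Pinj.isoOfEquiv (X := ⟨PUnit⟩) (Y := ⟨Fin 0 → Bool⟩)
    (Equiv.ofUnique _ _))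
  μIso X Y := ObjectProperty.isoMk _ (Pinj.isoOfEquiv
    (X := ⟨(Fin X.wires → Bool) × (Fin Y.wires → Bool)⟩)
    (Y := ⟨Fin (X.wires + Y.wires) → Bool⟩) (appendEquiv X.wires Y.wires))
  μIso_hom_natural_left {X Y} f Z := ObjectProperty.hom_ext _ (Pinj.hom_ext (by
    rintro ⟨x, z⟩
    refine Eq.trans ?_ (evalHom_tens f (one Z.wires) x z).symm
    change Option.bind ((evalHom (n := X.wires) (m := Y.wires) f x).bind fun y => some (y, z))
      (fun p => some (Fin.append p.1 p.2)) = _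
    cases evalHom (n := X.wires) (m := Y.wires) f x <;> rfl))
  μIso_hom_natural_right {X Y} Z f := ObjectProperty.hom_ext _ (Pinj.hom_ext (by
    rintro ⟨z, x⟩
    refine Eq.trans ?_ (evalHom_tens (one Z.wires) f z x).symm
    change Option.bind ((evalHom (n := X.wires) (m := Y.wires) f x).map fun y => (z, y))
      (fun p => some (Fin.append p.1 p.2)) = (evalHom _ x).map _
    cases evalHom (n := X.wires) (m := Y.wires) f x <;> rfl))
  associativity X Y Z := ObjectProperty.hom_ext _ (Pinj.hom_ext (by
    rintro ⟨⟨x, y⟩, z⟩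
    exact evalHom_wire_assoc x y z))
  left_unitality X := ObjectProperty.hom_ext _ (Pinj.hom_ext (by
    rintro ⟨⟨⟩, x⟩
    refine congrArg some (funext fun i => ?_)
    exact ((congrArg (Fin.append (fun j : Fin 0 => j.elim0) x)
      (Fin.ext (Nat.zero_add i.val).symm : Fin.cast (zero_add X.wires).symm i = Fin.natAdd 0 i)).trans
        (Fin.append_right _ x i)).symm))
  right_unitality X := ObjectProperty.hom_ext _ (Pinj.hom_ext (by
    rintro ⟨x, ⟨⟩⟩
    exact congrArg some (funext fun i => (Fin.append_left x _ i).symm)))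

instance : realization.Monoidal := coreMonoidalRealization.toMonoidal

instance : realization.Braided where
  braided X Y := ObjectProperty.hom_ext _ (Pinj.hom_ext (by
    rintro ⟨x, y⟩
    exact Circuit.eval_swap x y))

theorem isDiscreteInverseFunctor_realization :
    IsDiscreteInverseFunctor discreteInverse FPinj₂.discreteInverse realization where
  map_dagger _ := ObjectProperty.hom_ext _ (Pinj.hom_ext fun _ => rfl)
  map_diag X := ObjectProperty.hom_ext _ (Pinj.hom_ext fun x => evalHom_dup X.wires x)

/-! ### Total points -/

theorem evalHom_ketBit (b : Bool) (x : Fin 0 → Bool) :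
    evalHom (ofCircuit (Circuit.ketBit b)) x = some ![b] := by
  revert x
  cases b <;> decide +kernel

theorem evalHom_ket (n : ℕ) (x : Fin n → Bool) (y : Fin 0 → Bool) :
    evalHom (ket n x) y = some x := by
  induction n with
  | zero => exact congrArg some (funext fun i => i.elim0)
  | succ n ih =>
    have h := evalHom_tens (ket n (Fin.init x)) (ofCircuit (Circuit.ketBit (x (Fin.last n)))) y y
    rw [ih, evalHom_ketBit, Option.bind_some, Option.map_some, append_single,
      Fin.snoc_init_self] at h
    refine Eq.trans ?_ h
    exact congrArg (evalHom (ket (n + 1) x)) (funext fun i => i.elim0)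

theorem eq_ket_iff {n : ℕ} (p : H 0 n) (x : Fin n → Bool) :
    p = ket n x ↔ evalHom p ![] = some x := by
  constructor
  · rintro rfl
    exact evalHom_ket n x _
  · intro h
    refine evalHom_injective (funext fun y => ?_)
    rw [evalHom_ket, ← h]
    exact congrArg (evalHom p) (Subsingleton.elim _ _)

theorem ket_comp_eq_ket_iff {n m : ℕ} (f : H n m) (x : Fin n → Bool) (y : Fin m → Bool) :
    ket n x ≫ f = ket m y ↔ evalHom f x = some y := by
  rw [eq_ket_iff, evalHom_comp_of (evalHom_ket n x _)]

theorem ket_injective (n : ℕ) : Function.Injective (ket n) := fun x y h => by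
  have h' := (eq_ket_iff _ _).1 h
  rw [evalHom_ket] at h'
  exact Option.some_inj.1 h'

/-- A point has a single input, the empty row: it is total exactly when it has a value there, and by
faithfulness it is then the ket of that value. -/
theorem isTotal_point_iff {n : ℕ} (p : H 0 n) :
    discreteInverse.IsTotal p ↔ ∃ x, ket n x = p := by
  refine (isTotal_iff p).trans ?_
  simp only [eq_comm (b := p), eq_ket_iff, ← Option.isSome_iff_exists]
  constructor
  · exact fun h => h _
  · intro h y
    rwa [Subsingleton.elim y ![]]

/-- Rows of bits as total points. -/
noncomputable def ketEquiv (n : ℕ) :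
    (Fin n → Bool) ≃ {p : H 0 n // discreteInverse.IsTotal p} :=
  Equiv.ofBijective (fun x => ⟨ket n x, (isTotal_point_iff _).2 ⟨x, rfl⟩⟩)
    ⟨fun _ _ h => ket_injective n (Subtype.mk.inj h), fun ⟨p, hp⟩ => by
      obtain ⟨x, rfl⟩ := (isTotal_point_iff p).1 hp
      exact ⟨x, rfl⟩⟩

theorem isPow2_points (X : TOF) :
    Pinj.IsPow2 ((discreteInverse.pointFunctor (TOF.mk 0)).obj X) :=
  ⟨X.wires, (Nat.card_congr (ketEquiv X.wires)).symm.trans (by simp)⟩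

/-- Circuits act in the same way on rows of bits and on total points. -/
noncomputable def realizationIso : realization ≅
    Pinj.IsPow2.lift (discreteInverse.pointFunctor (TOF.mk 0)) isPow2_points :=
  NatIso.ofComponents
    (fun X => ObjectProperty.isoMk _ (Pinj.isoOfEquiv (X := ⟨Fin X.wires → Bool⟩)
      (Y := discreteInverse.points (TOF.mk 0) X) (ketEquiv X.wires)))
    (fun {X Y} f => ObjectProperty.hom_ext _ (Pinj.hom_ext_iff_some fun x q => by
      obtain ⟨y, rfl⟩ := (ketEquiv Y.wires).surjective q
      refine Iff.trans ?_ (discreteInverse.evalPoint_eq_some f (ketEquiv X.wires x) _).symm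
      refine Iff.trans ?_ (ket_comp_eq_ket_iff (n := X.wires) (m := Y.wires) f x y).symm
      change (evalHom (n := X.wires) (m := Y.wires) f x).bind
        (fun y => some (ketEquiv Y.wires y)) = _ ↔ _
      cases evalHom (n := X.wires) (m := Y.wires) f x with
      | none => simp
      | some z =>
        exact Option.some_inj.trans ((ketEquiv Y.wires).injective.eq_iff.trans
          Option.some_inj.symm)))

/-- The functor of total points inherits its monoidal structure from the realization along
`realizationIso`, and with it the property of being a discrete inverse equivalence. -/
theorem isDiscreteInverseEquivalence_points :
    IsDiscreteInverseEquivalence discreteInverse FPinj₂.discreteInverse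
      (Pinj.IsPow2.lift (discreteInverse.pointFunctor (TOF.mk 0)) isPow2_points) := by
  let hB := Functor.Braided.transport realizationIso
  have := Functor.isEquivalence_of_iso realizationIso
  let e := (Pinj.IsPow2.lift (discreteInverse.pointFunctor (TOF.mk 0)) isPow2_points).asEquivalence
  let : e.functor.Braided := hB
  exact IsDiscreteInverseFunctor.isDiscreteInverseEquivalence (e := e)
    (isDiscreteInverseFunctor_realization.transport realizationIso)

end TOF

theorem mainTheorem1 :
    ∃ S : DiscreteInverseStructure TOF,
      (∀ (n m : ℕ) (c : Circuit n m),
        S.dagger (TOF.ofCircuit c) = TOF.ofCircuit c.flip) ∧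
      (∀ n : ℕ, S.diag (TOF.mk n) = TOF.diag n) ∧
      (∀ n : ℕ, Set.BijOn (TOF.ket n) Set.univ {p | S.IsTotal p}) ∧
      (∃ h : ∀ X : TOF, Pinj.IsPow2 ((S.pointFunctor (TOF.mk 0)).obj X),
        IsDiscreteInverseEquivalence S FPinj₂.discreteInverse
          (Pinj.IsPow2.lift (S.pointFunctor (TOF.mk 0)) h)) ∧
      (∀ (n m : ℕ) (c : Circuit n m) (x : Fin n → Bool) (y : Fin m → Bool),
        TOF.ket n x ≫ TOF.ofCircuit c = TOF.ket m y ↔ c.eval x = some y) ∧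
      (∀ (n m : ℕ) (c d : Circuit n m), Circuit.Eqv c d ↔ c.eval = d.eval) ∧
      (∀ (n m : ℕ) (φ : (Fin n → Bool) ≃. (Fin m → Bool)),
        ∃! f : TOF.mk n ⟶ TOF.mk m,
          ∀ (x : Fin n → Bool) (y : Fin m → Bool),
            TOF.ket n x ≫ f = TOF.ket m y ↔ φ x = some y) := by
  refine ⟨TOF.discreteInverse, fun _ _ _ => rfl, fun _ => rfl, fun n => ?_,
    ⟨TOF.isPow2_points, TOF.isDiscreteInverseEquivalence_points⟩,
    fun n m c x y => TOF.ket_comp_eq_ket_iff _ x y, fun n m c d => TOF.eqv_iff_eval_eq c d,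
    fun n m φ => ?_⟩
  · refine ⟨fun x _ => (TOF.isTotal_point_iff _).2 ⟨x, rfl⟩, (TOF.ket_injective n).injOn,
      fun p hp => ?_⟩
    obtain ⟨x, hx⟩ := (TOF.isTotal_point_iff p).1 hp
    exact ⟨x, trivial, hx⟩
  · obtain ⟨f, hf⟩ := TOF.exists_evalHom φ
    refine ⟨f, fun x y => by rw [TOF.ket_comp_eq_ket_iff, hf], fun g hg => ?_⟩
    refine TOF.hom_ext_of_evalHom fun x y => ?_
    rw [← TOF.ket_comp_eq_ket_iff, hg, hf]
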